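/- Let $\alpha\ge 1$, $\beta,\theta\ge 0$ with $\tfrac12\le\beta+\theta\le 1$, let $0<T\le\infty$, and let $u_0,B_0\in L^2_\sigma(\mathbb R^3)$ (real $L^2$ vector fields on $\mathbb R^3$ whose distributional divergence vanishes). Write $\Lambda^s=(-\Delta)^{s/2}$ for the Fourier multiplier with symbol $|\xi|^s$ and $(\cdot,\cdot)$ for the $L^2(\mathbb R^3)$ pairing. Let $(u,B)$ be a Leray–Hopf weak solution on $(0,T)$ of the fractional MHD system $$u_t+(-\Delta)^\alpha u+(u\cdot\nabla)u-(B\cdot\nabla)B+\nabla p=0,\quad B_t+(-\Delta)^\alpha B+(u\cdot\nabla)B-(B\cdot\nabla)u=0,\quad \operatorname{div}u=\operatorname{div}B=0$$ with initial values $u_0,B_0$; that is, $u,B\in L^\infty(0,T;L^2_\sigma(\mathbb R^3))\cap L^2(0,T;H^\alpha(\mathbb R^3))$ and (i) for all smooth compactly supported divergence-free test fields $\phi,\psi$ on $[0,T)\times\mathbb R^3$, $$\int_0^T\big[(\phi_\tau+(u\cdot\nabla)\phi,u)-(u,\Lambda^{2\alpha}\phi)-((B\cdot\nabla)\phi,B)\big]\,d\tau=-(u_0,\phi(0)),$$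 $$\int_0^T\big[(\psi_\tau+(u\cdot\nabla)\psi,B)-(B,\Lambda^{2\alpha}\psi)-((B\cdot\nabla)\psi,u)\big]\,d\tau=-(B_0,\psi(0));$$ (ii) $\tfrac12\|u(t)\|_{L^2}^2+\tfrac12\|B(t)\|_{L^2}^2+\int_0^t\big(\|\Lambda^\alpha u\|_{L^2}^2+\|\Lambda^\alpha B\|_{L^2}^2\big)\,d\tau\le\tfrac12\|u_0\|_{L^2}^2+\tfrac12\|B_0\|_{L^2}^2$ for all $t\in(0,T)$; (iii) $\|u(t)-u_0\|_{L^2}+\|B(t)-B_0\|_{L^2}\to0$ as $t\to0^+$. For $0\le s<\tfrac32$ and $1\le p<\infty$, let $\mathcal M(\dot H^s\to L^p)$ be the space of measurable $\varphi:\mathbb R^3\to\mathbb R$ with $\|\varphi\|_{\mathcal M(\dot H^s\to L^p)}:=\sup_{0\ne f\in\dot H^s(\mathbb R^3)}\|\varphi f\|_{L^p}/\|f\|_{\dot H^s}<\infty$, and for a vector field put $\|\varphi\|_{\mathcal M^3}^2=\sum_{i=1}^3\|\varphi^i\|_{\mathcal M}^2$. Assume that $$|u|^{\frac2{\beta+\theta}-2}u,\quad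 |B|^{\frac2{\beta+\theta}-2}B\ \in\ L^{\frac{2\alpha(\beta+\theta)}{\alpha-\theta}}\Big(0,T;\mathcal M^3\big(\dot H^{\frac{\theta}{\beta+\theta}}(\mathbb R^3)\to L^{2(\beta+\theta)}(\mathbb R^3)\big)\Big),$$ where the time exponent means $\infty$ when $\alpha=\theta$ (which happens only for $\alpha=\theta=1$, $\beta=0$). Then, after redefinition on a set of times of measure zero, $u$ and $B$ are weakly continuous from $[0,T)$ to $L^2(\mathbb R^3)$ with $u(0)=u_0$ and $B(0)=B_0$, and for these representatives the energy equality $$\tfrac12\|u(t)\|_{L^2}^2+\tfrac12\|B(t)\|_{L^2}^2+\int_0^t\big(\|\Lambda^\alpha u(\tau)\|_{L^2}^2+\|\Lambda^\alpha B(\tau)\|_{L^2}^2\big)\,d\tau=\tfrac12\|u_0\|_{L^2}^2+\tfrac12\|B_0\|_{L^2}^2$$ holds for every $0\le t<T$. -/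

import Mathlib

open MeasureTheory Filter Topology FourierTransform
open scoped ENNReal ContDiff SchwartzMap

namespace FracMHD

/-- Physical (and frequency) space `ℝ³`; also the space of values of real vector fields. -/
abbrev E3 : Type := EuclideanSpace ℝ (Fin 3)

/-- The space of values of complex vector fields on `ℝ³`. -/
abbrev C3 : Type := EuclideanSpace ℂ (Fin 3)

/-- `L²(ℝ³; ℝ³)`. -/
abbrev L2R : Type := Lp E3 2 (volume : Measure E3)

/-- `L²(ℝ³; ℂ³)`. -/
abbrev L2C : Type := Lp C3 2 (volume : Measure E3)

/-! ### The fractional operators `Λ^s` -/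

/-- The inclusion `ℝ³ → ℂ³`. -/
noncomputable def complexify : E3 →L[ℝ] C3 :=
  LinearMap.toContinuousLinearMap
    { toFun := fun v => WithLp.toLp 2 (fun i => ((v i : ℝ) : ℂ))
      map_add' := fun v w => by ext i; simp
      map_smul' := fun c v => by ext i; simp }

/-- A real `L²` vector field regarded as a complex one. -/
noncomputable def toComplex (f : L2R) : L2C := complexify.compLp f

/-- The function `ξ ↦ |ξ|^s f̂(ξ)`. Mathlib's Fourier transform has the kernel `e^{-2πi x·ξ}`, so
the symbol `|ξ|^s` (for the kernel `e^{-i x·ξ}`) is `(2π‖ξ‖)^s` here. -/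
noncomputable def symbolMul (s : ℝ) (f : L2C) : E3 → C3 :=
  fun ξ => (((2 * Real.pi * ‖ξ‖) ^ s : ℝ) : ℂ) • (𝓕 f : L2C) ξ

/-- For `s ≥ 0`: the `L²` field `f` lies in `H^s(ℝ³)`, that is, `|ξ|^s f̂ ∈ L²`. -/
def MemH (s : ℝ) (f : L2R) : Prop := MemLp (symbolMul s (toComplex f)) 2 volume

open Classical in
/-- `Λ^s f = (-Δ)^{s/2} f ∈ L²` for `f ∈ H^s`, the Fourier multiplier with symbol `|ξ|^s`
(and `0` if `f ∉ H^s`). -/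
noncomputable def Lam (s : ℝ) (f : L2R) : L2C :=
  if h : MemLp (symbolMul s (toComplex f)) 2 volume then 𝓕⁻ (h.toLp (symbolMul s (toComplex f)) : L2C) else 0

/-! ### Solenoidal fields and test fields -/

/-- `f ∈ L²_σ`: the divergence of `f` vanishes in the sense of distributions. -/
def IsSolenoidal (f : L2R) : Prop :=
  ∀ ψ : E3 → ℝ, ContDiff ℝ ∞ ψ → HasCompactSupport ψ → ∫ x, fderiv ℝ ψ x (f x) = 0

/-- The set of times `(0,T)`, where `T ≤ ∞`. -/
def times (T : EReal) : Set ℝ := {t | 0 < t ∧ (t : EReal) < T}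

/-- Lebesgue measure on `(0,T)`. -/
noncomputable def timeMeasure (T : EReal) : Measure ℝ := volume.restrict (times T)

/-- Test fields in `C_c^∞([0,T); C^∞_{c,σ}(ℝ³))`, given as restrictions to `t ≥ 0` of smooth
compactly supported divergence-free fields on `(-∞,T) × ℝ³`. -/
structure TestField (T : EReal) where
  toFun : ℝ → E3 → E3
  smooth : ContDiff ℝ ∞ (fun p : ℝ × E3 => toFun p.1 p.2)
  compact : HasCompactSupport (fun p : ℝ × E3 => toFun p.1 p.2)
  support : tsupport (fun p : ℝ × E3 => toFun p.1 p.2) ⊆ {p | (p.1 : EReal) < T}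
  div_free : ∀ t x, ∑ i : Fin 3, (fderiv ℝ (toFun t) x (EuclideanSpace.single i 1)) i = 0

theorem TestField.memLp {T : EReal} (φ : TestField T) (t : ℝ) :
    MemLp (φ.toFun t) 2 (volume : Measure E3) := by
  have hc : Continuous (φ.toFun t) :=
    φ.smooth.continuous.comp (Continuous.prodMk_right t)
  refine hc.memLp_of_hasCompactSupport ?_
  refine HasCompactSupport.of_support_subset_isCompact (φ.compact.isCompact.image continuous_snd) ?_
  intro x hx
  exact ⟨(t, x), subset_tsupport _ hx, rfl⟩

/-- The time slice `φ(t)` as an element of `L²`. -/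
noncomputable def TestField.slice {T : EReal} (φ : TestField T) (t : ℝ) : L2R :=
  (φ.memLp t).toLp (φ.toFun t)

/-- `(φ_τ(t), v)`. -/
noncomputable def TestField.timeDerivPairing {T : EReal} (φ : TestField T) (t : ℝ) (v : L2R) : ℝ :=
  ∫ x, inner ℝ (deriv (fun τ => φ.toFun τ x) t) (v x)

/-- `((a·∇)φ(t), b)`. -/
noncomputable def TestField.transportPairing {T : EReal} (φ : TestField T) (t : ℝ) (a b : L2R) : ℝ :=
  ∫ x, inner ℝ (fderiv ℝ (φ.toFun t) x (a x)) (b x)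

/-- `(v, Λ^{2α} φ(t))`; the complex inner product of `L²` is real here, both fields being real. -/
noncomputable def TestField.dissipationPairing {T : EReal} (φ : TestField T) (α : ℝ) (t : ℝ)
    (v : L2R) : ℝ :=
  (inner ℂ (toComplex v) (Lam (2 * α) (φ.slice t))).re

/-! ### Leray–Hopf weak solutions -/

/-- `u ∈ L^∞(0,T; L²_σ) ∩ L²(0,T; H^α)`. -/
structure InEnergyClass (T : EReal) (α : ℝ) (u : ℝ → L2R) : Prop where
  memLp_top : MemLp u ⊤ (timeMeasure T)
  solenoidal : ∀ᵐ t ∂(timeMeasure T), IsSolenoidal (u t)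
  memLp_two : MemLp u 2 (timeMeasure T)
  memH : ∀ᵐ t ∂(timeMeasure T), MemH α (u t)
  lam_memLp_two : MemLp (fun t => Lam α (u t)) 2 (timeMeasure T)

/-- The total energy at time `t` plus the energy dissipated up to time `t`. -/
noncomputable def energyAndDissipation (α : ℝ) (u B : ℝ → L2R) (t : ℝ) : ℝ :=
  1 / 2 * ‖u t‖ ^ 2 + 1 / 2 * ‖B t‖ ^ 2 +
    ∫ τ in (0 : ℝ)..t, (‖Lam α (u τ)‖ ^ 2 + ‖Lam α (B τ)‖ ^ 2)

/-- `(u,B)` is a Leray–Hopf weak solution on `(0,T)` of the fractional MHD system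
`u_t + Λ^{2α} u + (u·∇)u - (B·∇)B + ∇p = 0`, `B_t + Λ^{2α} B + (u·∇)B - (B·∇)u = 0`,
`div u = div B = 0`, with initial values `u₀, B₀`. -/
structure IsLerayHopf (T : EReal) (α : ℝ) (u₀ B₀ : L2R) (u B : ℝ → L2R) : Prop where
  u_class : InEnergyClass T α u
  B_class : InEnergyClass T α B
  momentum : ∀ φ : TestField T,
    ∫ t in times T, (φ.timeDerivPairing t (u t) + φ.transportPairing t (u t) (u t)
      - φ.dissipationPairing α t (u t) - φ.transportPairing t (B t) (B t))
      = - ∫ x, inner ℝ (u₀ x) (φ.toFun 0 x)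
  induction_eq : ∀ ψ : TestField T,
    ∫ t in times T, (ψ.timeDerivPairing t (B t) + ψ.transportPairing t (u t) (B t)
      - ψ.dissipationPairing α t (B t) - ψ.transportPairing t (B t) (u t))
      = - ∫ x, inner ℝ (B₀ x) (ψ.toFun 0 x)
  energy_inequality : ∀ t ∈ times T,
    energyAndDissipation α u B t ≤ 1 / 2 * ‖u₀‖ ^ 2 + 1 / 2 * ‖B₀‖ ^ 2
  u_initial : Tendsto (fun t => ‖u t - u₀‖) (𝓝[>] 0) (𝓝 0)
  B_initial : Tendsto (fun t => ‖B t - B₀‖) (𝓝[>] 0) (𝓝 0)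

/-- `v` is the representative of `u` that is weakly continuous from `[0,T)` into `L²`. -/
structure IsWeaklyContinuousRepresentative (T : EReal) (u v : ℝ → L2R) : Prop where
  ae_eq : u =ᵐ[timeMeasure T] v
  weakly_continuous : ∀ g : L2R,
    ContinuousOn (fun t => inner ℝ (v t) g) {t : ℝ | 0 ≤ t ∧ (t : EReal) < T}

/-! ### Homogeneous Sobolev spaces and multiplier spaces -/

/-- The function `f` defines a tempered distribution, whose Fourier transform is the function `g`
(for the kernel `e^{-2πi x·ξ}`). -/
structure IsFourierPair (f : E3 → ℝ) (g : E3 → ℂ) : Prop where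
  aesm_left : AEStronglyMeasurable f volume
  aesm_right : AEStronglyMeasurable g volume
  integrable_left : ∀ ψ : 𝓢(E3, ℂ), Integrable (fun x => (f x : ℂ) * ψ x)
  integrable_right : ∀ ψ : 𝓢(E3, ℂ), Integrable (fun ξ => g ξ * ψ ξ)
  pairing : ∀ ψ : 𝓢(E3, ℂ), ∫ x, (f x : ℂ) * (𝓕 ψ : 𝓢(E3, ℂ)) x = ∫ ξ, g ξ * ψ ξ

/-- The norm `‖f‖ = ‖|ξ|^s f̂‖_{L²}` of `Ḣ^s(ℝ³)`, `0 ≤ s < 3/2`, with value `∞` if `f` is not a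
tempered distribution with a function as Fourier transform (this function is a.e. unique, so the
infimum is over at most one class). For `s < 3/2` all elements of `Ḣ^s` are functions. -/
noncomputable def homSobolevNorm (s : ℝ) (f : E3 → ℝ) : ℝ≥0∞ :=
  ⨅ (g : E3 → ℂ) (_ : IsFourierPair f g),
    eLpNorm (fun ξ => (((2 * Real.pi * ‖ξ‖) ^ s : ℝ) : ℂ) * g ξ) 2 volume

/-- `f ∈ Ḣ^s(ℝ³)`. -/
def MemHomSobolev (s : ℝ) (f : E3 → ℝ) : Prop := homSobolevNorm s f < ⊤

/-- `‖φ‖_{M(Ḣ^s → L^p)}`, the supremum of `‖φ f‖_{L^p} / ‖f‖_{Ḣ^s}` over `f ∈ Ḣ^s ∖ {0}`. A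
measurable `φ` belongs to the multiplier space exactly if this is finite. -/
noncomputable def multiplierNorm (s : ℝ) (p : ℝ≥0∞) (φ : E3 → ℝ) : ℝ≥0∞ :=
  ⨆ (f : E3 → ℝ) (_ : MemHomSobolev s f ∧ ¬ f =ᵐ[volume] 0),
    eLpNorm (fun x => φ x * f x) p volume / homSobolevNorm s f

/-- `‖φ‖_{M³(Ḣ^s → L^p)} = (∑ᵢ ‖φᵢ‖²)^{1/2}` for a vector field `φ`. -/
noncomputable def multiplierNorm3 (s : ℝ) (p : ℝ≥0∞) (φ : E3 → E3) : ℝ≥0∞ :=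
  (∑ i : Fin 3, multiplierNorm s p (fun x => φ x i) ^ 2) ^ (1 / 2 : ℝ)

/-- `|v|^r v`. -/
noncomputable def powerField (r : ℝ) (v : L2R) : E3 → E3 := fun x => (‖v x‖ ^ r) • v x

/-- `|v|^r v ∈ L^q(0,T; M³(Ḣ^s → L^p))`. -/
def PowerInMultiplierClass (T : EReal) (q : ℝ≥0∞) (s : ℝ) (p : ℝ≥0∞) (r : ℝ) (v : ℝ → L2R) : Prop :=
  MemLp (fun t => multiplierNorm3 s p (powerField r (v t))) q (timeMeasure T)

end FracMHD

namespace FracMHD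

/-! ### Absolutely continuous functions with values in a Hilbert space -/

/-! The multiplier hypothesis is a disguised form of $u,B\in L^4(0,T;L^4)$, and in that class the
formal energy computation is rigorous.

Put $\gamma=\beta+\theta$ and $\varphi=|u|^{2/\gamma-2}u$. Then $|u|^{2/\gamma}=\varphi\cdot u$, and
its $L^{2\gamma}$ norm is $\|u\|_{L^4}^{2/\gamma}$, so $\|u\|_{L^4}^4\lesssim(\|\varphi\|_{\mathcal
M^3}\|u\|_{\dot H^{\theta/\gamma}})^{2\gamma}$. Interpolating $\dot H^{\theta/\gamma}$ between $L^2$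
(bounded in time) and $\dot H^\alpha$ (square integrable in time) leaves $\|\varphi\|_{\mathcal
M^3}^{2\gamma}\|\Lambda^\alpha u\|^{2\theta/\alpha}$. The time exponent
$2\alpha\gamma/(\alpha-\theta)$ is exactly the one for which Young's inequality makes this
integrable (`exists_integrable_eLpNorm_four_le`).

Consequently the products $u_ju$, $B_jB$, $u_jB$, $B_ju$ lie in $L^2(0,T;L^2)$. Since $\alpha\ge1$,
the time derivatives, after projection onto solenoidal fields, lie in the dual of
$L^2(0,T;H^\alpha)$. A Lions–Magenes argument (`exists_continuous_representative`) then yields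
strongly continuous representatives with $\frac{d}{dt}\|u\|^2=2\langle u_t,u\rangle$. To apply it,
the weak formulation is read on the frequency side: all pairings are divided by $1+|\xi|^{2\alpha}$,
so that every term is a bounded multiplier acting on an $L^2$ field, and the pressure is removed by
testing with curls and projecting (`IsWeakSolution.ae_eq_primitive`). Sharp frequency cut-offs serve
as the approximate identity.

Adding the two balances, the nonlinear terms cancel by the antisymmetry of $((a\cdot\nabla)b,c)$ in
$b,c$ for solenoidal $a\in L^4$ and $b,c\in H^1$ (`sum_inner_prodField_eq_zero`). Only the
dissipation remains (`power_add_power`). -/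

theorem absolutelyContinuousOnInterval_of_dist_le {X Y : Type*} [PseudoMetricSpace X]
    [PseudoMetricSpace Y] {f : ℝ → X} {g : ℝ → Y} {a b : ℝ} {C : ℝ} (hC : 0 < C)
    (hg : AbsolutelyContinuousOnInterval g a b)
    (h : ∀ x ∈ Set.uIcc a b, ∀ y ∈ Set.uIcc a b, dist (f x) (f y) ≤ C * dist (g x) (g y)) :
    AbsolutelyContinuousOnInterval f a b := by
  rw [absolutelyContinuousOnInterval_iff] at hg ⊢
  intro ε hε
  obtain ⟨δ, hδ, H⟩ := hg (ε / C) (div_pos hε hC)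
  refine ⟨δ, hδ, fun E hE hs => ?_⟩
  have h1 := H E hE hs
  calc _ ≤ ∑ i ∈ Finset.range E.1, C * dist (g (E.2 i).1) (g (E.2 i).2) :=
        Finset.sum_le_sum fun i hi => h _ (hE.1 i hi).1 _ (hE.1 i hi).2
    _ = C * ∑ i ∈ Finset.range E.1, dist (g (E.2 i).1) (g (E.2 i).2) := by
        rw [Finset.mul_sum]
    _ < C * (ε / C) := by gcongr
    _ = ε := by field_simp

section Hilbert

variable {H : Type*} [NormedAddCommGroup H] [InnerProductSpace ℂ H]

/-- The increments are dominated by those of the scalar primitive of $\|W\|$, for which absolute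
continuity is classical. -/
theorem absolutelyContinuousOnInterval_primitive {W : ℝ → H} {t : ℝ}
    (hW : IntervalIntegrable W volume 0 t) (x₀ : H) :
    AbsolutelyContinuousOnInterval (fun s => x₀ + ∫ τ in (0 : ℝ)..s, W τ) 0 t := by
  refine absolutelyContinuousOnInterval_of_dist_le one_pos
    (hW.norm.absolutelyContinuousOnInterval_intervalIntegral (c := 0) (by simp)) ?_
  intro x hx y hy
  have hs : ∀ z ∈ Set.uIcc 0 t, IntervalIntegrable W volume 0 z := fun z hz =>
    hW.mono_set (Set.uIcc_subset_uIcc (by simp) hz)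
  have hs' : ∀ z ∈ Set.uIcc 0 t, IntervalIntegrable (fun τ => ‖W τ‖) volume 0 z :=
    fun z hz => (hs z hz).norm
  rw [one_mul, dist_add_left, dist_eq_norm, dist_eq_norm,
    intervalIntegral.integral_interval_sub_left (hs x hx) (hs y hy),
    intervalIntegral.integral_interval_sub_left (hs' x hx) (hs' y hy)]
  exact intervalIntegral.norm_integral_le_abs_integral_norm

variable [CompleteSpace H]

/-- A bounded absolutely continuous curve has an absolutely continuous squared norm, so the
fundamental theorem of calculus applies to its a.e. derivative $2\,\mathrm{Re}\langle W,F\rangle$.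
-/
theorem norm_sq_primitive {W : ℝ → H} {t : ℝ}
    (hW : IntervalIntegrable W volume 0 t) (x₀ : H) :
    ‖x₀ + ∫ τ in (0 : ℝ)..t, W τ‖ ^ 2 = ‖x₀‖ ^ 2 +
      2 * ∫ s in (0 : ℝ)..t, (inner ℂ (W s) (x₀ + ∫ τ in (0 : ℝ)..s, W τ)).re := by
  set F : ℝ → H := fun s => x₀ + ∫ τ in (0 : ℝ)..s, W τ with hF
  have hac : AbsolutelyContinuousOnInterval F 0 t :=
    absolutelyContinuousOnInterval_primitive hW x₀
  obtain ⟨M, hM⟩ := hac.exists_bound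
  have hac2 : AbsolutelyContinuousOnInterval (fun s => ‖F s‖ ^ 2) 0 t := by
    -- The constant bounds $\|F(x)\|+\|F(y)\|$, the factor in the difference of squares; the added 1
    -- keeps it positive.
    refine absolutelyContinuousOnInterval_of_dist_le (C := 2 * |M| + 1) (by positivity) hac ?_
    intro x hx y hy
    have h1 := hM x hx
    have h2 := hM y hy
    have h3 := abs_norm_sub_norm_le (F x) (F y)
    have h4 : ‖F x‖ + ‖F y‖ ≤ 2 * |M| + 1 := by linarith [le_abs_self M]
    rw [Real.dist_eq, dist_eq_norm,
      show ‖F x‖ ^ 2 - ‖F y‖ ^ 2 = (‖F x‖ + ‖F y‖) * (‖F x‖ - ‖F y‖) by ring, abs_mul,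
      abs_of_nonneg (by positivity : 0 ≤ ‖F x‖ + ‖F y‖)]
    gcongr
  have h := hac2.integral_deriv_eq_sub
  have h0 : F 0 = x₀ := by simp [hF]
  rw [h0] at h
  have h' : ∫ s in (0 : ℝ)..t, deriv (fun s => ‖F s‖ ^ 2) s =
      ∫ s in (0 : ℝ)..t, 2 * (inner ℂ (W s) (F s)).re := by
    apply intervalIntegral.integral_congr_ae
    filter_upwards [hW.ae_hasDerivAt_integral] with s hs hsm
    have hd : HasDerivAt F (W s) s :=
      (hs (Set.uIoc_subset_uIcc hsm) 0 (by simp)).const_add x₀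
    -- The derivative formula for the squared norm is a real one; this real inner product is by
    -- definition the real part of the complex one.
    let _ : InnerProductSpace ℝ H := InnerProductSpace.rclikeToReal ℂ H
    rw [hd.norm_sq.deriv, real_inner_comm]
    rfl
  rw [h', intervalIntegral.integral_const_mul] at h
  linarith

/-- Integration by parts for a merely integrable $D$. The difference of $\int_0^t(ZD+\zeta G)$ and
$Z(t)G(t)$ is absolutely continuous with a.e. derivative zero, hence constant; both boundary terms
vanish because $Z(b)=0$ and $G(0)=0$. -/
theorem integral_smul_primitive {D : ℝ → H} {ζ Z : ℝ → ℝ} {b : ℝ}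
    (hD : IntervalIntegrable D volume 0 b) (hζ : Continuous ζ)
    (hZ : ∀ t, HasDerivAt Z (ζ t) t) (hZb : Z b = 0) :
    ∫ s in (0 : ℝ)..b, Z s • D s = - ∫ s in (0 : ℝ)..b, ζ s • ∫ τ in (0 : ℝ)..s, D τ := by
  set G : ℝ → H := fun s => ∫ τ in (0 : ℝ)..s, D τ with hG
  have hGac : AbsolutelyContinuousOnInterval G 0 b := by
    simpa using absolutelyContinuousOnInterval_primitive hD 0
  have hGc : ContinuousOn G (Set.uIcc 0 b) := hGac.continuousOn
  have hZc : Continuous Z := continuous_iff_continuousAt.2 fun t => (hZ t).continuousAt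
  have hZd : ContDiff ℝ 1 Z := by
    rw [contDiff_one_iff_deriv]
    exact ⟨fun t => (hZ t).differentiableAt, by
      rw [show deriv Z = ζ from funext fun t => (hZ t).deriv]; exact hζ⟩
  have hZac : AbsolutelyContinuousOnInterval Z 0 b :=
    hZd.contDiffOn.absolutelyContinuousOnInterval
  have hi1 : IntervalIntegrable (fun s => Z s • D s) volume 0 b :=
    hD.continuousOn_smul hZc.continuousOn
  have hi2 : IntervalIntegrable (fun s => ζ s • G s) volume 0 b :=
    (hζ.continuousOn.smul hGc).intervalIntegrable
  have hi := hi1.add hi2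
  have hKac : AbsolutelyContinuousOnInterval
      (fun t => (∫ s in (0 : ℝ)..t, (Z s • D s + ζ s • G s)) - Z t • G t) 0 b := by
    refine AbsolutelyContinuousOnInterval.sub ?_ (hZac.smul hGac)
    simpa using absolutelyContinuousOnInterval_primitive hi 0
  obtain ⟨C, hC⟩ := hKac.const_of_ae_hasDerivAt_zero (by
    filter_upwards [hi.ae_hasDerivAt_integral, hD.ae_hasDerivAt_integral] with s h1 h2 hs
    convert! (h1 hs 0 (by simp)).sub ((hZ s).smul (h2 hs 0 (by simp))) using 1
    simp [hG])
  have e0 := hC 0 (by simp)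
  have eb := hC b (by simp)
  simp only [intervalIntegral.integral_same, hZb, zero_smul, sub_zero] at e0 eb
  rw [show G 0 = 0 by simp [hG], smul_zero, sub_zero] at e0
  rw [← e0, intervalIntegral.integral_add hi1 hi2] at eb
  exact eq_neg_of_add_eq_zero_left eb

end Hilbert

/-! ### Weak measurability -/

/-- Distinct orthonormal vectors are at distance $\sqrt2$, so balls of radius $1/2$ around them are
disjoint open sets in a separable space. -/
theorem countable_of_orthonormal {H : Type*} [NormedAddCommGroup H] [InnerProductSpace ℂ H]
    [TopologicalSpace.SeparableSpace H] {ι : Type*} {b : ι → H} (hb : Orthonormal ℂ b) :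
    Countable ι := by
  have hd : Pairwise (Function.onFun Disjoint fun i => Metric.ball (b i) (1 / 2)) := by
    intro i j hij
    apply Metric.ball_disjoint_ball
    have h1 : ‖b i - b j‖ ^ 2 = 2 := by
      rw [@norm_sub_sq ℂ, hb.2 hij, hb.1 i, hb.1 j]; norm_num
    rw [dist_eq_norm]
    nlinarith [norm_nonneg (b i - b j)]
  exact hd.countable_of_isOpen_disjoint (fun i => Metric.isOpen_ball) fun i => by simp

/-- Pettis' theorem in a separable Hilbert space: the partial sums of the expansion in a Hilbert
basis are measurable and converge pointwise. It is needed for products of fields, which do not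
depend continuously on their factors in $L^2$. -/
theorem aestronglyMeasurable_of_inner {X H : Type*} [MeasurableSpace X] {μ : Measure X}
    [NormedAddCommGroup H] [InnerProductSpace ℂ H] [CompleteSpace H]
    [TopologicalSpace.SeparableSpace H] {f : X → H} {S : Set H} (hS : Dense S)
    (hf : ∀ g ∈ S, AEStronglyMeasurable (fun x => inner ℂ g (f x)) μ) :
    AEStronglyMeasurable f μ := by
  have hall : ∀ g : H, AEStronglyMeasurable (fun x => inner ℂ g (f x)) μ := by
    intro g
    obtain ⟨s, hs, hlim⟩ := mem_closure_iff_seq_limit.1 (hS g)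
    exact aestronglyMeasurable_of_tendsto_ae atTop (fun n => hf _ (hs n))
      (Eventually.of_forall fun x => hlim.inner tendsto_const_nhds)
  obtain ⟨w, b, hb⟩ := exists_hilbertBasis ℂ H
  -- Countability of the basis makes the filter of finite subsets countably generated, as the
  -- measurability of the limit requires.
  have hc : Countable w := countable_of_orthonormal b.orthonormal
  refine aestronglyMeasurable_of_tendsto_ae (atTop : Filter (Finset w))
    (f := fun s x => ∑ i ∈ s, inner ℂ (b i) (f x) • b i) (fun s => ?_)
    (Eventually.of_forall fun x => ?_)
  · refine Finset.aestronglyMeasurable_fun_sum s fun i _ => ?_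
    exact (hall (b i)).smul_const _
  · have := b.hasSum_repr (f x)
    simp only [b.repr_apply_apply] at this
    exact this

/-! ### Weak time derivatives -/

theorem isOpen_times (T : EReal) : IsOpen (times T) :=
  isOpen_Ioi.inter (isOpen_lt continuous_coe_real_ereal continuous_const)

theorem measurableSet_times (T : EReal) : MeasurableSet (times T) :=
  (isOpen_times T).measurableSet

theorem Ioc_subset_times {T : EReal} {t : ℝ} (ht : (t : EReal) < T) :
    Set.Ioc 0 t ⊆ times T := fun _ hs =>
  ⟨hs.1, lt_of_le_of_lt (EReal.coe_le_coe_iff.2 hs.2) ht⟩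

theorem exists_gt_mem_times {T : EReal} {t : ℝ} (ht : t ∈ times T) : ∃ b ∈ times T, t < b := by
  obtain ⟨b, h1, h2⟩ := EReal.lt_iff_exists_real_btwn.1 ht.2
  have h3 : t < b := EReal.coe_lt_coe_iff.1 h1
  exact ⟨b, ⟨ht.1.trans h3, h2⟩, h3⟩

section Hilbert

variable {H : Type*} [NormedAddCommGroup H] [InnerProductSpace ℂ H] [CompleteSpace H]

/-- The fundamental lemma of the calculus of variations, with the initial value included. Any
$\zeta$ supported in $(0,T)$ is, for positive times, the derivative of an admissible $\eta$ that
need not vanish at $0$; integrating by parts turns the hypothesis into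
$\int\zeta\,(f-f_0-\int_0^tD)=0$. -/
theorem ae_eq_primitive_of_weak {T : EReal} {f D : ℝ → H} {f₀ : H}
    (hf : ∀ t ∈ times T, IntervalIntegrable f volume 0 t)
    (hD : ∀ t ∈ times T, IntervalIntegrable D volume 0 t)
    (h : ∀ η : ℝ → ℝ, ContDiff ℝ ∞ η → HasCompactSupport η →
      tsupport η ⊆ {t | (t : EReal) < T} →
      (∫ t in times T, (deriv η t • f t + η t • D t)) + η 0 • f₀ = 0) :
    ∀ᵐ t ∂(timeMeasure T), f t = f₀ + ∫ s in (0 : ℝ)..t, D s := by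
  set G : ℝ → H := fun t => ∫ s in (0 : ℝ)..t, D s with hG
  have hGc : ∀ t ∈ times T, ContinuousOn G (Set.uIcc 0 t) := fun t ht => by
    simpa using (absolutelyContinuousOnInterval_primitive (hD t ht) 0).continuousOn
  have hloc : LocallyIntegrableOn (fun t => f t - (f₀ + G t)) (times T) := by
    rw [locallyIntegrableOn_iff (isOpen_times T).isLocallyClosed]
    intro K hK hKc
    rcases K.eq_empty_or_nonempty with rfl | hne
    · simp
    obtain ⟨m, hm, hmax⟩ := hKc.exists_isMaxOn hne continuousOn_id
    have hmT := hK hm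
    have : K ⊆ Set.Ioc 0 m := fun x hx => ⟨(hK hx).1, hmax hx⟩
    refine IntegrableOn.mono_set ?_ this
    rw [← intervalIntegrable_iff_integrableOn_Ioc_of_le hmT.1.le]
    exact (hf m hmT).sub (continuousOn_const.add (hGc m hmT)).intervalIntegrable
  have key := (isOpen_times T).ae_eq_zero_of_integral_contDiff_smul_eq_zero hloc ?_
  · rw [timeMeasure, ae_restrict_iff' (measurableSet_times T)]
    filter_upwards [key] with t ht hm
    exact sub_eq_zero.1 (ht hm)
  intro ζ hζ hζc hζs
  rcases (tsupport ζ).eq_empty_or_nonempty with he | hne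
  · have : ζ = 0 := tsupport_eq_empty_iff.1 he
    simp [this]
  obtain ⟨m, hm, hmax⟩ := hζc.isCompact.exists_isMaxOn hne continuousOn_id
  obtain ⟨b, hb, hmb⟩ := exists_gt_mem_times (hζs hm)
  have hb0 : 0 ≤ b := hb.1.le
  have hzb : ∀ t, m < t → ζ t = 0 := fun t ht => by
    by_contra hne'
    exact absurd (hmax (subset_tsupport ζ (Function.mem_support.2 hne'))) (not_le.2 ht)
  have hz0 : ∀ t, t ≤ 0 → ζ t = 0 := fun t ht => by
    by_contra hne'
    exact absurd (hζs (subset_tsupport ζ (Function.mem_support.2 hne'))).1 (not_lt.2 ht)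
  -- The primitive is based at a point `b` to the right of the support of `ζ`, so that it vanishes
  -- from `b` on; its value at $0$ is $-\int\zeta$, which produces the $f_0$ term.
  set Z : ℝ → ℝ := fun t => ∫ s in b..t, ζ s with hZdef
  have hZ : ∀ t, HasDerivAt Z (ζ t) t := fun t =>
    intervalIntegral.integral_hasDerivAt_right (hζ.continuous.intervalIntegrable _ _)
      (hζ.continuous.stronglyMeasurableAtFilter _ _) hζ.continuous.continuousAt
  have hZb : ∀ t, b ≤ t → Z t = 0 := fun t ht => by
    refine intervalIntegral.integral_zero_ae (Eventually.of_forall fun s hs => ?_)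
    rw [Set.uIoc_of_le ht] at hs
    exact hzb s (hmb.trans hs.1)
  have hZs : ContDiff ℝ ∞ Z := by
    rw [contDiff_infty_iff_deriv]
    refine ⟨fun t => (hZ t).differentiableAt, ?_⟩
    rw [show deriv Z = ζ from funext fun t => (hZ t).deriv]
    exact hζ
  -- The transition factor is 1 for $t\ge0$ and 0 for $t\le-1$: it makes the support compact without
  -- changing `Z` at nonnegative times.
  set η : ℝ → ℝ := fun t => Real.smoothTransition (t + 1) * Z t with hη
  have hηs : ContDiff ℝ ∞ η :=
    (Real.smoothTransition.contDiff.comp (contDiff_id.add contDiff_const)).mul hZs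
  have hsub : Function.support η ⊆ Set.Icc (-1) b := by
    intro t ht
    by_contra hnot
    rw [Set.mem_Icc, not_and_or, not_le, not_le] at hnot
    rcases hnot with h1 | h1
    · exact ht (by simp [hη, Real.smoothTransition.zero_of_nonpos (by linarith : t + 1 ≤ 0)])
    · exact ht (by simp [hη, hZb t h1.le])
  have hts : tsupport η ⊆ Set.Icc (-1) b := closure_minimal hsub isClosed_Icc
  have hηp : ∀ t, 0 ≤ t → η t = Z t := fun t ht => by
    simp [hη, Real.smoothTransition.one_of_one_le (by linarith : 1 ≤ t + 1)]
  have hηd : ∀ t, 0 < t → deriv η t = ζ t := fun t ht => by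
    rw [← (hZ t).deriv]
    apply EventuallyEq.deriv_eq
    filter_upwards [Ioi_mem_nhds ht] with s hs using hηp s (le_of_lt hs)
  have h1 := h η hηs (HasCompactSupport.of_support_subset_isCompact isCompact_Icc hsub)
    fun t ht => lt_of_le_of_lt (EReal.coe_le_coe_iff.2 (hts ht).2) hb.2
  have h2 : ∫ t in times T, (deriv η t • f t + η t • D t) =
      ∫ t in (0 : ℝ)..b, (ζ t • f t + Z t • D t) := by
    rw [intervalIntegral.integral_of_le hb0]
    have e1 : ∫ t in times T, (deriv η t • f t + η t • D t) =
        ∫ t in times T, (ζ t • f t + Z t • D t) := by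
      refine setIntegral_congr_fun (measurableSet_times T) fun t ht => ?_
      simp only [hηd t ht.1, hηp t ht.1.le]
    rw [e1]
    refine (setIntegral_eq_of_subset_of_forall_sdiff_eq_zero (measurableSet_times T)
      (Ioc_subset_times hb.2) fun t ht => ?_)
    have hbt : b < t := by
      by_contra hle
      exact ht.2 ⟨ht.1.1, not_lt.1 hle⟩
    simp [hzb t (hmb.trans hbt), hZb t hbt.le]
  have hi1 : IntervalIntegrable (fun t => ζ t • f t) volume 0 b :=
    (hf b hb).continuousOn_smul hζ.continuous.continuousOn
  have hi2 : IntervalIntegrable (fun t => Z t • D t) volume 0 b :=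
    (hD b hb).continuousOn_smul hZs.continuous.continuousOn
  have hi3 : IntervalIntegrable (fun t => ζ t • G t) volume 0 b :=
    (hζ.continuous.continuousOn.smul (hGc b hb)).intervalIntegrable
  have hi4 : IntervalIntegrable (fun t => ζ t • f₀) volume 0 b :=
    (hζ.continuous.smul continuous_const).intervalIntegrable _ _
  rw [h2, intervalIntegral.integral_add hi1 hi2,
    integral_smul_primitive (hD b hb) hζ.continuous hZ (hZb b le_rfl), hηp 0 le_rfl] at h1
  have h3 : ∫ t, ζ t • (f t - (f₀ + G t)) = ∫ t in (0 : ℝ)..b, ζ t • (f t - (f₀ + G t)) := by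
    rw [intervalIntegral.integral_of_le hb0]
    refine (setIntegral_eq_integral_of_forall_compl_eq_zero fun t ht => ?_).symm
    rw [Set.mem_Ioc, not_and_or, not_lt, not_le] at ht
    rcases ht with ht | ht
    · rw [hz0 t ht, zero_smul]
    · rw [hzb t (hmb.trans ht), zero_smul]
  have h4 : Z 0 • f₀ = - ∫ t in (0 : ℝ)..b, ζ t • f₀ := by
    rw [intervalIntegral.integral_smul_const, ← neg_smul]
    congr 1
    rw [hZdef]
    exact intervalIntegral.integral_symm 0 b
  rw [h3]
  simp only [smul_sub, smul_add]
  rw [intervalIntegral.integral_sub hi1 (hi4.add hi3), intervalIntegral.integral_add hi4 hi3, ← h1,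
    h4]
  abel

/-- A Hilbert space valued function whose weak time derivative is controlled in the sense of a
Gelfand triple has a strongly continuous representative that satisfies the energy identity. The
operators `S n` approximate the identity, `W n` plays the role of `S n` applied to the weak time
derivative of `f`, and `h` that of the duality pairing of this derivative with `f`. -/
theorem exists_continuous_representative {T : EReal} {f : ℝ → H} {f₀ : H} {S : ℕ → H →L[ℂ] H}
    {W : ℕ → ℝ → H} {h k : ℝ → ℝ} (hT : 0 < T) (hf : AEStronglyMeasurable f (timeMeasure T))
    (hS : ∀ x, Tendsto (fun n => S n x) atTop (𝓝 x))
    (hW : ∀ n, ∀ t ∈ times T, IntervalIntegrable (W n) volume 0 t)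
    (hWm : ∀ n, AEStronglyMeasurable (W n) (timeMeasure T))
    (hae : ∀ n, ∀ᵐ t ∂(timeMeasure T), S n (f t) = S n f₀ + ∫ s in (0 : ℝ)..t, W n s)
    (hk : Integrable k (timeMeasure T))
    (hbound : ∀ n m, ∀ᵐ t ∂(timeMeasure T), |(inner ℂ (W n t) (S m (f t))).re| ≤ k t)
    (hlim : ∀ᵐ t ∂(timeMeasure T),
      Tendsto (fun p : ℕ × ℕ => (inner ℂ (W p.1 t) (S p.2 (f t))).re) atTop (𝓝 (h t))) :
    ∃ V : ℝ → H, ContinuousOn V {t | 0 ≤ t ∧ (t : EReal) < T} ∧ f =ᵐ[timeMeasure T] V ∧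
      V 0 = f₀ ∧ ∀ t : ℝ, 0 ≤ t → (t : EReal) < T →
        ‖V t‖ ^ 2 = ‖f₀‖ ^ 2 + 2 * ∫ s in (0 : ℝ)..t, h s := by
  set I : Set ℝ := {t | 0 ≤ t ∧ (t : EReal) < T} with hI
  set F : ℕ → ℝ → H := fun n t => S n f₀ + ∫ s in (0 : ℝ)..t, W n s with hF
  set q : ℕ → ℕ → ℝ → ℝ := fun n m t => (inner ℂ (W n t) (S m (f t))).re with hq
  have hWI : ∀ n, ∀ t ∈ I, IntervalIntegrable (W n) volume 0 t := by
    intro n t ht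
    rcases ht.1.eq_or_lt with rfl | h0
    · exact IntervalIntegrable.refl
    · exact hW n t ⟨h0, ht.2⟩
  have hqm : ∀ n m, AEStronglyMeasurable (q n m) (timeMeasure T) := fun n m =>
    Complex.continuous_re.comp_aestronglyMeasurable
      ((hWm n).inner ((S m).continuous.comp_aestronglyMeasurable hf))
  have hrestr : ∀ {g₁ g₂ : ℝ → ℝ} {t : ℝ}, t ∈ I → g₁ =ᵐ[timeMeasure T] g₂ →
      ∫ s in (0 : ℝ)..t, g₁ s = ∫ s in (0 : ℝ)..t, g₂ s := by
    intro g₁ g₂ t ht hg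
    rw [intervalIntegral.integral_of_le ht.1, intervalIntegral.integral_of_le ht.1]
    exact integral_congr_ae (ae_restrict_of_ae_restrict_of_subset (Ioc_subset_times ht.2) hg)
  have hFc : ∀ n, ContinuousOn (F n) I := by
    intro n t ht
    obtain ⟨b, hbI, htb⟩ : ∃ b ∈ I, t < b := by
      obtain ⟨b, h1, h2⟩ := EReal.lt_iff_exists_real_btwn.1 ht.2
      have h3 : t < b := EReal.coe_lt_coe_iff.1 h1
      exact ⟨b, ⟨ht.1.trans h3.le, h2⟩, h3⟩
    have hc := (absolutelyContinuousOnInterval_primitive (hWI n b hbI) (S n f₀)).continuousOn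
    rw [Set.uIcc_of_le hbI.1] at hc
    refine ((hc t ⟨ht.1, htb.le⟩).mono_of_mem_nhdsWithin ?_)
    filter_upwards [self_mem_nhdsWithin, mem_nhdsWithin_of_mem_nhds (Iio_mem_nhds htb)]
      with s hs hsb using ⟨hs.1, le_of_lt hsb⟩
  have hFn : ∀ n, ∀ t ∈ I, ‖F n t‖ ^ 2 = ‖S n f₀‖ ^ 2 + 2 * ∫ s in (0 : ℝ)..t, q n n s := by
    intro n t ht
    rw [hF, norm_sq_primitive (hWI n t ht), hrestr ht]
    filter_upwards [hae n] with s hs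
    rw [← hs]
  -- This is $\mathrm{Re}\langle W_n-W_m,(S_n-S_m)f\rangle$ expanded. Its four terms, with signs
  -- $+,-,-,+$, all tend to $h$, so it tends to zero under the dominating function $4k$.
  set r : ℕ × ℕ → ℝ → ℝ := fun p s =>
    q p.1 p.1 s - q p.1 p.2 s - q p.2 p.1 s + q p.2 p.2 s with hr
  have hFd : ∀ p : ℕ × ℕ, ∀ t ∈ I, ‖F p.1 t - F p.2 t‖ ^ 2 =
      ‖S p.1 f₀ - S p.2 f₀‖ ^ 2 + 2 * ∫ s in (0 : ℝ)..t, r p s := by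
    intro p t ht
    have e : ∀ s ∈ I, F p.1 s - F p.2 s =
        (S p.1 f₀ - S p.2 f₀) + ∫ τ in (0 : ℝ)..s, (W p.1 τ - W p.2 τ) := by
      intro s hs
      rw [intervalIntegral.integral_sub (hWI p.1 s hs) (hWI p.2 s hs)]
      simp only [hF]
      abel
    rw [e t ht, norm_sq_primitive ((hWI p.1 t ht).sub (hWI p.2 t ht)), hrestr ht]
    rw [timeMeasure]
    filter_upwards [hae p.1, hae p.2, ae_restrict_mem (measurableSet_times T)] with s h1 h2 h3
    rw [← e s ⟨h3.1.le, h3.2⟩]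
    simp only [hF, ← h1, ← h2, hr, hq, inner_sub_left, inner_sub_right, Complex.sub_re]
    ring
  have hqp : ∀ᵐ s ∂(timeMeasure T), ∀ n m, |q n m s| ≤ k s :=
    ae_all_iff.2 fun n => ae_all_iff.2 fun m => hbound n m
  have hrm : ∀ p, AEStronglyMeasurable (r p) (timeMeasure T) := fun p =>
    (((hqm _ _).sub (hqm _ _)).sub (hqm _ _)).add (hqm _ _)
  have hrb : ∀ p, ∀ᵐ s ∂(timeMeasure T), ‖r p s‖ ≤ 4 * k s := by
    intro p
    filter_upwards [hqp] with s hs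
    have h1 := abs_le.1 (hs p.1 p.1)
    have h2 := abs_le.1 (hs p.1 p.2)
    have h3 := abs_le.1 (hs p.2 p.1)
    have h4 := abs_le.1 (hs p.2 p.2)
    rw [Real.norm_eq_abs, abs_le]
    simp only [hr]
    constructor <;> linarith [h1.1, h1.2, h2.1, h2.2, h3.1, h3.2, h4.1, h4.2]
  have hri : ∀ p, Integrable (r p) (timeMeasure T) := fun p =>
    (hk.const_mul 4).mono' (hrm p) (hrb p)
  have hfst : Tendsto (fun p : ℕ × ℕ => p.1) atTop atTop := by
    rw [← prod_atTop_atTop_eq]; exact tendsto_fst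
  have hsnd : Tendsto (fun p : ℕ × ℕ => p.2) atTop atTop := by
    rw [← prod_atTop_atTop_eq]; exact tendsto_snd
  have hpair : ∀ {ι : Type} {l : Filter ι} {a b : ι → ℕ}, Tendsto a l atTop → Tendsto b l atTop →
      Tendsto (fun i => (a i, b i)) l atTop := by
    intro ι l a b ha hb
    rw [← prod_atTop_atTop_eq]
    exact ha.prodMk hb
  have hr0 : Tendsto (fun p => ∫ s in times T, ‖r p s‖) atTop (𝓝 0) := by
    have : Tendsto (fun p => ∫ s, ‖r p s‖ ∂(timeMeasure T)) atTop
        (𝓝 (∫ _, (0 : ℝ) ∂(timeMeasure T))) := by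
      refine tendsto_integral_filter_of_dominated_convergence (fun s => 4 * k s)
        (Eventually.of_forall fun p => (hrm p).norm)
        (Eventually.of_forall fun p => ?_) (hk.const_mul 4) ?_
      · filter_upwards [hrb p] with s hs
        rwa [norm_norm]
      · filter_upwards [hlim] with s hs
        have h1 : Tendsto (fun p : ℕ × ℕ => q p.1 p.1 s) atTop (𝓝 (h s)) :=
          hs.comp (hpair hfst hfst)
        have h2 : Tendsto (fun p : ℕ × ℕ => q p.2 p.1 s) atTop (𝓝 (h s)) :=
          hs.comp (hpair hsnd hfst)
        have h3 : Tendsto (fun p : ℕ × ℕ => q p.2 p.2 s) atTop (𝓝 (h s)) :=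
          hs.comp (hpair hsnd hsnd)
        have := (((h1.sub hs).sub h2).add h3).norm
        simpa [hr] using this
    simpa [timeMeasure] using this
  have hint_le : ∀ p : ℕ × ℕ, ∀ t ∈ I, ∫ s in (0 : ℝ)..t, r p s ≤ ∫ s in times T, ‖r p s‖ := by
    intro p t ht
    rw [intervalIntegral.integral_of_le ht.1]
    calc _ ≤ ∫ s in Set.Ioc 0 t, ‖r p s‖ :=
          (Real.le_norm_self _).trans (norm_integral_le_integral_norm _)
      _ ≤ _ := setIntegral_mono_set (hri p).norm (Eventually.of_forall fun s => norm_nonneg _)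
          (Ioc_subset_times ht.2).eventuallyLE
  -- The integral of `r` over $(0,t)$ is at most the integral of its norm over all of $(0,T)$, so
  -- the Cauchy estimate is uniform in $t$.
  have hcauchy : UniformCauchySeqOn F atTop I := by
    rw [Metric.uniformCauchySeqOn_iff]
    intro ε hε
    have hl : Tendsto (fun p : ℕ × ℕ => ‖S p.1 f₀ - S p.2 f₀‖ ^ 2 +
        2 * ∫ s in times T, ‖r p s‖) atTop (𝓝 0) := by
      have h1 := ((((hS f₀).comp hfst).sub ((hS f₀).comp hsnd)).norm.pow 2).add
        (hr0.const_mul 2)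
      simpa using h1
    have := hl.eventually (gt_mem_nhds (by positivity : 0 < ε ^ 2))
    obtain ⟨⟨N, M⟩, hN⟩ := eventually_atTop.1 this
    refine ⟨max N M, fun m hm n hn t ht => ?_⟩
    have h1 := hN (m, n) ⟨(le_max_left _ _).trans hm, (le_max_right _ _).trans hn⟩
    have h2 := hFd (m, n) t ht
    have h3 := hint_le (m, n) t ht
    rw [dist_eq_norm]
    refine lt_of_pow_lt_pow_left₀ 2 hε.le ?_
    linarith
  have hex : ∀ t, ∃ v : H, t ∈ I → Tendsto (fun n => F n t) atTop (𝓝 v) := by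
    intro t
    by_cases ht : t ∈ I
    · obtain ⟨v, hv⟩ := cauchySeq_tendsto_of_complete (hcauchy.cauchySeq ht)
      exact ⟨v, fun _ => hv⟩
    · exact ⟨0, fun h => absurd h ht⟩
  choose V hV using hex
  have hunif : TendstoUniformlyOn F V atTop I :=
    hcauchy.tendstoUniformlyOn_of_tendsto fun t ht => hV t ht
  have h0I : (0 : ℝ) ∈ I := ⟨le_rfl, by simpa using hT⟩
  refine ⟨V, hunif.continuousOn (Frequently.of_forall hFc), ?_, ?_, ?_⟩
  -- For almost every $t$ the sequence $S_nf(t)=F_n(t)$ converges both to $f(t)$ and to $V(t)$.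
  · rw [timeMeasure]
    filter_upwards [ae_all_iff.2 hae, ae_restrict_mem (measurableSet_times T)] with t h1 h2
    refine tendsto_nhds_unique (hS (f t)) ?_
    simp only [h1]
    exact hV t ⟨h2.1.le, h2.2⟩
  · refine tendsto_nhds_unique (hV 0 h0I) ?_
    simpa [hF] using hS f₀
  · intro t h0 h1
    have ht : t ∈ I := ⟨h0, h1⟩
    have hsub := Ioc_subset_times h1
    refine tendsto_nhds_unique ((hV t ht).norm.pow 2) ?_
    simp only [hFn _ t ht]
    refine ((hS f₀).norm.pow 2).add (Tendsto.const_mul 2 ?_)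
    simp only [intervalIntegral.integral_of_le h0]
    refine tendsto_integral_filter_of_dominated_convergence k
      (Eventually.of_forall fun n => (hqm n n).mono_measure (Measure.restrict_mono hsub le_rfl))
      (Eventually.of_forall fun n => ?_) (hk.mono_measure (Measure.restrict_mono hsub le_rfl)) ?_
    · exact ae_restrict_of_ae_restrict_of_subset hsub (hbound n n)
    · refine ae_restrict_of_ae_restrict_of_subset hsub ?_
      filter_upwards [hlim] with s hs
      exact hs.comp (hpair tendsto_id tendsto_id)

end Hilbert

/-! ### Uniqueness for the Fourier transform -/

/-- A real test function as a complex Schwartz function. -/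
noncomputable def schwartzOfReal (ρ : E3 → ℝ) (hρ : ContDiff ℝ ∞ ρ) (hc : HasCompactSupport ρ) :
    𝓢(E3, ℂ) :=
  HasCompactSupport.toSchwartzMap (f := fun x => (ρ x : ℂ))
    (hc.comp_left (g := fun r : ℝ => (r : ℂ)) Complex.ofReal_zero)
    (Complex.ofRealCLM.contDiff.comp hρ)

@[simp]
theorem schwartzOfReal_apply (ρ : E3 → ℝ) (hρ : ContDiff ℝ ∞ ρ) (hc : HasCompactSupport ρ)
    (x : E3) : schwartzOfReal ρ hρ hc x = ρ x := rfl

/-- Every test function is itself a Fourier transform of a Schwartz function, and the transform can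
be moved from that factor onto $h$. -/
theorem ae_eq_zero_of_fourier_eq_zero {h : E3 → ℂ} (hh : Integrable h) (h0 : ∀ x, 𝓕 h x = 0) :
    h =ᵐ[volume] 0 := by
  refine ae_eq_zero_of_integral_contDiff_smul_eq_zero hh.locallyIntegrable fun g hg hgc => ?_
  set ψ := schwartzOfReal g hg hgc
  have h1 : ∫ x, g x • h x = ∫ x, (𝓕 (𝓕⁻ ψ : 𝓢(E3, ℂ)) : 𝓢(E3, ℂ)) x * h x := by
    rw [FourierTransform.fourier_fourierInv_eq]
    simp [ψ, Complex.real_smul]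
  have h2 := VectorFourier.integral_bilin_fourierIntegral_eq_flip (ContinuousLinearMap.mul ℂ ℂ)
    (L := innerₗ E3) Real.continuous_fourierChar continuous_inner 
    (SchwartzMap.integrable (μ := volume) (𝓕⁻ ψ : 𝓢(E3, ℂ))) hh
  rw [h1]
  refine Eq.trans h2 ?_
  have h3 : ∀ x, VectorFourier.fourierIntegral Real.fourierChar volume (innerₗ E3).flip h x = 0 := by
    intro x
    rw [flip_innerₗ]
    exact h0 x
  simp only [h3, map_zero, integral_zero]

theorem fourier_comp_sub (f : E3 → ℂ) (a ξ : E3) :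
    𝓕 (fun y => f (y - a)) ξ = Real.fourierChar (-inner ℝ a ξ) • 𝓕 f ξ := by
  rw [Real.fourier_eq, Real.fourier_eq, Circle.smul_def, smul_eq_mul, ← integral_const_mul,
    ← integral_sub_right_eq_self (fun y => ((Real.fourierChar (-inner ℝ a ξ) : Circle) : ℂ) *
      Real.fourierChar (-inner ℝ y ξ) • f y) a]
  congr 1
  ext y
  rw [Circle.smul_def, Circle.smul_def, smul_eq_mul, smul_eq_mul, ← mul_assoc, ← Circle.coe_mul,
    ← AddChar.map_add_eq_mul]
  congr 4
  rw [inner_sub_left]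
  ring

/-- For normalised bumps shrinking to the origin, the transform at $\xi$ is an average of a
continuous character near $0$, where the character equals 1. -/
theorem exists_tendsto_fourier_one :
    ∃ ρ : ℕ → E3 → ℝ, (∀ n, ContDiff ℝ ∞ (ρ n)) ∧ (∀ n, HasCompactSupport (ρ n)) ∧
      ∀ ξ, Tendsto (fun n => 𝓕 (fun x => (ρ n x : ℂ)) ξ) atTop (𝓝 1) := by
  let φ : ℕ → ContDiffBump (0 : E3) := fun n =>
    ⟨1 / (2 * (n + 1)), 1 / (n + 1), by positivity, by
      rw [div_lt_div_iff₀ (by positivity) (by positivity)]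
      have : (0 : ℝ) ≤ n := n.cast_nonneg
      nlinarith⟩
  refine ⟨fun n => (φ n).normed volume, fun n => (φ n).contDiff_normed,
    fun n => (φ n).hasCompactSupport_normed, fun ξ => ?_⟩
  have hr : Tendsto (fun n => (φ n).rOut) atTop (𝓝 0) :=
    tendsto_one_div_add_atTop_nhds_zero_nat
  have hg : Continuous fun y : E3 => ((Real.fourierChar (inner ℝ y ξ) : Circle) : ℂ) := by
    fun_prop
  have h := ContDiffBump.convolution_tendsto_right_of_continuous (μ := volume) hr hg 0
  simp only [inner_zero_left, AddChar.map_zero_eq_one, Circle.coe_one] at h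
  refine h.congr fun n => ?_
  rw [Real.fourier_eq]
  simp only [convolution, zero_sub, inner_neg_left, ContinuousLinearMap.lsmul_apply]
  congr 1
  ext y
  rw [Circle.smul_def, smul_eq_mul, Complex.real_smul, mul_comm]

/-- A function on frequency space that annihilates the Fourier transforms of all real test
functions vanishes. -/
theorem ae_eq_zero_of_integral_mul_fourier {G : E3 → ℂ}
    (hG : ∀ ψ : 𝓢(E3, ℂ), Integrable (fun ξ => G ξ * ψ ξ))
    (h : ∀ (ρ : E3 → ℝ), ContDiff ℝ ∞ ρ → HasCompactSupport ρ →
      ∫ ξ, G ξ * 𝓕 (fun x => (ρ x : ℂ)) ξ = 0) : G =ᵐ[volume] 0 := by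
  obtain ⟨ρ, hs, hc, hlim⟩ := exists_tendsto_fourier_one
  have key : ∀ n, (fun ξ => G ξ * 𝓕 (fun x => (ρ n x : ℂ)) ξ) =ᵐ[volume] 0 := by
    intro n
    -- `G` itself need not be integrable, but its product with $\hat\rho_n$ is. Translating $\rho_n$
    -- by $a$ multiplies $\hat\rho_n$ by a character, so the hypothesis for all translates says that
    -- this product has vanishing Fourier transform.
    refine ae_eq_zero_of_fourier_eq_zero (hG (𝓕 (schwartzOfReal (ρ n) (hs n) (hc n)))) fun a => ?_
    have h1 := h (fun y => ρ n (y - a)) ((hs n).comp (contDiff_id.sub contDiff_const))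
      ((hc n).comp_homeomorph (Homeomorph.subRight a))
    rw [Real.fourier_eq, ← h1]
    congr 1
    ext ξ
    rw [fourier_comp_sub (fun y => (ρ n y : ℂ)), real_inner_comm, Circle.smul_def, Circle.smul_def,
      smul_eq_mul, smul_eq_mul]
    ring
  filter_upwards [ae_all_iff.2 key] with ξ hξ
  have h1 : Tendsto (fun n => G ξ * 𝓕 (fun x => (ρ n x : ℂ)) ξ) atTop (𝓝 (G ξ * 1)) :=
    (hlim ξ).const_mul _
  simp only [hξ, Pi.zero_apply, mul_one] at h1
  exact (tendsto_nhds_unique tendsto_const_nhds h1).symm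

/-! ### Fourier transforms of real fields -/

/-- Complex conjugation of vectors. -/
noncomputable def conjC3 : C3 →L[ℝ] C3 :=
  LinearMap.toContinuousLinearMap
    { toFun := fun v => WithLp.toLp 2 (fun i => (starRingEnd ℂ) (v i))
      map_add' := fun v w => by ext i; simp
      map_smul' := fun c v => by ext i; simp }

@[simp]
theorem conjC3_apply (v : C3) (i : Fin 3) : conjC3 v i = (starRingEnd ℂ) (v i) := rfl

@[simp]
theorem complexify_apply (v : E3) (i : Fin 3) : complexify v i = (v i : ℂ) := rfl

theorem norm_complexify (v : E3) : ‖complexify v‖ = ‖v‖ := by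
  simp [EuclideanSpace.norm_eq]

theorem inner_complexify (v w : E3) :
    inner ℂ (complexify v) (complexify w) = ((inner ℝ v w : ℝ) : ℂ) := by
  simp [PiLp.inner_apply]

theorem inner_conjC3 (v w : C3) :
    inner ℂ (conjC3 v) (conjC3 w) = (starRingEnd ℂ) (inner ℂ v w) := by
  simp [PiLp.inner_apply]

/-- The antiunitary involution `f ↦ conj f(-·)`. -/
noncomputable def conjReflect (f : L2C) : L2C :=
  conjC3.compLp (Lp.compMeasurePreserving (fun ξ : E3 => -ξ) (Measure.measurePreserving_neg volume) f)

theorem coeFn_conjReflect (f : L2C) : conjReflect f =ᵐ[volume] fun ξ => conjC3 (f (-ξ)) := by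
  have h1 := conjC3.coeFn_compLp (Lp.compMeasurePreserving (fun ξ : E3 => -ξ)
    (Measure.measurePreserving_neg volume) f)
  have h2 := Lp.coeFn_compMeasurePreserving f (Measure.measurePreserving_neg (volume : Measure E3))
  filter_upwards [h1, h2] with ξ h3 h4
  rw [conjReflect, h3, h4]
  rfl

theorem continuous_conjReflect : Continuous conjReflect := by
  have h1 : Continuous fun f : L2C => Lp.compMeasurePreserving (fun ξ : E3 => -ξ)
      (Measure.measurePreserving_neg volume) f := Lp.isometry_compMeasurePreserving _ |>.continuous
  exact (conjC3.compLpL 2 volume).continuous.comp h1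

theorem continuous_toComplex : Continuous toComplex := (complexify.compLpL 2 volume).continuous

theorem coeFn_toComplex (f : L2R) : toComplex f =ᵐ[volume] fun x => complexify (f x) :=
  complexify.coeFn_compLp f

/-- The Hermitian symmetry of the transform of a real field. Both sides are continuous in $f$, so it
suffices to conjugate the Fourier integral of a Schwartz field. -/
theorem conjReflect_fourier_toComplex (f : L2R) :
    conjReflect (𝓕 (toComplex f)) = 𝓕 (toComplex f) := by
  refine DenseRange.induction_on (p := fun f : L2R => conjReflect (𝓕 (toComplex f)) =
    𝓕 (toComplex f)) (SchwartzMap.denseRange_toLpCLM (E := E3) (F := E3) (p := 2)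
      ENNReal.ofNat_ne_top) f ?_ ?_
  · have hF : Continuous fun f : L2R => (𝓕 (toComplex f) : L2C) :=
      (Lp.fourierTransformₗᵢ E3 C3).continuous.comp continuous_toComplex
    exact isClosed_eq (continuous_conjReflect.comp hF) hF
  · intro φ
    set ψ : 𝓢(E3, C3) := SchwartzMap.postcompCLM complexify φ with hψ
    have e1 : toComplex (SchwartzMap.toLpCLM ℝ E3 2 volume φ) = ψ.toLp 2 volume := by
      apply Lp.ext
      filter_upwards [coeFn_toComplex (SchwartzMap.toLpCLM ℝ E3 2 volume φ),
        ψ.coeFn_toLp 2 volume, φ.coeFn_toLp 2 volume] with x h1 h2 h3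
      rw [h1, h2, SchwartzMap.toLpCLM_apply, h3]
      rfl
    rw [e1, SchwartzMap.toLp_fourier_eq]
    apply Lp.ext
    have h1 := (𝓕 ψ : 𝓢(E3, C3)).coeFn_toLp 2 volume
    have h2 := (Measure.measurePreserving_neg (volume : Measure E3)).quasiMeasurePreserving.ae_eq_comp h1
    filter_upwards [coeFn_conjReflect ((𝓕 ψ : 𝓢(E3, C3)).toLp 2 volume), h1, h2] with ξ h3 h4 h5
    rw [h3, h4]
    simp only [Function.comp_apply] at h5
    rw [h5, SchwartzMap.fourier_coe, Real.fourier_eq, Real.fourier_eq,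
      ← ContinuousLinearMap.integral_comp_comm]
    · congr 1
      ext x i
      simp only [inner_neg_right, neg_neg, Circle.smul_def, conjC3_apply, PiLp.smul_apply,
        smul_eq_mul, map_mul, hψ, SchwartzMap.postcompCLM_apply, complexify_apply,
        Complex.conj_ofReal]
      congr 1
      rw [← Circle.coe_inv_eq_conj, ← AddChar.map_neg_eq_inv]
    · exact (Real.fourierIntegral_convergent_iff _).2 ψ.integrable

/-- The symbol is real and even, so $\xi\mapsto-\xi$ turns the integrand into its conjugate. This
shows that taking the real part in `dissipationPairing` loses nothing. -/
theorem im_integral_inner_even_symbol {s : ℝ} (f g : L2R) :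
    (∫ ξ, inner ℂ ((𝓕 (toComplex f) : L2C) ξ) (symbolMul s (toComplex g) ξ)).im = 0 := by
  have hf := conjReflect_fourier_toComplex f
  have hg := conjReflect_fourier_toComplex g
  have h1 := coeFn_conjReflect (𝓕 (toComplex f))
  have h2 := coeFn_conjReflect (𝓕 (toComplex g))
  rw [hf] at h1
  rw [hg] at h2
  rw [← Complex.conj_eq_iff_im, ← integral_conj,
    ← integral_neg_eq_self (fun ξ => inner ℂ ((𝓕 (toComplex f) : L2C) ξ) (symbolMul s (toComplex g) ξ))]
  apply integral_congr_ae
  filter_upwards [h1, h2] with ξ h3 h4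
  rw [symbolMul, symbolMul, h3, h4, inner_smul_right, inner_smul_right, inner_conjC3, norm_neg,
    map_mul, Complex.conj_conj, Complex.conj_ofReal]

open LineDeriv

/-! ### Weights of polynomial growth and multiplication operators -/

/-- Measurable functions of at most polynomial growth. -/
def IsTemperateWeight (w : E3 → ℂ) : Prop :=
  Measurable w ∧ ∃ C r : ℝ, ∀ ξ, ‖w ξ‖ ≤ C * (1 + ‖ξ‖ ^ 2) ^ r

/-- The product is dominated by a power of $1+|\xi|^2$ times `ψ`, which is again a Schwartz
function. -/
theorem IsTemperateWeight.memLp_smul {F : Type*} [NormedAddCommGroup F] [NormedSpace ℂ F]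
    {w : E3 → ℂ} (hw : IsTemperateWeight w) (ψ : 𝓢(E3, F)) :
    MemLp (fun ξ => w ξ • ψ ξ) 2 volume := by
  obtain ⟨hm, C, r, hC⟩ := hw
  have hg : (fun ξ : E3 => (1 + ‖ξ‖ ^ 2) ^ r).HasTemperateGrowth :=
    Function.hasTemperateGrowth_one_add_norm_sq_rpow E3 r
  have h1 := ((SchwartzMap.smulLeftCLM F (fun ξ : E3 => (1 + ‖ξ‖ ^ 2) ^ r) ψ).memLp 2
    volume).const_smul C
  refine h1.mono (hm.aestronglyMeasurable.smul ψ.continuous.aestronglyMeasurable)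
    (Eventually.of_forall fun ξ => ?_)
  simp only [Pi.smul_apply, SchwartzMap.smulLeftCLM_apply_apply hg, norm_smul, Real.norm_eq_abs]
  rw [← mul_assoc]
  gcongr
  refine (hC ξ).trans ?_
  rw [← abs_mul]
  exact le_abs_self _

theorem isTemperateWeight_of_le {w : E3 → ℂ} (hm : Measurable w) {C s : ℝ}
    (hC : ∀ ξ, ‖w ξ‖ ≤ C * (1 + ‖ξ‖) ^ s) (hC0 : 0 ≤ C) (hs : 0 ≤ s) : IsTemperateWeight w := by
  -- The factor $2^s$ comes from $1+|\xi|\le2(1+|\xi|^2)^{1/2}$.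
  refine ⟨hm, C * 2 ^ s, s / 2, fun ξ => (hC ξ).trans ?_⟩
  rw [mul_assoc]
  gcongr
  have h2 : (1 + ‖ξ‖ ^ 2) ^ (s / 2) = (Real.sqrt (1 + ‖ξ‖ ^ 2)) ^ s := by
    rw [Real.sqrt_eq_rpow, ← Real.rpow_mul (by positivity)]
    congr 1
    ring
  rw [h2, ← Real.mul_rpow (by positivity) (by positivity)]
  gcongr
  have h3 : 1 ≤ Real.sqrt (1 + ‖ξ‖ ^ 2) := Real.one_le_sqrt.2 (by nlinarith [norm_nonneg ξ])
  have h4 : ‖ξ‖ ≤ Real.sqrt (1 + ‖ξ‖ ^ 2) := Real.le_sqrt_of_sq_le (by linarith)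
  linarith

theorem isTemperateWeight_rpow {s : ℝ} (hs : 0 ≤ s) :
    IsTemperateWeight fun ξ => (((2 * Real.pi * ‖ξ‖) ^ s : ℝ) : ℂ) := by
  refine isTemperateWeight_of_le (C := (2 * Real.pi) ^ s) (s := s) (by fun_prop) (fun ξ => ?_)
    (by positivity) hs
  rw [Complex.norm_real, Real.norm_of_nonneg (by positivity),
    Real.mul_rpow (by positivity) (by positivity)]
  gcongr
  linarith

theorem isTemperateWeight_one_add_rpow {s : ℝ} (hs : 0 ≤ s) :
    IsTemperateWeight fun ξ => ((1 + (2 * Real.pi * ‖ξ‖) ^ s : ℝ) : ℂ) := by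
  refine isTemperateWeight_of_le (C := 1 + (2 * Real.pi) ^ s) (s := s) (by fun_prop) (fun ξ => ?_)
    (by positivity) hs
  have h0 : 1 ≤ (1 + ‖ξ‖) ^ s := Real.one_le_rpow (by linarith [norm_nonneg ξ]) hs
  rw [Complex.norm_real, Real.norm_of_nonneg (by positivity),
    Real.mul_rpow (by positivity) (by positivity), add_mul, one_mul]
  gcongr
  linarith

/-- The symbol `2πi ξ_j` of `∂_j`. -/
noncomputable def derivSymbol (j : Fin 3) (ξ : E3) : ℂ := 2 * Real.pi * Complex.I * (ξ j : ℂ)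

theorem measurable_derivSymbol (j : Fin 3) : Measurable (derivSymbol j) := by
  unfold derivSymbol
  fun_prop

theorem norm_derivSymbol_le (j : Fin 3) (ξ : E3) : ‖derivSymbol j ξ‖ ≤ 2 * Real.pi * ‖ξ‖ := by
  simp only [derivSymbol, norm_mul, Complex.norm_I, mul_one, Complex.norm_real, Complex.norm_ofNat]
  rw [Real.norm_of_nonneg Real.pi_pos.le]
  gcongr
  exact PiLp.norm_apply_le ξ j

theorem isTemperateWeight_mul_derivSymbol {w : E3 → ℂ} (hw : IsTemperateWeight w) (j : Fin 3) :
    IsTemperateWeight fun ξ => w ξ * derivSymbol j ξ := by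
  obtain ⟨hm, C, r, hC⟩ := hw
  refine ⟨hm.mul (measurable_derivSymbol j), |C| * (2 * Real.pi), r + 1, fun ξ => ?_⟩
  rw [norm_mul, Real.rpow_add_one (by positivity)]
  have h1 : ‖ξ‖ ≤ 1 + ‖ξ‖ ^ 2 := by nlinarith [sq_nonneg (‖ξ‖ - 1), norm_nonneg ξ]
  calc _ ≤ (|C| * (1 + ‖ξ‖ ^ 2) ^ r) * (2 * Real.pi * (1 + ‖ξ‖ ^ 2)) := by
        gcongr
        · exact (hC ξ).trans (by gcongr; exact le_abs_self C)
        · exact (norm_derivSymbol_le j ξ).trans (by gcongr)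
    _ = _ := by ring

/-- Multiplication by a bounded function as an operator on `L²`. -/
noncomputable def mulOp {σ : E3 → ℂ} (hσ : MemLp σ ⊤ (volume : Measure E3)) : L2C →L[ℂ] L2C :=
  (ContinuousLinearMap.lsmul ℂ ℂ).holderL volume ⊤ 2 2 (hσ.toLp σ)

theorem coeFn_mulOp {σ : E3 → ℂ} (hσ : MemLp σ ⊤ (volume : Measure E3)) (f : L2C) :
    mulOp hσ f =ᵐ[volume] fun ξ => σ ξ • f ξ := by
  have h := (ContinuousLinearMap.lsmul ℂ ℂ (E := C3)).coeFn_holder (r := 2) (hσ.toLp σ) f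
  filter_upwards [h, hσ.coeFn_toLp] with ξ h1 h2
  refine Eq.trans h1 ?_
  rw [h2]
  rfl

theorem memLp_top_of_le {σ : E3 → ℂ} (hm : Measurable σ) (C : ℝ) (h : ∀ ξ, ‖σ ξ‖ ≤ C) :
    MemLp σ ⊤ (volume : Measure E3) :=
  memLp_top_of_bound hm.aestronglyMeasurable C (Eventually.of_forall h)

/-! ### Schwartz fields -/

theorem fourier_postcompCLM {F G : Type*} [NormedAddCommGroup F] [NormedSpace ℂ F]
    [NormedAddCommGroup G] [NormedSpace ℂ G] [CompleteSpace F] [CompleteSpace G]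
    (L : F →L[ℂ] G) (f : 𝓢(E3, F)) (ξ : E3) :
    (𝓕 (SchwartzMap.postcompCLM L f) : 𝓢(E3, G)) ξ = L ((𝓕 f : 𝓢(E3, F)) ξ) := by
  rw [SchwartzMap.fourier_coe, SchwartzMap.fourier_coe, Real.fourier_eq, Real.fourier_eq,
    ← ContinuousLinearMap.integral_comp_comm]
  · congr 1
    ext x
    simp [Circle.smul_def]
  · exact (Real.fourierIntegral_convergent_iff _).2 f.integrable

theorem fourier_lineDerivOp {F : Type*} [NormedAddCommGroup F] [NormedSpace ℂ F] [CompleteSpace F]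
    (χ : 𝓢(E3, F)) (j : Fin 3) (ξ : E3) :
    (𝓕 (∂_{EuclideanSpace.single j (1 : ℝ)} χ) : 𝓢(E3, F)) ξ =
      derivSymbol j ξ • (𝓕 χ : 𝓢(E3, F)) ξ := by
  rw [SchwartzMap.fourier_lineDerivOp_eq]
  have h : (inner ℝ · (EuclideanSpace.single j (1 : ℝ)) : E3 → ℝ).HasTemperateGrowth :=
    Function.hasTemperateGrowth_inner_left _
  simp only [smul_apply, SchwartzMap.smulLeftCLM_apply_apply h, derivSymbol]
  rw [EuclideanSpace.inner_single_right, mul_smul, mul_smul, mul_smul, Complex.coe_smul]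
  simp [mul_smul]

/-- The field `ρ v` for a real test function `ρ` and a vector `v`. -/
noncomputable def testField (ρ : E3 → ℝ) (hρ : ContDiff ℝ ∞ ρ) (hc : HasCompactSupport ρ) (v : C3) :
    𝓢(E3, C3) :=
  SchwartzMap.postcompCLM (ContinuousLinearMap.toSpanSingleton ℂ v) (schwartzOfReal ρ hρ hc)

theorem hasCompactSupport_testField (ρ : E3 → ℝ) (hρ : ContDiff ℝ ∞ ρ) (hc : HasCompactSupport ρ)
    (v : C3) : HasCompactSupport (testField ρ hρ hc v) :=
  hc.comp_left (g := fun r : ℝ => (r : ℂ) • v) (by simp)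

theorem fourier_testField (ρ : E3 → ℝ) (hρ : ContDiff ℝ ∞ ρ) (hc : HasCompactSupport ρ) (v : C3)
    (ξ : E3) : (𝓕 (testField ρ hρ hc v) : 𝓢(E3, C3)) ξ = 𝓕 (fun x => (ρ x : ℂ)) ξ • v := by
  rw [testField, fourier_postcompCLM]
  rfl

theorem ae_eq_zero_of_integral_weight_mul_fourier {w g : E3 → ℂ} (hw : IsTemperateWeight w)
    (hg : MemLp g 2 volume)
    (h : ∀ (ρ : E3 → ℝ), ContDiff ℝ ∞ ρ → HasCompactSupport ρ →
      ∫ ξ, w ξ * g ξ * 𝓕 (fun x => (ρ x : ℂ)) ξ = 0) : (fun ξ => w ξ * g ξ) =ᵐ[volume] 0 := by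
  refine ae_eq_zero_of_integral_mul_fourier (fun ψ => ?_) h
  have h1 := (hw.memLp_smul ψ).integrable_mul hg
  refine h1.congr (Eventually.of_forall fun ξ => ?_)
  simp only [smul_eq_mul, Pi.mul_apply]
  ring

/-! ### Density of test fields in `H¹` -/

theorem isTemperateWeight_one_add : IsTemperateWeight fun ξ => ((1 + 2 * Real.pi * ‖ξ‖ : ℝ) : ℂ) := by
  simpa using isTemperateWeight_one_add_rpow zero_le_one

theorem one_add_ne_zero (ξ : E3) : ((1 + 2 * Real.pi * ‖ξ‖ : ℝ) : ℂ) ≠ 0 := by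
  have : 0 < 1 + 2 * Real.pi * ‖ξ‖ := by positivity
  exact_mod_cast this.ne'

theorem norm_one_add (ξ : E3) :
    ‖((1 + 2 * Real.pi * ‖ξ‖ : ℝ) : ℂ)‖ = 1 + 2 * Real.pi * ‖ξ‖ := by
  rw [Complex.norm_real, Real.norm_of_nonneg (by positivity)]

/-- `(1 + |ξ|) χ̂` for a Schwartz field `χ`. -/
noncomputable def weightedFourier : 𝓢(E3, C3) →ₗ[ℂ] L2C where
  toFun χ := (isTemperateWeight_one_add.memLp_smul (𝓕 χ : 𝓢(E3, C3))).toLp _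
  map_add' χ₁ χ₂ := by
    rw [← MemLp.toLp_add]
    congr 1
    ext1 ξ
    simp [FourierTransform.fourier_add]
  map_smul' c χ := by
    rw [RingHom.id_apply, ← MemLp.toLp_const_smul]
    congr 1
    ext1 ξ
    simp only [FourierTransform.fourier_smul, smul_apply, Pi.smul_apply]
    exact smul_comm _ _ _

theorem coeFn_weightedFourier (χ : 𝓢(E3, C3)) : weightedFourier χ =ᵐ[volume]
    fun ξ => ((1 + 2 * Real.pi * ‖ξ‖ : ℝ) : ℂ) • (𝓕 χ : 𝓢(E3, C3)) ξ :=
  (isTemperateWeight_one_add.memLp_smul (𝓕 χ : 𝓢(E3, C3))).coeFn_toLp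

/-- Schwartz fields of compact support. -/
def compactSchwartz : Submodule ℂ 𝓢(E3, C3) where
  carrier := {χ | HasCompactSupport χ}
  add_mem' h₁ h₂ := h₁.add h₂
  zero_mem' := HasCompactSupport.zero
  smul_mem' c _ h := h.smul_left (f := fun _ => c)

/-- Density of test fields in $H^1$, transported to $L^2$ by the weight. If $h$ is orthogonal to all
$(1+|\xi|)\hat\rho\,e_i$, then $(1+|\xi|)\overline{h_i}$ annihilates every $\hat\rho$ and vanishes
by the uniqueness lemma. -/
theorem dense_weightedFourier :
    (compactSchwartz.map weightedFourier).topologicalClosure = ⊤ := by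
  rw [Submodule.topologicalClosure_eq_top_iff, Submodule.eq_bot_iff]
  intro h hh
  rw [Submodule.mem_orthogonal'] at hh
  have key : ∀ i : Fin 3, ∀ᵐ ξ ∂(volume : Measure E3), h ξ i = 0 := by
    intro i
    have hm : MemLp (fun ξ => (starRingEnd ℂ) (h ξ i)) 2 (volume : Measure E3) := by
      have h1 : MemLp (fun ξ => h ξ i) 2 (volume : Measure E3) :=
        (EuclideanSpace.proj (𝕜 := ℂ) i : C3 →L[ℂ] ℂ).comp_memLp' (Lp.memLp h)
      exact h1.star
    have h2 := ae_eq_zero_of_integral_weight_mul_fourier isTemperateWeight_one_add hm ?_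
    · filter_upwards [h2] with ξ hξ
      exact (starRingEnd ℂ).injective (by
        rw [map_zero]; exact (mul_eq_zero.1 hξ).resolve_left (one_add_ne_zero ξ))
    · intro ρ hρ hc
      have h3 := hh _ (Submodule.mem_map_of_mem (f := weightedFourier)
        (show testField ρ hρ hc (EuclideanSpace.single i 1) ∈ compactSchwartz from
          hasCompactSupport_testField ρ hρ hc _))
      rw [L2.inner_def] at h3
      rw [← h3]
      apply integral_congr_ae
      filter_upwards [coeFn_weightedFourier (testField ρ hρ hc (EuclideanSpace.single i 1))] with ξ hξ
      rw [hξ, fourier_testField, inner_smul_right, inner_smul_right,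
        EuclideanSpace.inner_single_right]
      ring
  rw [Lp.eq_zero_iff_ae_eq_zero]
  filter_upwards [ae_all_iff.2 key] with ξ hξ
  ext i
  exact hξ i

/-- The field `f` belongs to `H¹`. -/
def HasH1 (f : L2C) : Prop :=
  MemLp (fun ξ => ((2 * Real.pi * ‖ξ‖ : ℝ) : ℂ) • (𝓕 f : L2C) ξ) 2 (volume : Measure E3)

theorem HasH1.memLp_one_add {f : L2C} (hf : HasH1 f) :
    MemLp (fun ξ => ((1 + 2 * Real.pi * ‖ξ‖ : ℝ) : ℂ) • (𝓕 f : L2C) ξ) 2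
      (volume : Measure E3) := by
  refine (MemLp.add (Lp.memLp (𝓕 f : L2C)) hf).ae_eq (Eventually.of_forall fun ξ => ?_)
  simp [add_smul]

theorem HasH1.memLp_derivSymbol {f : L2C} (hf : HasH1 f) (j : Fin 3) :
    MemLp (fun ξ => derivSymbol j ξ • (𝓕 f : L2C) ξ) 2 (volume : Measure E3) := by
  refine hf.mono ((measurable_derivSymbol j).aestronglyMeasurable.smul
    (Lp.aestronglyMeasurable _)) (Eventually.of_forall fun ξ => ?_)
  rw [norm_smul, norm_smul, Complex.norm_real, Real.norm_of_nonneg (by positivity)]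
  gcongr
  exact norm_derivSymbol_le j ξ

open Classical in
/-- The Fourier transform of `∂_j f`, for `f` in `H¹`. -/
noncomputable def freqDeriv (j : Fin 3) (f : L2C) : L2C :=
  if h : MemLp (fun ξ => derivSymbol j ξ • (𝓕 f : L2C) ξ) 2 (volume : Measure E3)
    then h.toLp _ else 0

theorem HasH1.coeFn_freqDeriv {f : L2C} (hf : HasH1 f) (j : Fin 3) :
    freqDeriv j f =ᵐ[volume] fun ξ => derivSymbol j ξ • (𝓕 f : L2C) ξ := by
  rw [freqDeriv, dif_pos (hf.memLp_derivSymbol j)]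
  exact (hf.memLp_derivSymbol j).coeFn_toLp

theorem memLp_top_inv_one_add :
    MemLp (fun ξ : E3 => (((1 + 2 * Real.pi * ‖ξ‖ : ℝ) : ℂ))⁻¹) ⊤ volume := by
  refine memLp_top_of_le (by fun_prop) 1 fun ξ => ?_
  rw [norm_inv, norm_one_add]
  exact inv_le_one_of_one_le₀ (by linarith [(by positivity : 0 ≤ 2 * Real.pi * ‖ξ‖)])

theorem memLp_top_derivSymbol_mul_inv (j : Fin 3) :
    MemLp (fun ξ : E3 => derivSymbol j ξ * (((1 + 2 * Real.pi * ‖ξ‖ : ℝ) : ℂ))⁻¹) ⊤ volume := by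
  refine memLp_top_of_le ((measurable_derivSymbol j).mul (by fun_prop)) 1 fun ξ => ?_
  rw [norm_mul, norm_inv, norm_one_add, ← div_eq_mul_inv, div_le_one (by positivity)]
  exact (norm_derivSymbol_le j ξ).trans (by linarith)

/-- One approximation of $(1+|\xi|)\hat f$ serves for everything: the bounded multipliers
$1/(1+|\xi|)$ and $2\pi i\xi_j/(1+|\xi|)$, with the weight taken as $1+2\pi|\xi|$, recover the field
and its derivatives. -/
theorem exists_compact_approx {f : L2C} (hf : HasH1 f) :
    ∃ χ : ℕ → 𝓢(E3, C3), (∀ n, HasCompactSupport (χ n)) ∧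
      Tendsto (fun n => (χ n).toLp 2 volume) atTop (𝓝 f) ∧
      ∀ j : Fin 3, Tendsto (fun n => (∂_{EuclideanSpace.single j (1 : ℝ)} (χ n)).toLp 2 volume)
        atTop (𝓝 (𝓕⁻ (freqDeriv j f))) := by
  set g : L2C := hf.memLp_one_add.toLp _ with hg
  have hgc := hf.memLp_one_add.coeFn_toLp
  have hmem : g ∈ (compactSchwartz.map weightedFourier).topologicalClosure := by
    rw [dense_weightedFourier]; trivial
  obtain ⟨s, hs, hlim⟩ := mem_closure_iff_seq_limit.1 hmem
  choose χ hχ hχs using fun n => Submodule.mem_map.1 (hs n)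
  obtain rfl : (fun n => weightedFourier (χ n)) = s := funext hχs
  refine ⟨χ, hχ, ?_, fun j => ?_⟩
  · have h1 := ((mulOp memLp_top_inv_one_add).continuous.tendsto g).comp hlim
    have h2 := ((Lp.fourierTransformₗᵢ E3 C3).symm.continuous.tendsto _).comp h1
    have e1 : mulOp memLp_top_inv_one_add g = 𝓕 f := by
      apply Lp.ext
      filter_upwards [coeFn_mulOp memLp_top_inv_one_add g, hgc] with ξ h3 h4
      rw [h3, h4, smul_smul, inv_mul_cancel₀ (one_add_ne_zero ξ), one_smul]
    have e2 : ∀ n, mulOp memLp_top_inv_one_add (weightedFourier (χ n)) =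
        𝓕 ((χ n).toLp 2 volume) := by
      intro n
      rw [SchwartzMap.toLp_fourier_eq]
      apply Lp.ext
      filter_upwards [coeFn_mulOp memLp_top_inv_one_add (weightedFourier (χ n)),
        coeFn_weightedFourier (χ n), (𝓕 (χ n) : 𝓢(E3, C3)).coeFn_toLp 2 volume] with ξ h3 h4 h5
      rw [h3, h4, h5, smul_smul, inv_mul_cancel₀ (one_add_ne_zero ξ), one_smul]
    rw [e1] at h2
    simp only [Function.comp_def, e2] at h2
    have e3 : (Lp.fourierTransformₗᵢ E3 C3).symm (𝓕 f) = f :=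
      (Lp.fourierTransformₗᵢ E3 C3).symm_apply_apply f
    rw [e3] at h2
    refine h2.congr fun n => ?_
    exact (Lp.fourierTransformₗᵢ E3 C3).symm_apply_apply _
  · have h1 := ((mulOp (memLp_top_derivSymbol_mul_inv j)).continuous.tendsto g).comp hlim
    have h2 := ((Lp.fourierTransformₗᵢ E3 C3).symm.continuous.tendsto _).comp h1
    have e1 : mulOp (memLp_top_derivSymbol_mul_inv j) g = freqDeriv j f := by
      apply Lp.ext
      filter_upwards [coeFn_mulOp (memLp_top_derivSymbol_mul_inv j) g, hgc,
        hf.coeFn_freqDeriv j] with ξ h3 h4 h5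
      rw [h3, h4, h5, smul_smul, mul_assoc, inv_mul_cancel₀ (one_add_ne_zero ξ), mul_one]
    have e2 : ∀ n, mulOp (memLp_top_derivSymbol_mul_inv j) (weightedFourier (χ n)) =
        𝓕 ((∂_{EuclideanSpace.single j (1 : ℝ)} (χ n)).toLp 2 volume) := by
      intro n
      rw [SchwartzMap.toLp_fourier_eq]
      apply Lp.ext
      filter_upwards [coeFn_mulOp (memLp_top_derivSymbol_mul_inv j) (weightedFourier (χ n)),
        coeFn_weightedFourier (χ n),
        (𝓕 (∂_{EuclideanSpace.single j (1 : ℝ)} (χ n)) : 𝓢(E3, C3)).coeFn_toLp 2 volume]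
        with ξ h3 h4 h5
      rw [h3, h4, h5, fourier_lineDerivOp, smul_smul, mul_assoc,
        inv_mul_cancel₀ (one_add_ne_zero ξ), mul_one]
    rw [e1] at h2
    simp only [Function.comp_def, e2] at h2
    refine h2.congr fun n => ?_
    exact (Lp.fourierTransformₗᵢ E3 C3).symm_apply_apply _

/-! ### The embedding of `H¹` into `L⁴` -/

/-- Hölder's inequality gives $\|f\|_4\le\|f\|_2^{1/4}\|f\|_6^{3/4}$. -/
theorem eLpNorm_four_le_add {X F : Type*} [MeasurableSpace X] {μ : Measure X}
    [NormedAddCommGroup F] {f : X → F} (hf : AEStronglyMeasurable f μ) :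
    eLpNorm f 4 μ ≤ eLpNorm f 2 μ + eLpNorm f 6 μ := by
  have e4 := eLpNorm_eq_lintegral_rpow_enorm_toReal (p := 4) (f := f) (μ := μ) (by norm_num)
    (by norm_num)
  have e2 := eLpNorm_eq_lintegral_rpow_enorm_toReal (p := 2) (f := f) (μ := μ) (by norm_num)
    (by norm_num)
  have e6 := eLpNorm_eq_lintegral_rpow_enorm_toReal (p := 6) (f := f) (μ := μ) (by norm_num)
    (by norm_num)
  simp only [ENNReal.toReal_ofNat] at e4 e2 e6
  set A := eLpNorm f 2 μ
  set B := eLpNorm f 6 μ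
  have h1 := ENNReal.lintegral_mul_norm_pow_le (μ := μ) (hf.enorm.pow_const (2 : ℝ))
    (hf.enorm.pow_const (6 : ℝ)) (p := 1 / 2) (q := 1 / 2) (by norm_num) (by norm_num)
    (by norm_num)
  have h2 : ∀ x, (‖f x‖ₑ ^ (2 : ℝ)) ^ (1 / 2 : ℝ) * (‖f x‖ₑ ^ (6 : ℝ)) ^ (1 / 2 : ℝ) =
      ‖f x‖ₑ ^ (4 : ℝ) := by
    intro x
    rw [← ENNReal.rpow_mul, ← ENNReal.rpow_mul, ← ENNReal.rpow_add_of_nonneg _ _ (by norm_num)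
      (by norm_num)]
    norm_num
  simp only [h2] at h1
  rw [e4]
  calc _ ≤ ((∫⁻ x, ‖f x‖ₑ ^ (2 : ℝ) ∂μ) ^ (1 / 2 : ℝ) *
        (∫⁻ x, ‖f x‖ₑ ^ (6 : ℝ) ∂μ) ^ (1 / 2 : ℝ)) ^ (1 / 4 : ℝ) := by gcongr
    _ = A ^ (1 / 4 : ℝ) * B ^ (3 / 4 : ℝ) := by
        rw [ENNReal.mul_rpow_of_nonneg _ _ (by norm_num), e2, e6, ← ENNReal.rpow_mul,
          ← ENNReal.rpow_mul, ← ENNReal.rpow_mul]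
        norm_num
    _ ≤ (A + B) ^ (1 / 4 : ℝ) * (A + B) ^ (3 / 4 : ℝ) := by
        gcongr
        · exact le_self_add
        · exact le_add_self
    _ = A + B := by
        rw [← ENNReal.rpow_add_of_nonneg _ _ (by norm_num) (by norm_num)]
        norm_num

theorem norm_le_sum_norm_single {F : Type*} [NormedAddCommGroup F] [NormedSpace ℝ F]
    (L : E3 →L[ℝ] F) : ‖L‖ ≤ ∑ j : Fin 3, ‖L (EuclideanSpace.single j 1)‖ := by
  refine L.opNorm_le_bound (by positivity) fun v => ?_
  have hv : v = ∑ j : Fin 3, v j • EuclideanSpace.single j (1 : ℝ) := by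
    ext i
    simp [Fin.sum_univ_three]
    fin_cases i <;> simp
  conv_lhs => rw [hv]
  rw [map_sum, Finset.sum_mul]
  refine (norm_sum_le _ _).trans (Finset.sum_le_sum fun j _ => ?_)
  rw [map_smul, norm_smul, mul_comm]
  gcongr
  exact PiLp.norm_apply_le v j

/-- In dimension three the Gagliardo–Nirenberg–Sobolev inequality controls $L^6$ by the $L^2$ norm
of the gradient; interpolation with $L^2$ gives $L^4$. -/
theorem exists_eLpNorm_four_le : ∃ C : NNReal, ∀ χ : 𝓢(E3, C3), HasCompactSupport χ →
    eLpNorm χ 4 volume ≤ C * (eLpNorm χ 2 volume +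
      ∑ j : Fin 3, eLpNorm (∂_{EuclideanSpace.single j (1 : ℝ)} χ : 𝓢(E3, C3)) 2 volume) := by
  refine ⟨1 + SNormLESNormFDerivOfEqConst C3 (volume : Measure E3) 2, fun χ hχ => ?_⟩
  set K := SNormLESNormFDerivOfEqConst C3 (volume : Measure E3) 2
  have h6 : eLpNorm χ 6 volume ≤ K * eLpNorm (fderiv ℝ χ) 2 volume := by
    have := eLpNorm_le_eLpNorm_fderiv_of_eq (volume : Measure E3) (χ.smooth 1) hχ (p := 2)
      (p' := 6) (by norm_num) (by simp) (by simp; norm_num)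
    simpa using this
  have hd : eLpNorm (fderiv ℝ χ) 2 volume ≤
      ∑ j : Fin 3, eLpNorm (∂_{EuclideanSpace.single j (1 : ℝ)} χ : 𝓢(E3, C3)) 2 volume := by
    calc _ ≤ eLpNorm (∑ j : Fin 3, fun x =>
          ‖(∂_{EuclideanSpace.single j (1 : ℝ)} χ : 𝓢(E3, C3)) x‖) 2 volume := by
          refine eLpNorm_mono_real fun x => ?_
          refine (norm_le_sum_norm_single _).trans ?_
          simp [SchwartzMap.lineDerivOp_apply_eq_fderiv]
      _ ≤ _ := by
          refine (eLpNorm_sum_le (fun j _ => (SchwartzMap.continuous _).norm.aestronglyMeasurable)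
            (by norm_num)).trans (le_of_eq ?_)
          refine Finset.sum_congr rfl fun j _ => ?_
          exact eLpNorm_norm _
  refine (eLpNorm_four_le_add χ.continuous.aestronglyMeasurable).trans ?_
  set A := eLpNorm χ 2 volume
  set S := ∑ j : Fin 3, eLpNorm (∂_{EuclideanSpace.single j (1 : ℝ)} χ : 𝓢(E3, C3)) 2 volume
  calc _ ≤ A + K * S := by gcongr; exact h6.trans (by gcongr)
    _ ≤ (A + S) + K * (A + S) := by
        gcongr
        · exact le_self_add
        · exact le_add_self
    _ = _ := by push_cast; ring

theorem exists_norm_toLp_four_le : ∃ C : ℝ, ∀ χ : 𝓢(E3, C3), HasCompactSupport χ →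
    ‖χ.toLp 4 volume‖ ≤ C * (‖χ.toLp 2 volume‖ +
      ∑ j : Fin 3, ‖(∂_{EuclideanSpace.single j (1 : ℝ)} χ : 𝓢(E3, C3)).toLp 2 volume‖) := by
  obtain ⟨C, hC⟩ := exists_eLpNorm_four_le
  refine ⟨C, fun χ hχ => ?_⟩
  have hfin : ∀ φ : 𝓢(E3, C3), eLpNorm φ 2 volume ≠ ⊤ := fun φ => (φ.eLpNorm_lt_top 2 volume).ne
  have h1 := hC χ hχ
  simp only [SchwartzMap.norm_toLp]
  rw [← ENNReal.toReal_sum fun j _ => hfin _, ← ENNReal.toReal_add (hfin _)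
    (ENNReal.sum_ne_top.2 fun j _ => hfin _), ← ENNReal.coe_toReal, ← ENNReal.toReal_mul]
  refine ENNReal.toReal_mono ?_ h1
  exact ENNReal.mul_ne_top ENNReal.coe_ne_top (ENNReal.add_ne_top.2
    ⟨hfin _, ENNReal.sum_ne_top.2 fun j _ => hfin _⟩)

instance : Fact ((1 : ℝ≥0∞) ≤ 4) := ⟨by norm_num⟩

theorem ae_eq_of_tendsto_toLp {χ : ℕ → 𝓢(E3, C3)} {f : L2C} {f₄ : Lp C3 4 (volume : Measure E3)}
    (h₂ : Tendsto (fun n => (χ n).toLp 2 volume) atTop (𝓝 f))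
    (h₄ : Tendsto (fun n => (χ n).toLp 4 volume) atTop (𝓝 f₄)) : f₄ =ᵐ[volume] f := by
  have m2 := tendstoInMeasure_of_tendsto_Lp h₂
  have m4 := tendstoInMeasure_of_tendsto_Lp h₄
  refine tendstoInMeasure_ae_unique (m4.congr_left fun n => ?_) m2
  exact ((χ n).coeFn_toLp 4 volume).trans ((χ n).coeFn_toLp 2 volume).symm

/-- The Sobolev estimate applied to differences makes the sequence Cauchy in $L^4$; its two limits
agree because both convergences imply convergence in measure. -/
theorem exists_tendsto_toLp_four {χ : ℕ → 𝓢(E3, C3)} {f : L2C} {g : Fin 3 → L2C}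
    (hc : ∀ n, HasCompactSupport (χ n))
    (h₂ : Tendsto (fun n => (χ n).toLp 2 volume) atTop (𝓝 f))
    (hd : ∀ j : Fin 3, Tendsto (fun n =>
      (∂_{EuclideanSpace.single j (1 : ℝ)} (χ n)).toLp 2 volume) atTop (𝓝 (g j))) :
    ∃ f₄ : Lp C3 4 (volume : Measure E3),
      Tendsto (fun n => (χ n).toLp 4 volume) atTop (𝓝 f₄) ∧ f₄ =ᵐ[volume] f := by
  obtain ⟨C, hC⟩ := exists_norm_toLp_four_le
  have hbound : ∀ n m, dist ((χ n).toLp 4 volume) ((χ m).toLp 4 volume) ≤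
      C * (dist ((χ n).toLp 2 volume) ((χ m).toLp 2 volume) + ∑ j : Fin 3,
        dist ((∂_{EuclideanSpace.single j (1 : ℝ)} (χ n)).toLp 2 volume)
          ((∂_{EuclideanSpace.single j (1 : ℝ)} (χ m)).toLp 2 volume)) := by
    intro n m
    have hs : ∀ (p : ℝ≥0∞) [Fact (1 ≤ p)] (φ ψ : 𝓢(E3, C3)),
        dist (φ.toLp p volume) (ψ.toLp p volume) = ‖(φ - ψ : 𝓢(E3, C3)).toLp p volume‖ := by
      intro p _ φ ψ
      rw [dist_eq_norm]
      congr 1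
    have hl : ∀ (v : E3) (φ ψ : 𝓢(E3, C3)), ∂_{v} φ - ∂_{v} ψ = ∂_{v} (φ - ψ) := fun v φ ψ =>
      ((lineDerivOpCLM ℝ 𝓢(E3, C3) v).map_sub φ ψ).symm
    rw [hs, hs]
    simp only [hs, hl]
    exact hC (χ n - χ m) ((hc n).sub (hc m))
  have hcauchy : CauchySeq fun n => (χ n).toLp 4 (volume : Measure E3) := by
    rw [cauchySeq_iff_tendsto_dist_atTop_0]
    have d2 := cauchySeq_iff_tendsto_dist_atTop_0.1 h₂.cauchySeq
    have dd := fun j => cauchySeq_iff_tendsto_dist_atTop_0.1 (hd j).cauchySeq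
    have hl := (d2.add (tendsto_finsetSum Finset.univ fun j _ => dd j)).const_mul (C : ℝ)
    simp only [Finset.sum_const_zero, add_zero, mul_zero] at hl
    exact squeeze_zero (fun _ => dist_nonneg) (fun p => hbound p.1 p.2) hl
  obtain ⟨f₄, h₄⟩ := cauchySeq_tendsto_of_complete hcauchy
  exact ⟨f₄, h₄, ae_eq_of_tendsto_toLp h₂ h₄⟩

/-! ### Antisymmetry of the trilinear form -/

open Classical in
/-- The field `a_j b`, if it is square integrable. -/
noncomputable def prodField (a b : L2R) (j : Fin 3) : L2C :=
  if h : MemLp (fun x => a x j • complexify (b x)) 2 (volume : Measure E3) then h.toLp _ else 0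

theorem coeFn_prodField {a b : L2R} {j : Fin 3}
    (h : MemLp (fun x => a x j • complexify (b x)) 2 (volume : Measure E3)) :
    prodField a b j =ᵐ[volume] fun x => a x j • complexify (b x) := by
  rw [prodField, dif_pos h]
  exact h.coeFn_toLp

instance : ENNReal.HolderTriple 4 4 2 where
  inv_add_inv_eq_inv := by
    have h : (2 : ℝ≥0∞)⁻¹ = 2 * (4 : ℝ≥0∞)⁻¹ := by
      rw [show (4 : ℝ≥0∞) = 2 * 2 by norm_num, ENNReal.mul_inv (by norm_num) (by norm_num),
        ← mul_assoc, ENNReal.mul_inv_cancel (by norm_num) (by norm_num), one_mul]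
    rw [h, two_mul]

theorem memLp_apply {a : E3 → E3} {p : ℝ≥0∞} (ha : MemLp a p volume) (j : Fin 3) :
    MemLp (fun x => a x j) p volume :=
  (EuclideanSpace.proj (𝕜 := ℝ) j : E3 →L[ℝ] ℝ).comp_memLp' ha

theorem memLp_prod {a b : L2R} (ha : MemLp a 4 volume) (hb : MemLp b 4 volume) (j : Fin 3) :
    MemLp (fun x => a x j • complexify (b x)) 2 (volume : Measure E3) :=
  (complexify.comp_memLp' hb).smul (memLp_apply ha j)

/-- Multiplication by `a_j`, as an operator from `L⁴` to `L²`. -/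
noncomputable def smulFour {a : L2R} (ha : MemLp a 4 volume) (j : Fin 3) :
    Lp C3 4 (volume : Measure E3) →L[ℝ] L2C :=
  (ContinuousLinearMap.lsmul ℝ ℝ).holderL volume 4 4 2 ((memLp_apply ha j).toLp _)

theorem coeFn_smulFour {a : L2R} (ha : MemLp a 4 volume) (j : Fin 3)
    (f : Lp C3 4 (volume : Measure E3)) :
    smulFour ha j f =ᵐ[volume] fun x => a x j • f x := by
  have h := (ContinuousLinearMap.lsmul ℝ ℝ (E := C3)).coeFn_holder (r := 2)
    ((memLp_apply ha j).toLp _) f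
  filter_upwards [h, (memLp_apply ha j).coeFn_toLp] with ξ h1 h2
  refine Eq.trans h1 ?_
  rw [h2]
  rfl

theorem eq_sum_single (v : E3) : v = ∑ j : Fin 3, v j • EuclideanSpace.single j (1 : ℝ) := by
  ext i
  simp [Fin.sum_univ_three]
  fin_cases i <;> simp

/-- By the product rule the integrand is $a\cdot\nabla\,\mathrm{Re}\langle\chi,\tau\rangle$, the
derivative of a real test function along a solenoidal field. Compact support of one factor suffices.
-/
theorem sum_inner_smulFour_eq_zero {a : L2R} (hs : IsSolenoidal a) (ha : MemLp a 4 volume)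
    {χ τ : 𝓢(E3, C3)} (hχ : HasCompactSupport χ) :
    ∑ j : Fin 3, ((inner ℂ (smulFour ha j (χ.toLp 4 volume))
        ((∂_{EuclideanSpace.single j (1 : ℝ)} τ).toLp 2 volume)).re +
      (inner ℂ (smulFour ha j (τ.toLp 4 volume))
        ((∂_{EuclideanSpace.single j (1 : ℝ)} χ).toLp 2 volume)).re) = 0 := by
  set r : E3 → ℝ := fun x => (inner ℂ (χ x) (τ x)).re with hr
  have hrs : ContDiff ℝ ∞ r := Complex.reCLM.contDiff.comp ((χ.smooth ⊤).inner ℂ (τ.smooth ⊤))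
  have hrc : HasCompactSupport r := hχ.mono fun x hx => by
    contrapose! hx
    simp only [Function.mem_support, not_not] at hx
    simp [hr, hx]
  rw [← hs r hrs hrc]
  have hre : ∀ f g : L2C, (inner ℂ f g).re = ∫ x, (inner ℂ (f x) (g x)).re := by
    intro f g
    rw [L2.inner_def]
    exact (integral_re (𝕜 := ℂ) (L2.integrable_inner f g)).symm
  have hint : ∀ f g : L2C, Integrable fun x => (inner ℂ (f x) (g x)).re := fun f g =>
    Integrable.re (𝕜 := ℂ) (L2.integrable_inner f g)
  simp only [hre]
  rw [← Finset.sum_congr rfl fun j _ => integral_add (hint _ _) (hint _ _), ← integral_finsetSum]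
  swap
  · exact fun j _ => (hint _ _).add (hint _ _)
  apply integral_congr_ae
  have h1 := ae_all_iff.2 fun j => coeFn_smulFour ha j (χ.toLp 4 volume)
  have h2 := ae_all_iff.2 fun j => coeFn_smulFour ha j (τ.toLp 4 volume)
  have h3 := ae_all_iff.2 fun j : Fin 3 =>
    (∂_{EuclideanSpace.single j (1 : ℝ)} χ : 𝓢(E3, C3)).coeFn_toLp 2 volume
  have h4 := ae_all_iff.2 fun j : Fin 3 =>
    (∂_{EuclideanSpace.single j (1 : ℝ)} τ : 𝓢(E3, C3)).coeFn_toLp 2 volume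
  filter_upwards [h1, h2, h3, h4, χ.coeFn_toLp 4 volume, τ.coeFn_toLp 4 volume]
    with x h1 h2 h3 h4 h5 h6
  have hd : ∀ v : E3, fderiv ℝ r x v =
      (inner ℂ (χ x) (fderiv ℝ τ x v) + inner ℂ (fderiv ℝ χ x v) (τ x)).re := by
    intro v
    have hin : DifferentiableAt ℝ (fun y => inner ℂ (χ y) (τ y)) x :=
      χ.differentiableAt.inner ℂ τ.differentiableAt
    have : r = Complex.reCLM ∘ fun y => inner ℂ (χ y) (τ y) := rfl
    rw [this, fderiv_comp x Complex.reCLM.differentiableAt hin, ContinuousLinearMap.fderiv,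
      ContinuousLinearMap.comp_apply, fderiv_inner_apply ℂ χ.differentiableAt τ.differentiableAt]
    rfl
  rw [show fderiv ℝ r x (a x) = ∑ j, a x j * fderiv ℝ r x (EuclideanSpace.single j 1) by
    conv_lhs => rw [eq_sum_single (a x)]
    rw [map_sum]
    simp]
  refine Finset.sum_congr rfl fun j _ => ?_
  simp only [h1, h2, h3, h4, h5, h6, hd, SchwartzMap.lineDerivOp_apply_eq_fderiv]
  rw [← Complex.coe_smul, ← Complex.coe_smul, inner_smul_left, inner_smul_left]
  have hsymm : (inner ℂ (τ x) (fderiv ℝ χ x (EuclideanSpace.single j 1))).re =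
      (inner ℂ (fderiv ℝ χ x (EuclideanSpace.single j 1)) (τ x)).re :=
    inner_re_symm (𝕜 := ℂ) (τ x) (fderiv ℝ χ x (EuclideanSpace.single j 1))
  simp only [Complex.conj_ofReal, Complex.re_ofReal_mul, Complex.add_re, hsymm]
  ring

/-- This is $((a\cdot\nabla)c,b)+((a\cdot\nabla)b,c)=0$, written on the frequency side. Test fields
approximating $b$ and $c$ in $H^1$ converge in $L^4$ as well, and multiplication by $a_j\in L^4$ is
continuous from $L^4$ to $L^2$, so the identity for test fields passes to the limit. -/
theorem sum_inner_prodField_eq_zero {a b c : L2R} (hs : IsSolenoidal a) (ha : MemLp a 4 volume)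
    (hb : HasH1 (toComplex b)) (hc : HasH1 (toComplex c)) :
    ∑ j : Fin 3, ((inner ℂ (𝓕 (prodField a b j)) (freqDeriv j (toComplex c))).re +
      (inner ℂ (𝓕 (prodField a c j)) (freqDeriv j (toComplex b))).re) = 0 := by
  obtain ⟨χ, hχ, hχ2, hχd⟩ := exists_compact_approx hb
  obtain ⟨τ, hτ, hτ2, hτd⟩ := exists_compact_approx hc
  obtain ⟨b₄, hb₄, hbe⟩ := exists_tendsto_toLp_four hχ hχ2 hχd
  obtain ⟨c₄, hc₄, hce⟩ := exists_tendsto_toLp_four hτ hτ2 hτd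
  have hP : ∀ (f : L2R) (f₄ : Lp C3 4 (volume : Measure E3)), f₄ =ᵐ[volume] toComplex f →
      ∀ j, smulFour ha j f₄ = prodField a f j := by
    intro f f₄ hf j
    have h1 : smulFour ha j f₄ =ᵐ[volume] fun x => a x j • complexify (f x) := by
      filter_upwards [coeFn_smulFour ha j f₄, hf, coeFn_toComplex f] with x h1 h2 h3
      rw [h1, h2, h3]
    apply Lp.ext
    exact h1.trans (coeFn_prodField ((Lp.memLp (smulFour ha j f₄)).ae_eq h1)).symm
  have hF : ∀ f g : L2C, inner ℂ (𝓕 f) g = inner ℂ f (𝓕⁻ g) := by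
    intro f g
    rw [← Lp.inner_fourier_eq f (𝓕⁻ g), FourierTransform.fourier_fourierInv_eq]
  have hlim : Tendsto (fun n => ∑ j : Fin 3, ((inner ℂ (smulFour ha j ((χ n).toLp 4 volume))
        ((∂_{EuclideanSpace.single j (1 : ℝ)} (τ n)).toLp 2 volume)).re +
      (inner ℂ (smulFour ha j ((τ n).toLp 4 volume))
        ((∂_{EuclideanSpace.single j (1 : ℝ)} (χ n)).toLp 2 volume)).re)) atTop
      (𝓝 (∑ j : Fin 3, ((inner ℂ (smulFour ha j b₄) (𝓕⁻ (freqDeriv j (toComplex c)))).re +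
        (inner ℂ (smulFour ha j c₄) (𝓕⁻ (freqDeriv j (toComplex b)))).re))) := by
    refine tendsto_finsetSum _ fun j _ => ?_
    refine Tendsto.add ?_ ?_
    · exact (Complex.continuous_re.tendsto _).comp
        ((((smulFour ha j).continuous.tendsto _).comp hb₄).inner (hτd j))
    · exact (Complex.continuous_re.tendsto _).comp
        ((((smulFour ha j).continuous.tendsto _).comp hc₄).inner (hχd j))
  simp only [sum_inner_smulFour_eq_zero hs ha (hχ _)] at hlim
  simp only [hF, ← hP b b₄ hbe, ← hP c c₄ hce]
  exact (tendsto_nhds_unique tendsto_const_nhds hlim).symm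

/-! ### The `L⁴` bound -/

theorem norm_toComplex (f : L2R) : ‖toComplex f‖ = ‖f‖ := by
  rw [Lp.norm_def, Lp.norm_def]
  congr 1
  refine eLpNorm_congr_norm_ae ?_
  filter_upwards [coeFn_toComplex f] with x hx
  rw [hx, norm_complexify]

/-- The compatibility of the $L^2$ transform with the distributional one, through which the norms in
the multiplier hypothesis become computable. -/
theorem isFourierPair_apply (v : L2R) (i : Fin 3) :
    IsFourierPair (fun x => v x i) (fun ξ => (𝓕 (toComplex v) : L2C) ξ i) := by
  have hl : MemLp (fun x => v x i) 2 volume := memLp_apply (Lp.memLp v) i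
  have hr : ∀ g : L2C, MemLp (fun x => g x i) 2 (volume : Measure E3) := fun g =>
    (EuclideanSpace.proj (𝕜 := ℂ) i : C3 →L[ℂ] ℂ).comp_memLp' (Lp.memLp g)
  have hc : MemLp (fun x => ((v x i : ℝ) : ℂ)) 2 volume := hl.ofReal
  refine ⟨hl.1, (hr _).1, fun ψ => hc.integrable_mul (ψ.memLp 2 volume), fun ψ =>
    (hr _).integrable_mul (ψ.memLp 2 volume), fun ψ => ?_⟩
  have key : ∀ (g : L2C) (φ : 𝓢(E3, ℂ)),
      (Lp.toTemperedDistribution g φ) i = ∫ x, g x i * φ x := by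
    intro g φ
    have hint : Integrable (fun x => φ x • g x) (volume : Measure E3) :=
      memLp_one_iff_integrable.1 ((Lp.memLp g).smul (φ.memLp 2 volume))
    rw [Lp.toTemperedDistribution_apply]
    refine Eq.trans ((EuclideanSpace.proj (𝕜 := ℂ) i : C3 →L[ℂ] ℂ).integral_comp_comm hint).symm ?_
    congr 1
    ext x
    simp [mul_comm]
  rw [← key, ← Lp.fourier_toTemperedDistribution_eq, TemperedDistribution.fourier_apply, key]
  apply integral_congr_ae
  filter_upwards [coeFn_toComplex v] with x hx
  rw [hx, complexify_apply]

theorem homSobolevNorm_apply_le (s : ℝ) (v : L2R) (i : Fin 3) :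
    homSobolevNorm s (fun x => v x i) ≤ eLpNorm (symbolMul s (toComplex v)) 2 volume := by
  refine (iInf₂_le _ (isFourierPair_apply v i)).trans (eLpNorm_mono fun ξ => ?_)
  rw [symbolMul, norm_mul, norm_smul]
  gcongr
  exact PiLp.norm_apply_le _ i

/-- Functions vanishing a.e. are outside the supremum and are treated apart; finiteness of both
norms excludes the ambiguous products $0\cdot\infty$. -/
theorem eLpNorm_mul_le_multiplierNorm {s : ℝ} {p : ℝ≥0∞} {φ f : E3 → ℝ}
    (hφ : multiplierNorm s p φ ≠ ⊤) (hf : homSobolevNorm s f ≠ ⊤) :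
    eLpNorm (fun x => φ x * f x) p volume ≤ multiplierNorm s p φ * homSobolevNorm s f := by
  by_cases h0 : f =ᵐ[volume] 0
  · rw [eLpNorm_congr_ae (g := 0)]
    · simp
    · filter_upwards [h0] with x hx
      simp [hx]
  · rw [← ENNReal.div_le_iff_le_mul (Or.inr hφ) (Or.inl hf)]
    exact le_iSup₂ (f := fun (f : E3 → ℝ) (_ : MemHomSobolev s f ∧ ¬ f =ᵐ[volume] 0) =>
      eLpNorm (fun x => φ x * f x) p volume / homSobolevNorm s f) f ⟨hf.lt_top, h0⟩

theorem multiplierNorm_apply_le (s : ℝ) (p : ℝ≥0∞) (φ : E3 → E3) (i : Fin 3) :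
    multiplierNorm s p (fun x => φ x i) ≤ multiplierNorm3 s p φ := by
  have h : multiplierNorm s p (fun x => φ x i) ^ 2 ≤
      ∑ i : Fin 3, multiplierNorm s p (fun x => φ x i) ^ 2 :=
    Finset.single_le_sum (f := fun i => multiplierNorm s p (fun x => φ x i) ^ 2)
      (fun _ _ => zero_le) (Finset.mem_univ i)
  calc _ = (multiplierNorm s p (fun x => φ x i) ^ 2) ^ (1 / 2 : ℝ) := by
        rw [← ENNReal.rpow_natCast, ← ENNReal.rpow_mul]
        norm_num
    _ ≤ _ := by
        unfold multiplierNorm3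
        gcongr

/-- The identity $|v|^{2/\gamma}=\varphi\cdot v$ puts one factor into the multiplier space and the
other into $\dot H^s$. The 3 counts components, and the outer power $2\gamma$ is the one with
$(2/\gamma)\cdot2\gamma=4$. -/
theorem eLpNorm_four_rpow_le {γ s : ℝ} (hγ : 1 / 2 ≤ γ) {v : L2R}
    (hM : multiplierNorm3 s (ENNReal.ofReal (2 * γ)) (powerField (2 / γ - 2) v) ≠ ⊤)
    (hH : eLpNorm (symbolMul s (toComplex v)) 2 volume ≠ ⊤) :
    eLpNorm v 4 volume ^ (4 : ℝ) ≤
      (3 * (multiplierNorm3 s (ENNReal.ofReal (2 * γ)) (powerField (2 / γ - 2) v) *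
        eLpNorm (symbolMul s (toComplex v)) 2 volume)) ^ (2 * γ) := by
  have hγ0 : 0 < γ := by linarith
  set p := ENNReal.ofReal (2 * γ) with hp
  set φ := powerField (2 / γ - 2) v with hφ
  have hp1 : 1 ≤ p := by
    rw [hp, ← ENNReal.ofReal_one]
    exact ENNReal.ofReal_le_ofReal (by linarith)
  have hvm : ∀ i, AEStronglyMeasurable (fun x => v x i) volume := fun i =>
    (memLp_apply (Lp.memLp v) i).1
  have hφm : ∀ i, AEStronglyMeasurable (fun x => φ x i) volume := fun i => by
    have h1 : AEMeasurable (fun x => ‖v x‖ ^ (2 / γ - 2)) volume :=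
      (Lp.aestronglyMeasurable v).norm.aemeasurable.pow_const _
    exact (h1.mul (hvm i).aemeasurable).aestronglyMeasurable
  have hpt : ∀ x, ‖v x‖ ^ (2 / γ) = ∑ i : Fin 3, φ x i * v x i := by
    intro x
    have h1 : ∑ i : Fin 3, φ x i * v x i = ‖v x‖ ^ (2 / γ - 2) * ‖v x‖ ^ 2 := by
      rw [EuclideanSpace.real_norm_sq_eq, Finset.mul_sum]
      refine Finset.sum_congr rfl fun i _ => ?_
      simp only [hφ, powerField, PiLp.smul_apply, smul_eq_mul]
      ring
    rw [h1]
    rcases eq_or_ne (‖v x‖) 0 with h0 | h0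
    · rw [h0, Real.zero_rpow (by positivity)]
      simp
    · rw [← Real.rpow_natCast, ← Real.rpow_add (by positivity)]
      norm_num
  have h1 : eLpNorm v 4 volume ^ (2 / γ) = eLpNorm (fun x => ‖v x‖ ^ (2 / γ)) p volume := by
    rw [eLpNorm_norm_rpow _ (by positivity), hp, ← ENNReal.ofReal_mul (by positivity)]
    congr 2
    rw [show 2 * γ * (2 / γ) = 4 by field_simp; norm_num]
    norm_num
  have h2 : eLpNorm v 4 volume ^ (2 / γ) ≤ 3 * (multiplierNorm3 s p φ *
      eLpNorm (symbolMul s (toComplex v)) 2 volume) := by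
    rw [h1]
    simp only [hpt]
    have h3 : (fun x => ∑ i : Fin 3, φ x i * v x i) = ∑ i : Fin 3, fun x => φ x i * v x i := by
      ext x
      simp
    rw [h3]
    refine (eLpNorm_sum_le (fun i _ => (hφm i).mul (hvm i)) hp1).trans ?_
    calc _ ≤ ∑ i : Fin 3, multiplierNorm3 s p φ *
          eLpNorm (symbolMul s (toComplex v)) 2 volume := by
          refine Finset.sum_le_sum fun i _ => ?_
          have hi := multiplierNorm_apply_le s p φ i
          have hs := homSobolevNorm_apply_le s v i
          refine (eLpNorm_mul_le_multiplierNorm (ne_top_of_le_ne_top hM hi)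
            (ne_top_of_le_ne_top hH hs)).trans ?_
          gcongr
      _ = _ := by simp
  calc _ = (eLpNorm v 4 volume ^ (2 / γ)) ^ (2 * γ) := by
        rw [← ENNReal.rpow_mul]
        congr 1
        field_simp
        norm_num
    _ ≤ _ := by gcongr

/-- Hölder's inequality applied to $|\xi|^{2s}|\hat f|^2=(|\hat
f|^2)^{1-s/\alpha}(|\xi|^{2\alpha}|\hat f|^2)^{s/\alpha}$. -/
theorem eLpNorm_symbolMul_le {s α : ℝ} (hs : 0 ≤ s) (hsα : s ≤ α) (hα : 0 < α) (f : L2C) :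
    eLpNorm (symbolMul s f) 2 volume ≤ eLpNorm (𝓕 f : L2C) 2 volume ^ (1 - s / α) *
      eLpNorm (symbolMul α f) 2 volume ^ (s / α) := by
  have e : ∀ g : E3 → C3, eLpNorm g 2 volume = (∫⁻ x, ‖g x‖ₑ ^ (2 : ℝ)) ^ (1 / 2 : ℝ) := fun g => by
    simpa using eLpNorm_eq_lintegral_rpow_enorm_toReal (p := 2) (f := g)
      (μ := (volume : Measure E3)) (by norm_num) (by norm_num)
  have hm : ∀ r : ℝ, AEMeasurable (fun ξ => ‖symbolMul r f ξ‖ₑ ^ (2 : ℝ)) volume := fun r => by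
    have h1 : AEStronglyMeasurable (symbolMul r f) volume := by
      have h2 : Measurable fun ξ : E3 => (((2 * Real.pi * ‖ξ‖) ^ r : ℝ) : ℂ) := by fun_prop
      exact h2.aestronglyMeasurable.smul (Lp.aestronglyMeasurable (𝓕 f : L2C))
    exact h1.enorm.pow_const _
  have hsa0 : 0 ≤ s / α := by positivity
  have hsa1 : 0 ≤ 1 - s / α := by
    rw [sub_nonneg, div_le_one hα]
    exact hsα
  have h := ENNReal.lintegral_mul_norm_pow_le (μ := volume)
    ((Lp.aestronglyMeasurable (𝓕 f : L2C)).enorm.pow_const (2 : ℝ)) (hm α) hsa1 hsa0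
    (by ring)
  have hpt : ∀ ξ, (‖(𝓕 f : L2C) ξ‖ₑ ^ (2 : ℝ)) ^ (1 - s / α) *
      (‖symbolMul α f ξ‖ₑ ^ (2 : ℝ)) ^ (s / α) = ‖symbolMul s f ξ‖ₑ ^ (2 : ℝ) := by
    intro ξ
    rw [← ENNReal.rpow_mul, ← ENNReal.rpow_mul, mul_comm 2 (1 - s / α), mul_comm 2 (s / α),
      ENNReal.rpow_mul, ENNReal.rpow_mul, ← ENNReal.mul_rpow_of_nonneg _ _ (by norm_num)]
    congr 1
    have hn : ∀ r : ℝ, ‖symbolMul r f ξ‖ₑ =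
        ENNReal.ofReal ((2 * Real.pi * ‖ξ‖) ^ r) * ‖(𝓕 f : L2C) ξ‖ₑ := by
      intro r
      rw [symbolMul, enorm_smul, ← ofReal_norm, Complex.norm_real,
        Real.norm_of_nonneg (by positivity)]
    rw [hn, hn, ENNReal.mul_rpow_of_nonneg _ _ hsa0, ENNReal.ofReal_rpow_of_nonneg (by positivity)
      hsa0, ← Real.rpow_mul (by positivity), mul_div_cancel₀ _ hα.ne']
    rw [mul_left_comm, ← ENNReal.rpow_add_of_nonneg _ _ hsa1 hsa0]
    simp
  simp only [hpt] at h
  rw [e, e, e, ← ENNReal.rpow_mul, ← ENNReal.rpow_mul, mul_comm (1 / 2), mul_comm (1 / 2),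
    ENNReal.rpow_mul, ENNReal.rpow_mul, ← ENNReal.mul_rpow_of_nonneg _ _ (by norm_num)]
  gcongr

theorem fourier_Lam {α : ℝ} {f : L2R} (hf : MemLp (symbolMul α (toComplex f)) 2 volume) :
    𝓕 (Lam α f) = hf.toLp _ := by
  rw [Lam, dif_pos hf, FourierTransform.fourier_fourierInv_eq]

theorem enorm_Lam {α : ℝ} {f : L2R} (hf : MemH α f) :
    ‖Lam α f‖ₑ = eLpNorm (symbolMul α (toComplex f)) 2 volume := by
  rw [← ofReal_norm, ← Lp.norm_fourier_eq, fourier_Lam hf, ofReal_norm]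
  exact Lp.enorm_toLp (hf := hf)

theorem eLpNorm_fourier_toComplex (f : L2R) :
    eLpNorm (𝓕 (toComplex f) : L2C) 2 volume = ‖f‖ₑ := by
  rw [← Lp.enorm_def, ← ofReal_norm, Lp.norm_fourier_eq, norm_toComplex, ofReal_norm]

theorem lintegral_enorm_sq_ne_top {X F : Type*} [MeasurableSpace X] {μ : Measure X}
    [NormedAddCommGroup F] {f : X → F} (hf : MemLp f 2 μ) :
    ∫⁻ x, ‖f x‖ₑ ^ (2 : ℝ) ∂μ ≠ ⊤ := by
  have := lintegral_rpow_enorm_lt_top_of_eLpNorm_lt_top (p := 2) (by norm_num) (by norm_num) hf.2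
  simpa using this.ne

/-- Young's inequality in time; the exponent in the hypothesis on `M` is dictated by the weights
$(\alpha-\theta)/\alpha$ and $\theta/\alpha$. -/
theorem exists_bound_multiplier {α γ θ : ℝ} (hα : 1 ≤ α) (hθ : 0 ≤ θ) (hlow : 1 / 2 ≤ γ)
    (hθγ : θ ≤ γ) (hhigh : γ ≤ 1) {X : Type*} [MeasurableSpace X] {μ : Measure X}
    {M L : X → ℝ≥0∞}
    (hM : MemLp M (ENNReal.ofReal (2 * α * γ) / ENNReal.ofReal (α - θ)) μ)
    (hL : AEMeasurable L μ) (hL2 : ∫⁻ t, L t ^ (2 : ℝ) ∂μ ≠ ⊤) :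
    ∃ N : X → ℝ≥0∞, AEMeasurable N μ ∧ ∫⁻ t, N t ∂μ ≠ ⊤ ∧
      ∀ᵐ t ∂μ, M t < ⊤ ∧ M t ^ (2 * γ) * L t ^ (2 * θ / α) ≤ N t := by
  -- Because $\theta\le\gamma\le1\le\alpha$, equality $\theta=\alpha$ forces both to be 1. The
  -- exponent is then a positive number divided by 0, that is $\infty$, and `M` is essentially
  -- bounded.
  rcases (hθγ.trans hhigh |>.trans hα).eq_or_lt with h | h
  · obtain rfl : θ = 1 := by linarith
    obtain rfl : α = 1 := h.symm
    rw [sub_self, ENNReal.ofReal_zero, ENNReal.div_zero (by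
      rw [ENNReal.ofReal_ne_zero_iff]; linarith)] at hM
    set K := eLpNormEssSup M μ with hK
    have hKt : K ≠ ⊤ := by
      rw [hK, ← eLpNorm_exponent_top]
      exact hM.2.ne
    refine ⟨fun t => K ^ (2 * γ) * L t ^ (2 : ℝ), (hL.pow_const _).const_mul _, ?_, ?_⟩
    · rw [lintegral_const_mul'' _ (hL.pow_const _)]
      exact ENNReal.mul_ne_top (ENNReal.rpow_ne_top_of_nonneg (by linarith) hKt) hL2
    · filter_upwards [ae_le_eLpNormEssSup (f := M) (μ := μ)] with t ht
      rw [enorm_eq_self] at ht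
      refine ⟨ht.trans_lt hKt.lt_top, ?_⟩
      norm_num
      gcongr
  · have hd : 0 < α - θ := sub_pos.2 h
    rw [← ENNReal.ofReal_div_of_pos hd] at hM
    have hq : 0 < 2 * α * γ / (α - θ) := by positivity
    set q := 2 * α * γ / (α - θ)
    have hMq : ∫⁻ t, M t ^ q ∂μ ≠ ⊤ := by
      have := lintegral_rpow_enorm_lt_top_of_eLpNorm_lt_top (ENNReal.ofReal_pos.2 hq).ne'
        ENNReal.ofReal_ne_top hM.2
      rw [ENNReal.toReal_ofReal hq.le] at this
      simpa using this.ne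
    have hMm : AEMeasurable M μ := hM.1.aemeasurable
    refine ⟨fun t => M t ^ q + L t ^ (2 : ℝ), (hMm.pow_const _).add (hL.pow_const _), ?_, ?_⟩
    · rw [lintegral_add_left' (hMm.pow_const _)]
      exact ENNReal.add_ne_top.2 ⟨hMq, hL2⟩
    · filter_upwards [ae_lt_top' (hMm.pow_const _) hMq] with t ht
      refine ⟨(ENNReal.rpow_lt_top_iff_of_pos hq).1 ht, ?_⟩
      have ha : 0 ≤ (α - θ) / α := by positivity
      have hb : 0 ≤ θ / α := by positivity
      -- Since the two weights add up to 1, the bound $X^aY^b\le(X+Y)^{a+b}$ replaces the sharp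
      -- Young inequality.
      calc M t ^ (2 * γ) * L t ^ (2 * θ / α) =
            (M t ^ q) ^ ((α - θ) / α) * (L t ^ (2 : ℝ)) ^ (θ / α) := by
            rw [← ENNReal.rpow_mul, ← ENNReal.rpow_mul]
            congr 2
            · simp only [q]
              field_simp
            · ring
        _ ≤ (M t ^ q + L t ^ (2 : ℝ)) ^ ((α - θ) / α) *
            (M t ^ q + L t ^ (2 : ℝ)) ^ (θ / α) := by
            gcongr
            · exact le_self_add
            · exact le_add_self
        _ = M t ^ q + L t ^ (2 : ℝ) := by
            rw [← ENNReal.rpow_add_of_nonneg _ _ ha hb, ← add_div, sub_add_cancel,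
              div_self (by positivity), ENNReal.rpow_one]

theorem exists_integrable_eLpNorm_four_le {α β θ : ℝ} (hα : 1 ≤ α) (hβ : 0 ≤ β) (hθ : 0 ≤ θ)
    (hlow : 1 / 2 ≤ β + θ) (hhigh : β + θ ≤ 1) {T : EReal} {u : ℝ → L2R}
    (hu : InEnergyClass T α u)
    (hM : PowerInMultiplierClass T (ENNReal.ofReal (2 * α * (β + θ)) / ENNReal.ofReal (α - θ))
      (θ / (β + θ)) (ENNReal.ofReal (2 * (β + θ))) (2 / (β + θ) - 2) u) :
    ∃ κ : ℝ → ℝ, Integrable κ (timeMeasure T) ∧ ∀ᵐ t ∂(timeMeasure T),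
      0 ≤ κ t ∧ eLpNorm (u t) 4 volume ^ (4 : ℝ) ≤ ENNReal.ofReal (κ t) := by
  set γ := β + θ with hγ
  have hγ0 : 0 < γ := by linarith
  have hθγ : θ ≤ γ := by linarith
  have hs0 : 0 ≤ θ / γ := by positivity
  have hs1 : θ / γ ≤ 1 := (div_le_one hγ0).2 hθγ
  obtain ⟨N, hNm, hNi, hN⟩ := exists_bound_multiplier hα hθ hlow hθγ hhigh hM
    hu.lam_memLp_two.1.enorm (lintegral_enorm_sq_ne_top hu.lam_memLp_two)
  set K := eLpNormEssSup u (timeMeasure T) with hK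
  have hKt : K ≠ ⊤ := by
    rw [hK, ← eLpNorm_exponent_top]
    exact hu.memLp_top.2.ne
  have he : 0 ≤ 1 - θ / γ / α := by
    rw [sub_nonneg, div_le_one (by linarith)]
    linarith
  -- Collects the three components and the uniform $L^2$ bound `K`. The remaining power of
  -- $\|\Lambda^\alpha u\|$ is $(\theta/\gamma/\alpha)\cdot2\gamma=2\theta/\alpha$.
  set C : ℝ≥0∞ := (3 * K ^ (1 - θ / γ / α)) ^ (2 * γ) with hC
  have hCt : C ≠ ⊤ := ENNReal.rpow_ne_top_of_nonneg (by positivity)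
    (ENNReal.mul_ne_top (by norm_num) (ENNReal.rpow_ne_top_of_nonneg he hKt))
  have hCN : ∫⁻ t, C * N t ∂(timeMeasure T) ≠ ⊤ := by
    rw [lintegral_const_mul'' _ hNm]
    exact ENNReal.mul_ne_top hCt hNi
  refine ⟨fun t => (C * N t).toReal, integrable_toReal_of_lintegral_ne_top (hNm.const_mul C) hCN, ?_⟩
  filter_upwards [hN, hu.memH, ae_le_eLpNormEssSup (f := u) (μ := timeMeasure T),
    ae_lt_top' (hNm.const_mul C) hCN] with t h1 h2 h3 h4
  refine ⟨ENNReal.toReal_nonneg, ?_⟩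
  rw [ENNReal.ofReal_toReal h4.ne]
  have hint := eLpNorm_symbolMul_le hs0 (hs1.trans hα) (by linarith) (toComplex (u t))
  rw [eLpNorm_fourier_toComplex, ← enorm_Lam h2] at hint
  have hint' : eLpNorm (symbolMul (θ / γ) (toComplex (u t))) 2 volume ≤
      K ^ (1 - θ / γ / α) * ‖Lam α (u t)‖ₑ ^ (θ / γ / α) := hint.trans (by gcongr)
  have hfin : K ^ (1 - θ / γ / α) * ‖Lam α (u t)‖ₑ ^ (θ / γ / α) ≠ ⊤ :=
    ENNReal.mul_ne_top (ENNReal.rpow_ne_top_of_nonneg he hKt)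
      (ENNReal.rpow_ne_top_of_nonneg (by positivity) enorm_ne_top)
  refine (eLpNorm_four_rpow_le hlow h1.1.ne (ne_top_of_le_ne_top hfin hint')).trans ?_
  calc _ ≤ (3 * (multiplierNorm3 (θ / γ) (ENNReal.ofReal (2 * γ)) (powerField (2 / γ - 2) (u t)) *
        (K ^ (1 - θ / γ / α) * ‖Lam α (u t)‖ₑ ^ (θ / γ / α)))) ^ (2 * γ) := by gcongr
    _ = C * (multiplierNorm3 (θ / γ) (ENNReal.ofReal (2 * γ)) (powerField (2 / γ - 2) (u t)) ^
        (2 * γ) * ‖Lam α (u t)‖ₑ ^ (2 * θ / α)) := by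
        rw [mul_left_comm _ (K ^ _), ← mul_assoc, ENNReal.mul_rpow_of_nonneg _ _ (by positivity),
          ENNReal.mul_rpow_of_nonneg _ (_ ^ (θ / γ / α)) (by positivity),
          ← ENNReal.rpow_mul _ (θ / γ / α), show 2 * θ / α = θ / γ / α * (2 * γ) by field_simp]
    _ ≤ _ := by
        gcongr
        exact h1.2

/-! ### Products of fields depending on time -/

/-- Weak measurability suffices. Against a Schwartz field, $\langle\psi,a_jb\rangle=\langle
a_j\psi,b\rangle$, and $a_j\psi$ depends continuously on $a$ in $L^2$ because $\psi$ is bounded. -/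
theorem aestronglyMeasurable_prodField {X : Type*} [MeasurableSpace X] {μ : Measure X}
    {a b : X → L2R} (ha : AEStronglyMeasurable a μ) (hb : AEStronglyMeasurable b μ) (j : Fin 3)
    (ha4 : ∀ᵐ t ∂μ, MemLp (a t) 4 volume) (hb4 : ∀ᵐ t ∂μ, MemLp (b t) 4 volume) :
    AEStronglyMeasurable (fun t => prodField (a t) (b t) j) μ := by
  have : Fact ((2 : ℝ≥0∞) ≠ ⊤) := ⟨by simp⟩
  refine aestronglyMeasurable_of_inner (S := Set.range (SchwartzMap.toLpCLM ℂ C3 2 volume))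
    (SchwartzMap.denseRange_toLpCLM (E := E3) (F := C3) (p := 2) ENNReal.ofNat_ne_top) ?_
  rintro _ ⟨ψ, rfl⟩
  set B : L2R →L[ℝ] Lp C3 ⊤ (volume : Measure E3) →L[ℝ] L2C :=
    ((ContinuousLinearMap.lsmul ℝ ℝ (E := C3)).comp
      (EuclideanSpace.proj (𝕜 := ℝ) j : E3 →L[ℝ] ℝ)).holderL volume 2 ⊤ 2 with hB
  have hBc : ∀ a : L2R, B a (ψ.toLp ⊤ volume) =ᵐ[volume] fun x => a x j • ψ x := by
    intro a
    have h := ((ContinuousLinearMap.lsmul ℝ ℝ (E := C3)).comp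
      (EuclideanSpace.proj (𝕜 := ℝ) j : E3 →L[ℝ] ℝ)).coeFn_holder (r := 2) a
        (ψ.toLp ⊤ (volume : Measure E3))
    filter_upwards [h, ψ.coeFn_toLp ⊤ volume] with x h1 h2
    refine Eq.trans h1 ?_
    rw [h2]
    rfl
  have hcont : Continuous fun a : L2R => B a (ψ.toLp ⊤ volume) :=
    B.continuous.clm_apply continuous_const
  refine ((hcont.comp_aestronglyMeasurable ha).inner (𝕜 := ℂ)
    (continuous_toComplex.comp_aestronglyMeasurable hb)).congr ?_
  filter_upwards [ha4, hb4] with t h1 h2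
  rw [L2.inner_def, L2.inner_def]
  apply integral_congr_ae
  filter_upwards [hBc (a t), coeFn_prodField (memLp_prod h1 h2 j), coeFn_toComplex (b t),
    ψ.coeFn_toLp 2 volume] with x h3 h4 h5 h6
  rw [h4, SchwartzMap.toLpCLM_apply, h6]
  rw [h3, h5, ← Complex.coe_smul, ← Complex.coe_smul, inner_smul_left, inner_smul_right,
    Complex.conj_ofReal]

theorem enorm_prodField_sq_le {a b : L2R} (ha : MemLp a 4 volume) (hb : MemLp b 4 volume)
    (j : Fin 3) : ‖prodField a b j‖ₑ ^ (2 : ℝ) ≤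
      eLpNorm a 4 volume ^ (4 : ℝ) + eLpNorm b 4 volume ^ (4 : ℝ) := by
  have h1 : ‖prodField a b j‖ₑ ≤ eLpNorm a 4 volume * eLpNorm b 4 volume := by
    rw [Lp.enorm_def, eLpNorm_congr_ae (coeFn_prodField (memLp_prod ha hb j))]
    refine (eLpNorm_smul_le_mul_eLpNorm (p := 4) (q := 4) (r := 2)
      (complexify.comp_memLp' hb).1 (memLp_apply ha j).1).trans ?_
    gcongr
    · exact eLpNorm_mono fun x => PiLp.norm_apply_le _ j
    · exact eLpNorm_mono fun x => (norm_complexify _).le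
  set A := eLpNorm a 4 volume
  set B := eLpNorm b 4 volume
  have h2 : ∀ x : ℝ≥0∞, x ^ (4 : ℝ) = (x * x) ^ (2 : ℝ) := fun x => by
    rw [ENNReal.mul_rpow_of_nonneg _ _ (by norm_num), ← ENNReal.rpow_add_of_nonneg _ _ (by norm_num)
      (by norm_num)]
    norm_num
  rw [h2, h2]
  rcases le_total A B with h | h
  · exact le_trans (by gcongr; exact h1.trans (by gcongr)) le_add_self
  · exact le_trans (by gcongr; exact h1.trans (by gcongr)) le_self_add

/-- `u ∈ L⁴(0,T; L⁴)`. -/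
def InL4 (T : EReal) (u : ℝ → L2R) : Prop :=
  ∃ κ : ℝ → ℝ, Integrable κ (timeMeasure T) ∧ ∀ᵐ t ∂(timeMeasure T),
      0 ≤ κ t ∧ eLpNorm (u t) 4 volume ^ (4 : ℝ) ≤ ENNReal.ofReal (κ t)

theorem InL4.ae_memLp {T : EReal} {u : ℝ → L2R} (hu : InL4 T u) :
    ∀ᵐ t ∂(timeMeasure T), MemLp (u t) 4 volume := by
  obtain ⟨κ, -, h⟩ := hu
  filter_upwards [h] with t ht
  refine ⟨Lp.aestronglyMeasurable _, ?_⟩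
  rw [← ENNReal.rpow_lt_top_iff_of_pos (by norm_num : (0 : ℝ) < 4)]
  exact ht.2.trans_lt ENNReal.ofReal_lt_top

theorem InL4.memLp_prodField {T : EReal} {a b : ℝ → L2R} (ha : InL4 T a) (hb : InL4 T b)
    (ham : AEStronglyMeasurable a (timeMeasure T)) (hbm : AEStronglyMeasurable b (timeMeasure T))
    (j : Fin 3) : MemLp (fun t => prodField (a t) (b t) j) 2 (timeMeasure T) := by
  have ha4 := ha.ae_memLp
  have hb4 := hb.ae_memLp
  obtain ⟨κ, hκ, h1⟩ := ha
  obtain ⟨κ', hκ', h2⟩ := hb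
  have hm := aestronglyMeasurable_prodField ham hbm j ha4 hb4
  refine (memLp_two_iff_integrable_sq_norm hm).2 ?_
  refine (hκ.add hκ').mono' (hm.norm.pow 2) ?_
  filter_upwards [h1, h2, ha4, hb4] with t h3 h4 h5 h6
  have h7 := enorm_prodField_sq_le h5 h6 j
  have h8 := h7.trans (add_le_add h3.2 h4.2)
  rw [← ENNReal.ofReal_add h3.1 h4.1, ← ofReal_norm, ENNReal.ofReal_rpow_of_nonneg (norm_nonneg _)
    (by norm_num), ENNReal.ofReal_le_ofReal_iff (add_nonneg h3.1 h4.1), Real.rpow_two] at h8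
  simpa using h8

/-! ### Gradient fields and solenoidal fields on the frequency side -/

/-- Fields on frequency space that are parallel to `ξ` at almost every `ξ`. -/
def gradientFields : Submodule ℂ L2C where
  carrier := {g | ∀ i j : Fin 3, ∀ᵐ ξ : E3 ∂volume, derivSymbol j ξ * g ξ i = derivSymbol i ξ * g ξ j}
  add_mem' {f g} hf hg i j := by
    filter_upwards [hf i j, hg i j, Lp.coeFn_add f g] with ξ h1 h2 h3
    rw [h3]
    simp only [Pi.add_apply, PiLp.add_apply, mul_add, h1, h2]
  zero_mem' i j := by
    filter_upwards [Lp.coeFn_zero C3 2 (volume : Measure E3)] with ξ h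
    rw [h]
    simp
  smul_mem' c f hf i j := by
    filter_upwards [hf i j, Lp.coeFn_smul c f] with ξ h1 h2
    rw [h2]
    simp only [Pi.smul_apply, PiLp.smul_apply, smul_eq_mul, mul_left_comm _ c, h1]

theorem conj_derivSymbol (j : Fin 3) (ξ : E3) :
    (starRingEnd ℂ) (derivSymbol j ξ) = - derivSymbol j ξ := by
  simp only [derivSymbol, map_mul, Complex.conj_I, Complex.conj_ofReal, Complex.conj_ofNat]
  ring

/-- At almost every $\xi$ a gradient field is parallel to $\xi$, and the hypothesis says that
$s(\xi)$ is perpendicular to $\xi$. -/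
theorem mem_orthogonal_gradientFields {s : L2C}
    (hs : ∀ᵐ ξ : E3 ∂volume, ∑ i : Fin 3, derivSymbol i ξ * s ξ i = 0) : s ∈ gradientFieldsᗮ := by
  rw [Submodule.mem_orthogonal]
  intro g hg
  rw [L2.inner_def]
  refine integral_eq_zero_of_ae ?_
  have hg' := ae_all_iff.2 fun i => ae_all_iff.2 fun j => hg i j
  have h0 : ∀ᵐ ξ : E3 ∂volume, ξ ≠ 0 := by
    simp [ae_iff]
  filter_upwards [hs, hg', h0] with ξ h1 h2 h3
  obtain ⟨j, hj⟩ : ∃ j, ξ j ≠ 0 := by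
    by_contra! h
    exact h3 (by ext i; simpa using h i)
  have hj' : derivSymbol j ξ ≠ 0 := by
    simp [derivSymbol, hj, Real.pi_ne_zero]
  -- Multiplying by a nonvanishing component of the symbol allows every $g_i$ to be exchanged for
  -- $g_j$, which then factors out of the sum.
  have h4 : (starRingEnd ℂ) (derivSymbol j ξ) * inner ℂ (g ξ) (s ξ) = 0 := by
    rw [PiLp.inner_apply, Finset.mul_sum]
    calc _ = ∑ i : Fin 3, (starRingEnd ℂ) (g ξ j) * (- (derivSymbol i ξ * s ξ i)) := by
          refine Finset.sum_congr rfl fun i _ => ?_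
          have h5 := congrArg (starRingEnd ℂ) (h2 i j)
          rw [map_mul, map_mul, conj_derivSymbol i] at h5
          rw [RCLike.inner_apply, mul_comm (s ξ i), ← mul_assoc, h5]
          ring
      _ = 0 := by
          rw [← Finset.mul_sum, Finset.sum_neg_distrib, h1]
          simp
  exact (mul_eq_zero.1 h4).resolve_left (by simpa using hj')

/-- By Plancherel, $\int\nabla\rho\cdot f=0$ says that the conjugated divergence symbol annihilates
$\hat\rho$ for every real test function; uniqueness then applies even though that symbol is only of
polynomial growth times $L^2$. -/
theorem IsSolenoidal.sum_derivSymbol_eq_zero {f : L2R} (hf : IsSolenoidal f) :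
    ∀ᵐ ξ : E3 ∂volume, ∑ i : Fin 3, derivSymbol i ξ * (𝓕 (toComplex f) : L2C) ξ i = 0 := by
  set F : L2C := 𝓕 (toComplex f) with hF
  have hFi : ∀ i, MemLp (fun ξ => (starRingEnd ℂ) (F ξ i)) 2 (volume : Measure E3) := fun i =>
    ((EuclideanSpace.proj (𝕜 := ℂ) i : C3 →L[ℂ] ℂ).comp_memLp' (Lp.memLp F)).star
  have hint : ∀ (i : Fin 3) (ψ : 𝓢(E3, ℂ)),
      Integrable (fun ξ => derivSymbol i ξ * (starRingEnd ℂ) (F ξ i) * ψ ξ) volume := by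
    intro i ψ
    have hw : IsTemperateWeight (derivSymbol i) := by
      refine isTemperateWeight_of_le (measurable_derivSymbol i) (C := 2 * Real.pi) (s := 1)
        (fun ξ => (norm_derivSymbol_le i ξ).trans ?_) (by positivity) zero_le_one
      rw [Real.rpow_one]
      gcongr
      linarith
    refine ((hw.memLp_smul ψ).integrable_mul (hFi i)).congr (Eventually.of_forall fun ξ => ?_)
    simp only [smul_eq_mul, Pi.mul_apply]
    ring
  have key := ae_eq_zero_of_integral_mul_fourier
    (G := fun ξ => ∑ i : Fin 3, derivSymbol i ξ * (starRingEnd ℂ) (F ξ i)) ?_ ?_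
  · filter_upwards [key] with ξ hξ
    have h1 := congrArg (starRingEnd ℂ) hξ
    simp only [map_sum, map_mul, conj_derivSymbol, Complex.conj_conj, Pi.zero_apply, map_zero,
      neg_mul, Finset.sum_neg_distrib, neg_eq_zero] at h1
    exact h1
  · intro ψ
    simp only [Finset.sum_mul]
    exact integrable_finsetSum _ fun i _ => hint i ψ
  · intro ρ hρ hc
    have h1 : ∀ i : Fin 3, inner ℂ (toComplex f) ((∂_{EuclideanSpace.single i (1 : ℝ)}
        (testField ρ hρ hc (EuclideanSpace.single i 1))).toLp 2 volume) =
        ∫ ξ, derivSymbol i ξ * (starRingEnd ℂ) (F ξ i) * 𝓕 (fun x => (ρ x : ℂ)) ξ := by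
      intro i
      rw [← Lp.inner_fourier_eq, SchwartzMap.toLp_fourier_eq, L2.inner_def]
      apply integral_congr_ae
      filter_upwards [(𝓕 (∂_{EuclideanSpace.single i (1 : ℝ)}
        (testField ρ hρ hc (EuclideanSpace.single i 1))) : 𝓢(E3, C3)).coeFn_toLp 2 volume] with ξ hξ
      rw [hξ, fourier_lineDerivOp, fourier_testField, inner_smul_right, inner_smul_right,
        EuclideanSpace.inner_single_right]
      ring
    have h2 : ∑ i : Fin 3, inner ℂ (toComplex f) ((∂_{EuclideanSpace.single i (1 : ℝ)}
        (testField ρ hρ hc (EuclideanSpace.single i 1))).toLp 2 volume) =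
        ((∫ x, fderiv ℝ ρ x (f x) : ℝ) : ℂ) := by
      simp only [L2.inner_def]
      rw [← integral_finsetSum _ fun i _ => L2.integrable_inner _ _, ← integral_complex_ofReal]
      apply integral_congr_ae
      have h3 := ae_all_iff.2 fun i : Fin 3 => (∂_{EuclideanSpace.single i (1 : ℝ)}
        (testField ρ hρ hc (EuclideanSpace.single i 1)) : 𝓢(E3, C3)).coeFn_toLp 2 volume
      filter_upwards [coeFn_toComplex f, h3] with x h4 h5
      conv_rhs => rw [eq_sum_single (f x), map_sum, Complex.ofReal_sum]
      refine Finset.sum_congr rfl fun i _ => ?_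
      rw [h4, h5, SchwartzMap.lineDerivOp_apply_eq_fderiv]
      have h6 : HasFDerivAt (testField ρ hρ hc (EuclideanSpace.single i 1))
          ((Complex.ofRealCLM.comp (fderiv ℝ ρ x)).smulRight
            (EuclideanSpace.single i (1 : ℂ))) x := by
        have h7 : HasFDerivAt ρ (fderiv ℝ ρ x) x :=
          (hρ.differentiable (by simp)).differentiableAt.hasFDerivAt
        exact (Complex.ofRealCLM.hasFDerivAt.comp x h7).smul_const _
      rw [h6.fderiv]
      rw [ContinuousLinearMap.smulRight_apply, inner_smul_right, EuclideanSpace.inner_single_right]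
      simp [mul_comm]
    rw [hf ρ hρ hc, Complex.ofReal_zero] at h2
    rw [← h2]
    simp only [h1, Finset.sum_mul]
    rw [integral_finsetSum]
    intro i _
    exact hint i (𝓕 (schwartzOfReal ρ hρ hc))

/-! ### Test fields that are products -/

/-- The test field `η(t) Φ(x)`. -/
noncomputable def tensorField {T : EReal} {η : ℝ → ℝ} (hη : ContDiff ℝ ∞ η)
    (hηc : HasCompactSupport η) (hηT : tsupport η ⊆ {t | (t : EReal) < T}) {Φ : E3 → E3}
    (hΦ : ContDiff ℝ ∞ Φ) (hΦc : HasCompactSupport Φ)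
    (hdiv : ∀ x, ∑ i : Fin 3, (fderiv ℝ Φ x (EuclideanSpace.single i 1)) i = 0) : TestField T where
  toFun t x := η t • Φ x
  smooth := (hη.comp contDiff_fst).smul (hΦ.comp contDiff_snd)
  compact := by
    refine HasCompactSupport.of_support_subset_isCompact (hηc.isCompact.prod hΦc.isCompact) ?_
    rintro ⟨t, x⟩ h
    rw [Function.mem_support] at h
    exact ⟨subset_tsupport _ fun h0 => h (by simp [h0]), subset_tsupport _ fun h0 => h (by simp [h0])⟩
  support := by
    have h1 : tsupport (fun p : ℝ × E3 => η p.1 • Φ p.2) ⊆ Prod.fst ⁻¹' tsupport η := by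
      refine closure_minimal ?_ ((isClosed_tsupport η).preimage continuous_fst)
      rintro ⟨t, x⟩ h
      rw [Function.mem_support] at h
      exact subset_tsupport _ fun h0 => h (by simp [h0])
    exact fun p hp => hηT (h1 hp)
  div_free t x := by
    have h : ∀ i : Fin 3, (fderiv ℝ (fun x => η t • Φ x) x (EuclideanSpace.single i 1)) i =
        η t * (fderiv ℝ Φ x (EuclideanSpace.single i 1)) i := by
      intro i
      rw [fderiv_fun_const_smul (hΦ.differentiable (by simp)).differentiableAt]
      simp
    simp only [h, ← Finset.mul_sum, hdiv, mul_zero]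

section Tensor

variable {T : EReal} {η : ℝ → ℝ} (hη : ContDiff ℝ ∞ η)
    (hηc : HasCompactSupport η) (hηT : tsupport η ⊆ {t | (t : EReal) < T}) {Φ : E3 → E3}
    (hΦ : ContDiff ℝ ∞ Φ) (hΦc : HasCompactSupport Φ)
    (hdiv : ∀ x, ∑ i : Fin 3, (fderiv ℝ Φ x (EuclideanSpace.single i 1)) i = 0)
    {ψ : 𝓢(E3, C3)}

theorem inner_toLp_toComplex (hψ : ∀ x, ψ x = complexify (Φ x)) (v : L2R) :
    inner ℂ (ψ.toLp 2 volume) (toComplex v) = ((∫ x, inner ℝ (Φ x) (v x) : ℝ) : ℂ) := by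
  rw [L2.inner_def, ← integral_complex_ofReal]
  apply integral_congr_ae
  filter_upwards [ψ.coeFn_toLp 2 volume, coeFn_toComplex v] with x h1 h2
  rw [h1, h2, hψ, inner_complexify]

theorem timeDerivPairing_tensorField (hψ : ∀ x, ψ x = complexify (Φ x)) (t : ℝ) (v : L2R) :
    (((tensorField hη hηc hηT hΦ hΦc hdiv).timeDerivPairing t v : ℝ) : ℂ) =
      deriv η t * inner ℂ (ψ.toLp 2 volume) (toComplex v) := by
  rw [inner_toLp_toComplex hψ, ← Complex.ofReal_mul, ← integral_const_mul,
    TestField.timeDerivPairing]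
  congr 2
  ext x
  have h : deriv (fun τ => η τ • Φ x) t = deriv η t • Φ x :=
    deriv_smul_const (hη.differentiable (by simp)).differentiableAt _
  rw [← real_inner_smul_left, ← h]
  rfl

theorem initialPairing_tensorField (hψ : ∀ x, ψ x = complexify (Φ x)) (v : L2R) :
    ((∫ x, inner ℝ (v x) ((tensorField hη hηc hηT hΦ hΦc hdiv).toFun 0 x) : ℝ) : ℂ) =
      η 0 * inner ℂ (ψ.toLp 2 volume) (toComplex v) := by
  rw [inner_toLp_toComplex hψ, ← Complex.ofReal_mul, ← integral_const_mul]
  congr 2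
  ext x
  rw [real_inner_comm, ← real_inner_smul_left]
  rfl

theorem transportPairing_tensorField (hψ : ∀ x, ψ x = complexify (Φ x)) (t : ℝ) {a b : L2R} (ha : MemLp a 4 volume)
    (hb : MemLp b 4 volume) :
    (((tensorField hη hηc hηT hΦ hΦc hdiv).transportPairing t a b : ℝ) : ℂ) =
      η t * ∑ j : Fin 3, inner ℂ ((∂_{EuclideanSpace.single j (1 : ℝ)} ψ).toLp 2 volume)
        (prodField a b j) := by
  simp only [L2.inner_def]
  rw [← integral_finsetSum _ fun j _ => L2.integrable_inner _ _, ← integral_const_mul,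
    TestField.transportPairing, ← integral_complex_ofReal]
  apply integral_congr_ae
  have h1 := ae_all_iff.2 fun j : Fin 3 =>
    (∂_{EuclideanSpace.single j (1 : ℝ)} ψ : 𝓢(E3, C3)).coeFn_toLp 2 volume
  have h2 := ae_all_iff.2 fun j => coeFn_prodField (memLp_prod ha hb j)
  filter_upwards [h1, h2] with x h3 h4
  have hd : DifferentiableAt ℝ Φ x := (hΦ.differentiable (by simp)).differentiableAt
  have h5 : fderiv ℝ ((tensorField hη hηc hηT hΦ hΦc hdiv).toFun t) x = η t • fderiv ℝ Φ x :=
    fderiv_fun_const_smul hd _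
  have h6 : fderiv ℝ ψ x = complexify.comp (fderiv ℝ Φ x) := by
    rw [show (ψ : E3 → C3) = complexify ∘ Φ from funext hψ]
    exact (complexify.hasFDerivAt.comp x hd.hasFDerivAt).fderiv
  rw [h5]
  conv_lhs => rw [eq_sum_single (a x), map_sum, sum_inner, Complex.ofReal_sum]
  rw [Finset.mul_sum]
  refine Finset.sum_congr rfl fun j _ => ?_
  rw [h3, h4, SchwartzMap.lineDerivOp_apply_eq_fderiv, h6, ContinuousLinearMap.comp_apply,
    ← Complex.coe_smul, inner_smul_right, inner_complexify, map_smul, smul_apply,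
    real_inner_smul_left, real_inner_smul_left]
  push_cast
  ring

theorem dissipationPairing_tensorField (hψ : ∀ x, ψ x = complexify (Φ x)) {α : ℝ} (hα : 0 ≤ α) (t : ℝ) (v : L2R) :
    (((tensorField hη hηc hηT hΦ hΦc hdiv).dissipationPairing α t v : ℝ) : ℂ) =
      η t * inner ℂ (((isTemperateWeight_rpow (s := 2 * α) (by positivity)).memLp_smul
        (𝓕 ψ : 𝓢(E3, C3))).toLp _ : L2C) (𝓕 (toComplex v)) := by
  set φ := tensorField hη hηc hηT hΦ hΦc hdiv with hφ
  set h := (isTemperateWeight_rpow (s := 2 * α) (by positivity)).memLp_smul (𝓕 ψ : 𝓢(E3, C3))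
  have e1 : toComplex (φ.slice t) = (η t : ℂ) • ψ.toLp 2 volume := by
    apply Lp.ext
    filter_upwards [coeFn_toComplex (φ.slice t), (φ.memLp t).coeFn_toLp, ψ.coeFn_toLp 2 volume,
      Lp.coeFn_smul (η t : ℂ) (ψ.toLp 2 (volume : Measure E3))] with x h1 h2 h3 h4
    rw [h1, TestField.slice, h2, h4, Pi.smul_apply, h3, hψ, Complex.coe_smul]
    exact map_smul complexify _ _
  have e2 : symbolMul (2 * α) (toComplex (φ.slice t)) =ᵐ[volume]
      ((η t : ℂ) • (h.toLp _ : L2C) : L2C) := by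
    have e3 : (𝓕 (toComplex (φ.slice t)) : L2C) = (η t : ℂ) • (𝓕 ψ : 𝓢(E3, C3)).toLp 2 volume := by
      rw [e1, FourierTransform.fourier_smul, SchwartzMap.toLp_fourier_eq]
    filter_upwards [Lp.coeFn_smul (η t : ℂ) (h.toLp _ : L2C), h.coeFn_toLp,
      Lp.coeFn_smul (η t : ℂ) ((𝓕 ψ : 𝓢(E3, C3)).toLp 2 (volume : Measure E3)),
      (𝓕 ψ : 𝓢(E3, C3)).coeFn_toLp 2 volume] with ξ h1 h2 h3 h4
    rw [h1, symbolMul, e3, h3, Pi.smul_apply, Pi.smul_apply, h2, h4, smul_comm]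
  have hmem : MemLp (symbolMul (2 * α) (toComplex (φ.slice t))) 2 volume :=
    (Lp.memLp _).ae_eq e2.symm
  have e4 : 𝓕 (Lam (2 * α) (φ.slice t)) = (η t : ℂ) • (h.toLp _ : L2C) := by
    rw [fourier_Lam hmem]
    exact Lp.ext (hmem.coeFn_toLp.trans e2)
  have e5 : inner ℂ (toComplex v) (Lam (2 * α) (φ.slice t)) =
      ∫ ξ, inner ℂ ((𝓕 (toComplex v) : L2C) ξ) (symbolMul (2 * α) (toComplex (φ.slice t)) ξ) := by
    rw [← Lp.inner_fourier_eq, fourier_Lam hmem, L2.inner_def]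
    apply integral_congr_ae
    filter_upwards [hmem.coeFn_toLp] with ξ h1
    rw [h1]
  -- The pairing is defined as a real part; reality of the inner product also permits exchanging its
  -- arguments.
  have him : (inner ℂ (toComplex v) (Lam (2 * α) (φ.slice t))).im = 0 := by
    rw [e5]
    exact im_integral_inner_even_symbol v _
  have e6 : inner ℂ (toComplex v) (Lam (2 * α) (φ.slice t)) =
      inner ℂ (Lam (2 * α) (φ.slice t)) (toComplex v) := by
    rw [← inner_conj_symm (Lam _ _)]
    exact (Complex.conj_eq_iff_im.2 him).symm
  have e7 : ((φ.dissipationPairing α t v : ℝ) : ℂ) =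
      inner ℂ (toComplex v) (Lam (2 * α) (φ.slice t)) :=
    Complex.conj_eq_iff_re.1 (Complex.conj_eq_iff_im.2 him)
  rw [e7, e6, ← Lp.inner_fourier_eq, e4, inner_smul_left, Complex.conj_ofReal]

end Tensor

/-- The solenoidal field `∂_jρ e_i - ∂_iρ e_j`. -/
noncomputable def curlField (ρ : E3 → ℝ) (i j : Fin 3) (x : E3) : E3 :=
  fderiv ℝ ρ x (EuclideanSpace.single j 1) • EuclideanSpace.single i (1 : ℝ) -
    fderiv ℝ ρ x (EuclideanSpace.single i 1) • EuclideanSpace.single j (1 : ℝ)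

section Curl

variable {ρ : E3 → ℝ}

theorem contDiff_fderiv_single (hρ : ContDiff ℝ ∞ ρ) (k : Fin 3) :
    ContDiff ℝ ∞ fun x => fderiv ℝ ρ x (EuclideanSpace.single k 1) :=
  (hρ.fderiv_right (m := ∞) (by simp)).clm_apply contDiff_const

theorem contDiff_curlField (hρ : ContDiff ℝ ∞ ρ) (i j : Fin 3) : ContDiff ℝ ∞ (curlField ρ i j) :=
  ((contDiff_fderiv_single hρ j).smul contDiff_const).sub
    ((contDiff_fderiv_single hρ i).smul contDiff_const)

theorem hasCompactSupport_curlField (hc : HasCompactSupport ρ) (i j : Fin 3) : HasCompactSupport (curlField ρ i j) := by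
  refine (hc.fderiv ℝ).mono fun x hx => ?_
  contrapose! hx
  simp only [Function.mem_support, not_not] at hx
  simp [curlField, hx]

/-- Symmetry of the second derivatives of `ρ`. -/
theorem div_curlField (hρ : ContDiff ℝ ∞ ρ) (i j : Fin 3) (x : E3) :
    ∑ k : Fin 3, (fderiv ℝ (curlField ρ i j) x (EuclideanSpace.single k 1)) k = 0 := by
  have hs : ∀ k l : Fin 3,
      fderiv ℝ (fun x => fderiv ℝ ρ x (EuclideanSpace.single k 1)) x (EuclideanSpace.single l 1) =
      fderiv ℝ (fun x => fderiv ℝ ρ x (EuclideanSpace.single l 1)) x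
        (EuclideanSpace.single k 1) := by
    have hd : DifferentiableAt ℝ (fderiv ℝ ρ) x :=
      ((hρ.fderiv_right (m := ∞) (by simp)).differentiable (by simp)).differentiableAt
    have hev : ∀ v w : E3, fderiv ℝ (fun x => fderiv ℝ ρ x v) x w = fderiv ℝ (fderiv ℝ ρ) x w v := by
      intro v w
      rw [fderiv_clm_apply hd (differentiableAt_const v)]
      simp
    intro k l
    rw [hev, hev]
    exact (hρ.contDiffAt.isSymmSndFDerivAt (by
      rw [minSmoothness_of_isRCLikeNormedField]
      exact WithTop.coe_le_coe.2 le_top)).eq _ _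
  have hd : ∀ k : Fin 3, DifferentiableAt ℝ (fun x => fderiv ℝ ρ x (EuclideanSpace.single k 1)) x :=
    fun k => ((contDiff_fderiv_single hρ k).differentiable (by simp)).differentiableAt
  have h : ∀ k : Fin 3, (fderiv ℝ (curlField ρ i j) x (EuclideanSpace.single k 1)) k =
      fderiv ℝ (fun x => fderiv ℝ ρ x (EuclideanSpace.single j 1)) x (EuclideanSpace.single k 1) *
        (EuclideanSpace.single i (1 : ℝ) : E3) k -
      fderiv ℝ (fun x => fderiv ℝ ρ x (EuclideanSpace.single i 1)) x (EuclideanSpace.single k 1) *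
        (EuclideanSpace.single j (1 : ℝ) : E3) k := by
    intro k
    have h1 := ((hd j).hasFDerivAt.smul_const (EuclideanSpace.single i (1 : ℝ))).sub
      ((hd i).hasFDerivAt.smul_const (EuclideanSpace.single j (1 : ℝ)))
    rw [show fderiv ℝ (curlField ρ i j) x = _ from h1.fderiv]
    simp
  simp only [h, Finset.sum_sub_distrib]
  simp [hs i j]

/-- The field `∂_jρ e_i - ∂_iρ e_j` as a complex Schwartz field. -/
noncomputable def curlSchwartz (hρ : ContDiff ℝ ∞ ρ) (hc : HasCompactSupport ρ) (i j : Fin 3) : 𝓢(E3, C3) :=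
  ∂_{EuclideanSpace.single j (1 : ℝ)} (testField ρ hρ hc (EuclideanSpace.single i 1)) -
    ∂_{EuclideanSpace.single i (1 : ℝ)} (testField ρ hρ hc (EuclideanSpace.single j 1))

theorem fderiv_testField (hρ : ContDiff ℝ ∞ ρ) (hc : HasCompactSupport ρ) (v : C3) (x w : E3) :
    fderiv ℝ (testField ρ hρ hc v) x w = (fderiv ℝ ρ x w : ℂ) • v := by
  have h6 : HasFDerivAt (testField ρ hρ hc v)
      ((Complex.ofRealCLM.comp (fderiv ℝ ρ x)).smulRight v) x := by
    have h7 : HasFDerivAt ρ (fderiv ℝ ρ x) x :=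
      (hρ.differentiable (by simp)).differentiableAt.hasFDerivAt
    exact (Complex.ofRealCLM.hasFDerivAt.comp x h7).smul_const _
  rw [h6.fderiv]
  rfl

theorem curlSchwartz_apply (hρ : ContDiff ℝ ∞ ρ) (hc : HasCompactSupport ρ)
    (i j : Fin 3) (x : E3) :
    curlSchwartz hρ hc i j x = complexify (curlField ρ i j x) := by
  have h : ∀ k : Fin 3, complexify (EuclideanSpace.single k (1 : ℝ)) =
      EuclideanSpace.single k (1 : ℂ) := by
    intro k
    ext l
    rw [complexify_apply]
    rcases eq_or_ne l k with rfl | hlk <;> simp [*]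
  rw [curlSchwartz, sub_apply, SchwartzMap.lineDerivOp_apply_eq_fderiv,
    SchwartzMap.lineDerivOp_apply_eq_fderiv, fderiv_testField, fderiv_testField, curlField,
    map_sub, map_smul, map_smul, h, h, Complex.coe_smul, Complex.coe_smul]

theorem fourier_curlSchwartz (hρ : ContDiff ℝ ∞ ρ) (hc : HasCompactSupport ρ)
    (i j : Fin 3) (ξ : E3) : (𝓕 (curlSchwartz hρ hc i j) : 𝓢(E3, C3)) ξ =
    𝓕 (fun x => (ρ x : ℂ)) ξ • (derivSymbol j ξ • EuclideanSpace.single i (1 : ℂ) -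
      derivSymbol i ξ • EuclideanSpace.single j (1 : ℂ)) := by
  rw [curlSchwartz, sub_eq_add_neg, FourierTransform.fourier_add, FourierTransform.fourier_neg,
    ← sub_eq_add_neg, sub_apply, fourier_lineDerivOp,
    fourier_lineDerivOp, fourier_testField, fourier_testField, smul_sub, smul_comm (derivSymbol j ξ),
    smul_comm (derivSymbol i ξ)]

end Curl

/-! ### The resolvent of `(-Δ)^α` -/

/-- The symbol `1 + |ξ|^{2α}`. -/
noncomputable def freqWeight (α : ℝ) (ξ : E3) : ℝ := 1 + (2 * Real.pi * ‖ξ‖) ^ (2 * α)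

theorem freqWeight_pos (α : ℝ) (ξ : E3) : 0 < freqWeight α ξ := by
  unfold freqWeight
  positivity

theorem freqWeight_ne_zero (α : ℝ) (ξ : E3) : (freqWeight α ξ : ℂ) ≠ 0 :=
  Complex.ofReal_ne_zero.2 (freqWeight_pos α ξ).ne'

theorem measurable_freqWeight (α : ℝ) : Measurable fun ξ => (freqWeight α ξ : ℂ) := by
  unfold freqWeight
  fun_prop

theorem memLp_top_div_freqWeight {α : ℝ} {c : E3 → ℂ} (hm : Measurable c)
    (h : ∀ ξ, ‖c ξ‖ ≤ freqWeight α ξ) :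
    MemLp (fun ξ => c ξ / freqWeight α ξ) ⊤ (volume : Measure E3) := by
  refine memLp_top_of_le (hm.div (measurable_freqWeight α)) 1 fun ξ => ?_
  rw [norm_div, Complex.norm_real, Real.norm_of_nonneg (freqWeight_pos α ξ).le]
  exact (div_le_one (freqWeight_pos α ξ)).2 (h ξ)

theorem le_one_add_rpow {x s : ℝ} (hx : 0 ≤ x) (hs : 1 ≤ s) : x ≤ 1 + x ^ s := by
  rcases le_total x 1 with h | h
  · linarith [Real.rpow_nonneg hx s]
  · linarith [Real.self_le_rpow_of_one_le h hs]

theorem memLp_top_resolvent (α : ℝ) :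
    MemLp (fun ξ => (1 : ℂ) / freqWeight α ξ) ⊤ (volume : Measure E3) :=
  memLp_top_div_freqWeight (c := fun _ => 1) measurable_const fun ξ => by
    rw [norm_one, freqWeight]
    linarith [(by positivity : 0 ≤ (2 * Real.pi * ‖ξ‖) ^ (2 * α))]

/-- Here $\alpha\ge1$ enters: one derivative is absorbed by $1+|\xi|^{2\alpha}$. -/
theorem memLp_top_resolvent_deriv {α : ℝ} (hα : 1 ≤ α) (j : Fin 3) :
    MemLp (fun ξ => - derivSymbol j ξ / freqWeight α ξ) ⊤ (volume : Measure E3) :=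
  memLp_top_div_freqWeight (measurable_derivSymbol j).neg fun ξ => by
    rw [norm_neg]
    exact (norm_derivSymbol_le j ξ).trans (le_one_add_rpow (by positivity) (by linarith))

theorem memLp_top_resolvent_diss (α : ℝ) :
    MemLp (fun ξ => (((2 * Real.pi * ‖ξ‖) ^ (2 * α) : ℝ) : ℂ) / freqWeight α ξ) ⊤
      (volume : Measure E3) :=
  memLp_top_div_freqWeight (by fun_prop) fun ξ => by
    rw [Complex.norm_real, Real.norm_of_nonneg (by positivity), freqWeight]
    linarith

/-- The right-hand side `(1 + Λ^{2α})⁻¹ (- ∑ⱼ ∂ⱼ Fⱼ - Λ^{2α} f)` of the evolution equation, on the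
frequency side. -/
noncomputable def drift {α : ℝ} (hα : 1 ≤ α) (F : Fin 3 → L2C) (f : L2C) : L2C :=
  ∑ j : Fin 3, mulOp (memLp_top_resolvent_deriv hα j) (F j) - mulOp (memLp_top_resolvent_diss α) f

/-- `(1 + |ξ|^{2α}) ψ̂`. -/
noncomputable def resolventTest {α : ℝ} (hα : 1 ≤ α) (ψ : 𝓢(E3, C3)) : L2C :=
  ((isTemperateWeight_one_add_rpow (s := 2 * α) (by linarith)).memLp_smul
    (𝓕 ψ : 𝓢(E3, C3))).toLp _

theorem coeFn_resolventTest {α : ℝ} (hα : 1 ≤ α) (ψ : 𝓢(E3, C3)) : resolventTest hα ψ =ᵐ[volume]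
    fun ξ => (freqWeight α ξ : ℂ) • (𝓕 ψ : 𝓢(E3, C3)) ξ :=
  ((isTemperateWeight_one_add_rpow (s := 2 * α) (by linarith)).memLp_smul
    (𝓕 ψ : 𝓢(E3, C3))).coeFn_toLp

/-- Shifts the weight $1+|\xi|^{2\alpha}$ onto the test field and its inverse onto $g$. All terms of
the weak formulation are thereby paired with one and the same vector, and the operators acting on
the unknowns are bounded. -/
theorem inner_eq_inner_resolventTest {α : ℝ} (hα : 1 ≤ α) {ψ : 𝓢(E3, C3)} {h g : L2C}
    {c σ : E3 → ℂ} (hσ : MemLp σ ⊤ (volume : Measure E3))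
    (hh : h =ᵐ[volume] fun ξ => c ξ • (𝓕 ψ : 𝓢(E3, C3)) ξ)
    (hc : ∀ ξ, σ ξ * freqWeight α ξ = (starRingEnd ℂ) (c ξ)) :
    inner ℂ h g = inner ℂ (resolventTest hα ψ) (mulOp hσ g) := by
  rw [L2.inner_def, L2.inner_def]
  apply integral_congr_ae
  filter_upwards [hh, coeFn_mulOp hσ g, coeFn_resolventTest hα ψ] with ξ h1 h2 h3
  rw [h1, h2, h3, inner_smul_left, inner_smul_left, inner_smul_right, ← hc, Complex.conj_ofReal]
  ring

/-- The frequency-side form of de Rham's theorem: a field annihilated by all curls is parallel to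
$\xi$. This accounts for the pressure. -/
theorem mem_gradientFields_of_inner {α : ℝ} (hα : 1 ≤ α) {V : L2C}
    (h : ∀ (ρ : E3 → ℝ) (hρ : ContDiff ℝ ∞ ρ) (hc : HasCompactSupport ρ) (i j : Fin 3),
      inner ℂ (resolventTest hα (curlSchwartz hρ hc i j)) V = 0) : V ∈ gradientFields := by
  intro i j
  have hV : ∀ i, MemLp (fun ξ => (starRingEnd ℂ) (V ξ i)) 2 (volume : Measure E3) := fun i =>
    ((EuclideanSpace.proj (𝕜 := ℂ) i : C3 →L[ℂ] ℂ).comp_memLp' (Lp.memLp V)).star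
  have hint : ∀ (i j : Fin 3) (ψ : 𝓢(E3, ℂ)), Integrable (fun ξ =>
      (freqWeight α ξ : ℂ) * derivSymbol j ξ * (starRingEnd ℂ) (V ξ i) * ψ ξ) volume := by
    intro i j ψ
    have hw := isTemperateWeight_mul_derivSymbol
      (isTemperateWeight_one_add_rpow (s := 2 * α) (by linarith)) j
    refine ((hw.memLp_smul ψ).integrable_mul (hV i)).congr (Eventually.of_forall fun ξ => ?_)
    simp only [smul_eq_mul, Pi.mul_apply, freqWeight]
    ring
  have key := ae_eq_zero_of_integral_mul_fourier
    (G := fun ξ => (freqWeight α ξ : ℂ) * derivSymbol j ξ * (starRingEnd ℂ) (V ξ i) -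
      (freqWeight α ξ : ℂ) * derivSymbol i ξ * (starRingEnd ℂ) (V ξ j)) ?_ ?_
  · filter_upwards [key] with ξ hξ
    have h1 : (freqWeight α ξ : ℂ) * (derivSymbol j ξ * (starRingEnd ℂ) (V ξ i) -
        derivSymbol i ξ * (starRingEnd ℂ) (V ξ j)) = 0 := by
      refine Eq.trans ?_ hξ
      ring
    have h2 := congrArg (starRingEnd ℂ)
      (sub_eq_zero.1 ((mul_eq_zero.1 h1).resolve_left (freqWeight_ne_zero α ξ)))
    simpa only [map_mul, Complex.conj_conj, conj_derivSymbol, neg_mul, neg_inj] using h2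
  · intro ψ
    simp only [sub_mul]
    exact (hint i j ψ).sub (hint j i ψ)
  · intro ρ hρ hc
    have h1 := congrArg (starRingEnd ℂ) (h ρ hρ hc i j)
    rw [map_zero, L2.inner_def, ← integral_conj] at h1
    rw [← h1]
    apply integral_congr_ae
    filter_upwards [coeFn_resolventTest hα (curlSchwartz hρ hc i j)] with ξ hξ
    rw [hξ, fourier_curlSchwartz, inner_smul_left, inner_smul_left, inner_sub_left, inner_smul_left,
      inner_smul_left, EuclideanSpace.inner_single_left, EuclideanSpace.inner_single_left]
    simp only [map_mul, map_sub, Complex.conj_conj, map_one, one_mul]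
    ring

/-- The orthogonal projection onto the solenoidal fields, on the frequency side. -/
noncomputable def lerayProjection : L2C →L[ℂ] L2C := gradientFieldsᗮ.starProjection

theorem lerayProjection_eq_zero {V : L2C} (hV : V ∈ gradientFields) : lerayProjection V = 0 := by
  rw [lerayProjection, Submodule.starProjection_apply_eq_zero_iff]
  exact Submodule.le_orthogonal_orthogonal _ hV

theorem lerayProjection_eq_self {s : L2C} (hs : s ∈ gradientFieldsᗮ) : lerayProjection s = s :=
  Submodule.starProjection_eq_self_iff.2 hs

theorem inner_lerayProjection_left {s V : L2C} (hs : s ∈ gradientFieldsᗮ) :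
    inner ℂ (lerayProjection V) s = inner ℂ V s := by
  rw [lerayProjection, Submodule.inner_starProjection_left_eq_right]
  exact congrArg (inner ℂ V) (lerayProjection_eq_self hs)

theorem mulOp_mem_orthogonal_gradientFields {σ : E3 → ℂ} (hσ : MemLp σ ⊤ (volume : Measure E3))
    {g : L2C} (hg : ∀ᵐ ξ : E3 ∂volume, ∑ i : Fin 3, derivSymbol i ξ * g ξ i = 0) :
    mulOp hσ g ∈ gradientFieldsᗮ := by
  apply mem_orthogonal_gradientFields
  filter_upwards [coeFn_mulOp hσ g, hg] with ξ h1 h2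
  rw [h1]
  simp only [PiLp.smul_apply, smul_eq_mul, mul_left_comm _ (σ ξ), ← Finset.mul_sum, h2, mul_zero]

/-! ### The evolution equation -/

/-- The weak formulation of `f_t + Λ^{2α} f + (a₁·∇)b₁ - (a₂·∇)b₂ + ∇p = 0`, `f(0) = f₀`. -/
def IsWeakSolution (T : EReal) (α : ℝ) (f₀ : L2R) (f a₁ b₁ a₂ b₂ : ℝ → L2R) : Prop :=
  ∀ φ : TestField T, ∫ t in times T, (φ.timeDerivPairing t (f t) +
    φ.transportPairing t (a₁ t) (b₁ t) - φ.dissipationPairing α t (f t) -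
    φ.transportPairing t (a₂ t) (b₂ t)) = - ∫ x, inner ℝ (f₀ x) (φ.toFun 0 x)

/-- The Fourier transform of the flux `(a₁)ⱼ b₁ - (a₂)ⱼ b₂`. -/
noncomputable def flux (a₁ b₁ a₂ b₂ : L2R) (j : Fin 3) : L2C :=
  𝓕 (prodField a₁ b₁ j) - 𝓕 (prodField a₂ b₂ j)

theorem InL4.memLp_flux {T : EReal} {a₁ b₁ a₂ b₂ : ℝ → L2R} (h1 : InL4 T a₁) (h2 : InL4 T b₁)
    (h3 : InL4 T a₂) (h4 : InL4 T b₂) (m1 : AEStronglyMeasurable a₁ (timeMeasure T))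
    (m2 : AEStronglyMeasurable b₁ (timeMeasure T)) (m3 : AEStronglyMeasurable a₂ (timeMeasure T))
    (m4 : AEStronglyMeasurable b₂ (timeMeasure T)) (j : Fin 3) :
    MemLp (fun t => flux (a₁ t) (b₁ t) (a₂ t) (b₂ t) j) 2 (timeMeasure T) := by
  have hF : ∀ {g : ℝ → L2C}, MemLp g 2 (timeMeasure T) →
      MemLp (fun t => (𝓕 (g t) : L2C)) 2 (timeMeasure T) := fun hg =>
    ((Lp.fourierTransformₗᵢ E3 C3).toContinuousLinearEquiv : L2C →L[ℂ] L2C).comp_memLp' hg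
  exact (hF (h1.memLp_prodField h2 m1 m2 j)).sub (hF (h3.memLp_prodField h4 m3 m4 j))

theorem memLp_drift {α : ℝ} (hα : 1 ≤ α) {X : Type*} [MeasurableSpace X] {μ : Measure X}
    {F : X → Fin 3 → L2C} {f : X → L2C} (hF : ∀ j, MemLp (fun t => F t j) 2 μ)
    (hf : MemLp f 2 μ) : MemLp (fun t => drift hα (F t) (f t)) 2 μ :=
  (memLp_finsetSum _ fun j _ => (mulOp (memLp_top_resolvent_deriv hα j)).comp_memLp' (hF j)).sub
    ((mulOp (memLp_top_resolvent_diss α)).comp_memLp' hf)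

theorem memLp_fourier_toComplex {X : Type*} [MeasurableSpace X] {μ : Measure X} {f : X → L2R}
    {p : ℝ≥0∞} (hf : MemLp f p μ) : MemLp (fun t => (𝓕 (toComplex (f t)) : L2C)) p μ :=
  ((Lp.fourierTransformₗᵢ E3 C3).toContinuousLinearEquiv : L2C →L[ℂ] L2C).comp_memLp'
    ((complexify.compLpL 2 volume).comp_memLp' hf)

theorem memLp_of_hasCompactSupport {η : ℝ → ℝ} (hη : Continuous η) (hc : HasCompactSupport η)
    (T : EReal) : MemLp η 2 (timeMeasure T) :=
  (hη.memLp_of_hasCompactSupport hc).restrict _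

theorem inner_real_smul_right (r : ℝ) (g h : L2C) : inner ℂ g (r • h) = r * inner ℂ g h := by
  have e : r • h = (r : ℂ) • h := by
    apply Lp.ext
    filter_upwards [Lp.coeFn_smul r h, Lp.coeFn_smul (r : ℂ) h] with x h1 h2
    rw [h1, h2, Pi.smul_apply, Pi.smul_apply, Complex.coe_smul]
  rw [e, inner_smul_right]

theorem _root_.MeasureTheory.MemLp.intervalIntegrable_of_mem {H : Type*} [NormedAddCommGroup H]
    {T : EReal} {g : ℝ → H} (hg : MemLp g 2 (timeMeasure T)) {t : ℝ} (ht : t ∈ times T) :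
    IntervalIntegrable g volume 0 t := by
  rw [intervalIntegrable_iff_integrableOn_Ioc_of_le ht.1.le]
  have h : MemLp g 2 (volume.restrict (Set.Ioc 0 t)) :=
    hg.mono_measure (Measure.restrict_mono (Ioc_subset_times ht.2) le_rfl)
  exact h.integrable (by norm_num)

section Weak

variable {T : EReal} {α : ℝ} {f₀ : L2R} {f a₁ b₁ a₂ b₂ : ℝ → L2R}

/-- For product test fields the weak formulation becomes orthogonality of a single Bochner integral
in $L^2$ to the weighted test field, the pairing being taken out of the time integral. -/
theorem IsWeakSolution.inner_resolventTest_eq_zero (hα : 1 ≤ α)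
    (h : IsWeakSolution T α f₀ f a₁ b₁ a₂ b₂)
    (h1 : InL4 T a₁) (h2 : InL4 T b₁) (h3 : InL4 T a₂) (h4 : InL4 T b₂)
    {η : ℝ → ℝ} (hη : ContDiff ℝ ∞ η)
    (hηc : HasCompactSupport η) (hηT : tsupport η ⊆ {t | (t : EReal) < T}) {Φ : E3 → E3}
    (hΦ : ContDiff ℝ ∞ Φ) (hΦc : HasCompactSupport Φ)
    (hdiv : ∀ x, ∑ i : Fin 3, (fderiv ℝ Φ x (EuclideanSpace.single i 1)) i = 0)
    {ψ : 𝓢(E3, C3)} (hψ : ∀ x, ψ x = complexify (Φ x))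
    (hint : Integrable (fun t => deriv η t • mulOp (memLp_top_resolvent α) (𝓕 (toComplex (f t))) +
        η t • drift hα (flux (a₁ t) (b₁ t) (a₂ t) (b₂ t)) (𝓕 (toComplex (f t)))) (timeMeasure T)) :
    inner ℂ (resolventTest hα ψ)
      ((∫ t in times T, (deriv η t • mulOp (memLp_top_resolvent α) (𝓕 (toComplex (f t))) +
        η t • drift hα (flux (a₁ t) (b₁ t) (a₂ t) (b₂ t)) (𝓕 (toComplex (f t))))) +
        η 0 • mulOp (memLp_top_resolvent α) (𝓕 (toComplex f₀))) = 0 := by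
  have hr : ∀ g : L2C, inner ℂ (ψ.toLp 2 volume) g =
      inner ℂ (resolventTest hα ψ) (mulOp (memLp_top_resolvent α) (𝓕 g)) := by
    intro g
    rw [← Lp.inner_fourier_eq, SchwartzMap.toLp_fourier_eq]
    refine inner_eq_inner_resolventTest hα (c := fun _ => 1) _ ?_ fun ξ => ?_
    · filter_upwards [(𝓕 ψ : 𝓢(E3, C3)).coeFn_toLp 2 volume] with ξ hξ
      rw [hξ, one_smul]
    · rw [map_one, div_mul_cancel₀ _ (freqWeight_ne_zero α ξ)]
  have hd : ∀ (j : Fin 3) (g : L2C), inner ℂ ((∂_{EuclideanSpace.single j (1 : ℝ)} ψ).toLp 2 volume)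
      g = inner ℂ (resolventTest hα ψ) (mulOp (memLp_top_resolvent_deriv hα j) (𝓕 g)) := by
    intro j g
    rw [← Lp.inner_fourier_eq, SchwartzMap.toLp_fourier_eq]
    refine inner_eq_inner_resolventTest hα (c := derivSymbol j) _ ?_ fun ξ => ?_
    · filter_upwards [(𝓕 (∂_{EuclideanSpace.single j (1 : ℝ)} ψ) : 𝓢(E3, C3)).coeFn_toLp 2 volume]
        with ξ hξ
      rw [hξ, fourier_lineDerivOp]
    · rw [conj_derivSymbol, div_mul_cancel₀ _ (freqWeight_ne_zero α ξ)]
  have hα0 : 0 ≤ 2 * α := by linarith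
  have hl : ∀ g : L2C, inner ℂ (((isTemperateWeight_rpow hα0).memLp_smul
        (𝓕 ψ : 𝓢(E3, C3))).toLp _ : L2C) g =
      inner ℂ (resolventTest hα ψ) (mulOp (memLp_top_resolvent_diss α) g) := by
    intro g
    refine inner_eq_inner_resolventTest hα
      (c := fun ξ => (((2 * Real.pi * ‖ξ‖) ^ (2 * α) : ℝ) : ℂ)) _ (MemLp.coeFn_toLp _) fun ξ => ?_
    rw [Complex.conj_ofReal, div_mul_cancel₀ _ (freqWeight_ne_zero α ξ)]
  have key := congrArg (fun r : ℝ => (r : ℂ)) (h (tensorField hη hηc hηT hΦ hΦc hdiv))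
  rw [Complex.ofReal_neg, initialPairing_tensorField hη hηc hηT hΦ hΦc hdiv hψ, hr,
    ← integral_complex_ofReal] at key
  rw [inner_add_right, inner_real_smul_right, add_eq_zero_iff_eq_neg, ← key]
  refine (integral_inner hint _).symm.trans ?_
  apply integral_congr_ae
  filter_upwards [h1.ae_memLp, h2.ae_memLp, h3.ae_memLp, h4.ae_memLp] with t m1 m2 m3 m4
  push_cast
  rw [timeDerivPairing_tensorField hη hηc hηT hΦ hΦc hdiv hψ,
    transportPairing_tensorField hη hηc hηT hΦ hΦc hdiv hψ _ m1 m2,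
    transportPairing_tensorField hη hηc hηT hΦ hΦc hdiv hψ _ m3 m4,
    dissipationPairing_tensorField hη hηc hηT hΦ hΦc hdiv hψ (by linarith), hr, hl,
    inner_add_right, inner_real_smul_right, inner_real_smul_right, drift, inner_sub_right, inner_sum]
  simp only [hd, flux, map_sub, inner_sub_right, Finset.sum_sub_distrib]
  ring

/-- Testing with curls places the Bochner integral in the gradient fields, which the Leray
projection kills. The projection fixes the resolvent of a solenoidal field, so a genuine weak
evolution equation in $L^2$ remains. -/
theorem IsWeakSolution.ae_eq_primitive (hα : 1 ≤ α)
    (h : IsWeakSolution T α f₀ f a₁ b₁ a₂ b₂)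
    (h1 : InL4 T a₁) (h2 : InL4 T b₁) (h3 : InL4 T a₂) (h4 : InL4 T b₂)
    (hf : MemLp f 2 (timeMeasure T)) (hfs : ∀ᵐ t ∂(timeMeasure T), IsSolenoidal (f t))
    (hf₀ : IsSolenoidal f₀)
    (hF : ∀ j, MemLp (fun t => flux (a₁ t) (b₁ t) (a₂ t) (b₂ t) j) 2 (timeMeasure T)) :
    ∀ᵐ t ∂(timeMeasure T), mulOp (memLp_top_resolvent α) (𝓕 (toComplex (f t))) =
      mulOp (memLp_top_resolvent α) (𝓕 (toComplex f₀)) + ∫ s in (0 : ℝ)..t,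
        lerayProjection (drift hα (flux (a₁ s) (b₁ s) (a₂ s) (b₂ s)) (𝓕 (toComplex (f s)))) := by
  have hfF : MemLp (fun t => (𝓕 (toComplex (f t)) : L2C)) 2 (timeMeasure T) :=
    memLp_fourier_toComplex hf
  have hA : MemLp (fun t => mulOp (memLp_top_resolvent α) (𝓕 (toComplex (f t)))) 2
      (timeMeasure T) := (mulOp (memLp_top_resolvent α)).comp_memLp' hfF
  have hD := memLp_drift hα hF hfF
  have hPD := lerayProjection.comp_memLp' hD
  refine ae_eq_primitive_of_weak (fun t ht => hA.intervalIntegrable_of_mem ht)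
    (fun t ht => hPD.intervalIntegrable_of_mem ht) fun η hη hηc hηT => ?_
  have hη1 := memLp_of_hasCompactSupport hη.continuous hηc T
  have hη2 := memLp_of_hasCompactSupport (hη.continuous_deriv (by simp)) hηc.deriv T
  have hint : ∀ {g D : ℝ → L2C}, MemLp g 2 (timeMeasure T) → MemLp D 2 (timeMeasure T) →
      Integrable (fun t => deriv η t • g t + η t • D t) (timeMeasure T) := fun hg hD =>
    (memLp_one_iff_integrable.1 (hg.smul hη2)).add (memLp_one_iff_integrable.1 (hD.smul hη1))
  have hmem := mem_gradientFields_of_inner hα fun ρ hρ hc i j =>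
    h.inner_resolventTest_eq_zero hα h1 h2 h3 h4 hη hηc hηT (contDiff_curlField hρ i j)
      (hasCompactSupport_curlField hc i j) (div_curlField hρ i j) (curlSchwartz_apply hρ hc i j)
      (hint hA hD)
  have h0 := lerayProjection_eq_zero hmem
  rw [map_add, show lerayProjection (∫ t in times T, _) = _ from
    (ContinuousLinearMap.integral_comp_comm lerayProjection (hint hA hD)).symm] at h0
  have hself : ∀ g : L2R, IsSolenoidal g →
      lerayProjection (mulOp (memLp_top_resolvent α) (𝓕 (toComplex g))) =
        mulOp (memLp_top_resolvent α) (𝓕 (toComplex g)) := fun g hg =>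
    lerayProjection_eq_self (mulOp_mem_orthogonal_gradientFields _ hg.sum_derivSymbol_eq_zero)
  have hreal : ∀ (r : ℝ) (g : L2C), lerayProjection (r • g) = r • lerayProjection g := fun r g =>
    map_smul (lerayProjection.restrictScalars ℝ) r g
  rw [hreal, hself _ hf₀] at h0
  refine Eq.trans ?_ h0
  congr 1
  apply integral_congr_ae
  filter_upwards [hfs] with t ht
  rw [map_add, hreal, hreal, hself _ ht]
  rfl

end Weak

/-! ### Frequency cut-offs -/

open Classical in
/-- The indicator function of the ball of radius `n`. -/
noncomputable def cutoffSymbol (n : ℕ) (ξ : E3) : ℂ := if ‖ξ‖ ≤ n then 1 else 0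

theorem measurable_cutoffSymbol (n : ℕ) : Measurable (cutoffSymbol n) :=
  Measurable.ite (measurableSet_le measurable_norm measurable_const) measurable_const
    measurable_const

theorem norm_cutoffSymbol_le (n : ℕ) (ξ : E3) : ‖cutoffSymbol n ξ‖ ≤ 1 := by
  unfold cutoffSymbol
  split_ifs <;> simp

theorem conj_cutoffSymbol (n : ℕ) (ξ : E3) :
    (starRingEnd ℂ) (cutoffSymbol n ξ) = cutoffSymbol n ξ := by
  unfold cutoffSymbol
  split_ifs <;> simp

theorem tendsto_cutoffSymbol (ξ : E3) : Tendsto (fun n => cutoffSymbol n ξ) atTop (𝓝 1) := by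
  obtain ⟨N, hN⟩ := exists_nat_ge ‖ξ‖
  refine tendsto_const_nhds.congr' ?_
  filter_upwards [eventually_ge_atTop N] with n hn
  rw [cutoffSymbol, if_pos (hN.trans (by exact_mod_cast hn))]

/-- The projection onto the frequencies of modulus at most `n`. -/
noncomputable def cutoff (n : ℕ) : L2C →L[ℂ] L2C :=
  mulOp (memLp_top_of_le (measurable_cutoffSymbol n) 1 (norm_cutoffSymbol_le n))

theorem coeFn_cutoff (n : ℕ) (f : L2C) : cutoff n f =ᵐ[volume] fun ξ => cutoffSymbol n ξ • f ξ :=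
  coeFn_mulOp _ f

theorem norm_cutoff_le (n : ℕ) (f : L2C) : ‖cutoff n f‖ ≤ ‖f‖ := by
  refine Lp.norm_le_norm_of_ae_le ?_
  filter_upwards [coeFn_cutoff n f] with ξ h
  rw [h, norm_smul]
  exact mul_le_of_le_one_left (norm_nonneg _) (norm_cutoffSymbol_le n ξ)

theorem norm_sq_eq_integral (g : L2C) : ‖g‖ ^ 2 = ∫ ξ, ‖g ξ‖ ^ 2 := by
  rw [← inner_self_eq_norm_sq (𝕜 := ℂ), L2.inner_def]
  refine (integral_re (𝕜 := ℂ) (L2.integrable_inner g g)).symm.trans ?_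
  congr 1
  ext ξ
  exact inner_self_eq_norm_sq (𝕜 := ℂ) (g ξ)

theorem tendsto_cutoff (f : L2C) : Tendsto (fun n => cutoff n f) atTop (𝓝 f) := by
  rw [tendsto_iff_norm_sub_tendsto_zero]
  have h0 : ∀ n, cutoff n f - f =ᵐ[volume] fun ξ => (cutoffSymbol n ξ - 1) • f ξ := by
    intro n
    filter_upwards [Lp.coeFn_sub (cutoff n f) f, coeFn_cutoff n f] with ξ h1 h2
    rw [h1, Pi.sub_apply, h2, sub_smul, one_smul]
  have hsq : Tendsto (fun n => ‖cutoff n f - f‖ ^ 2) atTop (𝓝 (∫ ξ, (0 : ℝ) ∂(volume : Measure E3))) := by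
    simp only [norm_sq_eq_integral]
    -- The factor 4 is the square of the bound 2 for the distance of the cut-off symbol from 1.
    refine tendsto_integral_of_dominated_convergence (fun ξ => 4 * ‖f ξ‖ ^ 2)
      (fun n => (Lp.aestronglyMeasurable _).norm.pow 2)
      ((memLp_two_iff_integrable_sq_norm (Lp.aestronglyMeasurable f)).1 (Lp.memLp f) |>.const_mul 4)
      (fun n => ?_) ?_
    · filter_upwards [h0 n] with ξ h1
      rw [h1, Real.norm_of_nonneg (by positivity), norm_smul, mul_pow]
      gcongr
      have : ‖cutoffSymbol n ξ - 1‖ ≤ 2 :=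
        (norm_sub_le _ _).trans (by
          rw [norm_one]
          linarith [norm_cutoffSymbol_le n ξ])
      nlinarith [norm_nonneg (cutoffSymbol n ξ - 1)]
    · filter_upwards [ae_all_iff.2 h0] with ξ h1
      simp only [h1, norm_smul, mul_pow]
      have h2 := ((tendsto_cutoffSymbol ξ).sub_const 1).norm.pow 2 |>.mul_const (‖f ξ‖ ^ 2)
      simpa using h2
  rw [integral_zero] at hsq
  have := (Real.continuous_sqrt.tendsto _).comp hsq
  simpa [Function.comp_def, Real.sqrt_sq] using this

theorem memLp_top_cutoff_mul_freqWeight {α : ℝ} (hα : 1 ≤ α) (n : ℕ) :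
    MemLp (fun ξ => cutoffSymbol n ξ * freqWeight α ξ) ⊤ (volume : Measure E3) := by
  refine memLp_top_of_le ((measurable_cutoffSymbol n).mul (measurable_freqWeight α))
    (1 + (2 * Real.pi * n) ^ (2 * α)) fun ξ => ?_
  rw [norm_mul, Complex.norm_real, Real.norm_of_nonneg (freqWeight_pos α ξ).le, cutoffSymbol]
  split_ifs with h
  · rw [norm_one, one_mul, freqWeight]
    gcongr
  · rw [norm_zero, zero_mul]
    positivity

/-- The inverse of the resolvent on the frequencies of modulus at most `n`. -/
noncomputable def cutoffInv {α : ℝ} (hα : 1 ≤ α) (n : ℕ) : L2C →L[ℂ] L2C :=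
  mulOp (memLp_top_cutoff_mul_freqWeight hα n)

/-- Undoing the resolvent on bounded frequencies is a bounded operation; it turns the equation for
the resolvent of $f$ into one for the truncations of $f$. -/
theorem cutoffInv_resolvent {α : ℝ} (hα : 1 ≤ α) (n : ℕ) (g : L2C) :
    cutoffInv hα n (mulOp (memLp_top_resolvent α) g) = cutoff n g := by
  apply Lp.ext
  filter_upwards [coeFn_mulOp (memLp_top_cutoff_mul_freqWeight hα n)
    (mulOp (memLp_top_resolvent α) g), coeFn_mulOp (memLp_top_resolvent α) g, coeFn_cutoff n g]
    with ξ h1 h2 h3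
  rw [cutoffInv, h1, h2, h3, smul_smul, mul_assoc, mul_div_cancel₀ _ (freqWeight_ne_zero α ξ),
    mul_one]

theorem inner_cutoffInv_left {α : ℝ} (hα : 1 ≤ α) (n : ℕ) (x y : L2C) :
    inner ℂ (cutoffInv hα n x) y = inner ℂ x (cutoffInv hα n y) := by
  rw [L2.inner_def, L2.inner_def]
  apply integral_congr_ae
  filter_upwards [coeFn_mulOp (memLp_top_cutoff_mul_freqWeight hα n) x,
    coeFn_mulOp (memLp_top_cutoff_mul_freqWeight hα n) y] with ξ h1 h2
  rw [cutoffInv, h1, h2, inner_smul_left, inner_smul_right, map_mul, conj_cutoffSymbol,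
    Complex.conj_ofReal]

/-! ### Regularity of fields in `H^α` -/

theorem MemH.norm_le {α : ℝ} (hα : 1 ≤ α) (f : L2C) (ξ : E3) :
    ‖((2 * Real.pi * ‖ξ‖ : ℝ) : ℂ) • (𝓕 f : L2C) ξ‖ ≤
      ‖(𝓕 f : L2C) ξ‖ + ‖symbolMul α f ξ‖ := by
  rw [symbolMul, norm_smul, norm_smul, Complex.norm_real, Complex.norm_real,
    Real.norm_of_nonneg (by positivity), Real.norm_of_nonneg (by positivity), ← one_add_mul]
  gcongr
  exact le_one_add_rpow (by positivity) hα

theorem MemH.hasH1 {α : ℝ} (hα : 1 ≤ α) {f : L2R} (hf : MemH α f) : HasH1 (toComplex f) := by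
  have hm : Measurable fun ξ : E3 => ((2 * Real.pi * ‖ξ‖ : ℝ) : ℂ) := by fun_prop
  refine MemLp.mono ((Lp.memLp (𝓕 (toComplex f) : L2C)).norm.add (MemLp.norm hf))
    (hm.aestronglyMeasurable.smul (Lp.aestronglyMeasurable (𝓕 (toComplex f) : L2C)))
    (Eventually.of_forall fun ξ => (MemH.norm_le hα _ ξ).trans (le_abs_self _))

theorem MemH.coeFn_fourier_Lam {α : ℝ} {f : L2R} (hf : MemH α f) :
    (𝓕 (Lam α f) : L2C) =ᵐ[volume] symbolMul α (toComplex f) := by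
  rw [fourier_Lam hf]
  exact MemLp.coeFn_toLp hf

theorem norm_le_add_of_ae_le {x y z : L2C} (h : ∀ᵐ ξ : E3 ∂volume, ‖x ξ‖ ≤ ‖y ξ‖ + ‖z ξ‖) :
    ‖x‖ ≤ ‖y‖ + ‖z‖ := by
  have h1 : eLpNorm x 2 volume ≤ eLpNorm y 2 volume + eLpNorm z 2 volume := by
    rw [← eLpNorm_norm y, ← eLpNorm_norm z]
    refine le_trans (eLpNorm_mono_ae (g := (fun ξ => ‖y ξ‖) + fun ξ => ‖z ξ‖) ?_) (eLpNorm_add_le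
      (Lp.aestronglyMeasurable y).norm (Lp.aestronglyMeasurable z).norm (by norm_num))
    filter_upwards [h] with ξ h2
    exact h2.trans (le_abs_self _)
  rw [Lp.norm_def, Lp.norm_def, Lp.norm_def,
    ← ENNReal.toReal_add (Lp.eLpNorm_ne_top y) (Lp.eLpNorm_ne_top z)]
  exact ENNReal.toReal_mono (ENNReal.add_ne_top.2 ⟨Lp.eLpNorm_ne_top y, Lp.eLpNorm_ne_top z⟩) h1

theorem MemH.norm_freqDeriv_le {α : ℝ} (hα : 1 ≤ α) {f : L2R} (hf : MemH α f) (j : Fin 3) :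
    ‖freqDeriv j (toComplex f)‖ ≤ ‖f‖ + ‖Lam α f‖ := by
  rw [← norm_toComplex f, ← Lp.norm_fourier_eq (toComplex f), ← Lp.norm_fourier_eq (Lam α f)]
  refine norm_le_add_of_ae_le ?_
  filter_upwards [(hf.hasH1 hα).coeFn_freqDeriv j, hf.coeFn_fourier_Lam] with ξ h2 h3
  refine le_trans ?_ ((MemH.norm_le hα (toComplex f) ξ).trans_eq (by rw [h3]))
  rw [h2, norm_smul, norm_smul, Complex.norm_real, Real.norm_of_nonneg (by positivity)]
  gcongr
  exact norm_derivSymbol_le j ξ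

theorem sum_derivSymbol_mulOp {σ : E3 → ℂ} (hσ : MemLp σ ⊤ (volume : Measure E3)) {g : L2C}
    (hg : ∀ᵐ ξ : E3 ∂volume, ∑ i : Fin 3, derivSymbol i ξ * g ξ i = 0) :
    ∀ᵐ ξ : E3 ∂volume, ∑ i : Fin 3, derivSymbol i ξ * mulOp hσ g ξ i = 0 := by
  filter_upwards [coeFn_mulOp hσ g, hg] with ξ h1 h2
  rw [h1]
  simp only [PiLp.smul_apply, smul_eq_mul, mul_left_comm _ (σ ξ), ← Finset.mul_sum, h2, mul_zero]

/-- The duality pairing of $f_t$ with $f$, truncated. The weight cancels the resolvent, the skew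
symbol $-2\pi i\xi_j$ moves onto $f$ with a plus sign, and $|\xi|^{2\alpha}$ is shared equally
between the two factors. -/
theorem inner_cutoffInv_drift {α : ℝ} (hα : 1 ≤ α) {f : L2R} (hf : MemH α f)
    (hs : IsSolenoidal f) (F : Fin 3 → L2C) (n m : ℕ) :
    inner ℂ (cutoffInv hα n (lerayProjection (drift hα F (𝓕 (toComplex f)))))
      (cutoff m (𝓕 (toComplex f))) =
    ∑ j : Fin 3, inner ℂ (cutoff n (F j)) (cutoff m (freqDeriv j (toComplex f))) -
      inner ℂ (cutoff n (𝓕 (Lam α f))) (cutoff m (𝓕 (Lam α f))) := by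
  -- Scalar multipliers preserve solenoidality, so the projection disappears once it is moved to
  -- this side.
  have hmem : cutoffInv hα n (cutoff m (𝓕 (toComplex f))) ∈ gradientFieldsᗮ :=
    mulOp_mem_orthogonal_gradientFields _ (sum_derivSymbol_mulOp _ hs.sum_derivSymbol_eq_zero)
  rw [inner_cutoffInv_left, inner_lerayProjection_left hmem, drift, inner_sub_left, sum_inner]
  have hc1 := coeFn_mulOp (memLp_top_cutoff_mul_freqWeight hα n) (cutoff m (𝓕 (toComplex f)))
  have hc2 := coeFn_cutoff m (𝓕 (toComplex f))
  congr 1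
  · refine Finset.sum_congr rfl fun j _ => ?_
    rw [L2.inner_def, L2.inner_def]
    apply integral_congr_ae
    filter_upwards [hc1, hc2, coeFn_mulOp (memLp_top_resolvent_deriv hα j) (F j),
      coeFn_cutoff n (F j), coeFn_cutoff m (freqDeriv j (toComplex f)),
      (hf.hasH1 hα).coeFn_freqDeriv j] with ξ h1 h2 h3 h4 h5 h6
    rw [cutoffInv, h1, h2, h3, h4, h5, h6]
    simp only [inner_smul_left, inner_smul_right, map_div₀, map_neg, conj_derivSymbol,
      conj_cutoffSymbol, Complex.conj_ofReal, neg_neg]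
    have := freqWeight_ne_zero α ξ
    field_simp
  · rw [L2.inner_def, L2.inner_def]
    apply integral_congr_ae
    filter_upwards [hc1, hc2, coeFn_mulOp (memLp_top_resolvent_diss α) (𝓕 (toComplex f)),
      coeFn_cutoff n (𝓕 (Lam α f)), coeFn_cutoff m (𝓕 (Lam α f)), hf.coeFn_fourier_Lam]
      with ξ h1 h2 h3 h4 h5 h6
    rw [cutoffInv, h1, h2, h3, h4, h5, h6, symbolMul]
    simp only [inner_smul_left, inner_smul_right, map_div₀, conj_cutoffSymbol,
      Complex.conj_ofReal]
    have h7 : (((2 * Real.pi * ‖ξ‖) ^ (2 * α) : ℝ) : ℂ) =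
        (((2 * Real.pi * ‖ξ‖) ^ α : ℝ) : ℂ) * (((2 * Real.pi * ‖ξ‖) ^ α : ℝ) : ℂ) := by
      rw [← Complex.ofReal_mul, ← Real.rpow_add_of_nonneg (by positivity) (by linarith)
        (by linarith), ← two_mul α]
    have := freqWeight_ne_zero α ξ
    rw [h7]
    field_simp

/-! ### The energy identity -/

/-- The power supplied by the flux minus the dissipation. -/
noncomputable def power (α : ℝ) (F : Fin 3 → L2C) (f : L2R) : ℝ :=
  ∑ j : Fin 3, (inner ℂ (F j) (freqDeriv j (toComplex f))).re - ‖Lam α f‖ ^ 2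

/-- The bound is independent of both cut-offs and will be integrable in time: it supplies the
dominating function for the representative. -/
theorem abs_re_inner_cutoffInv_drift_le {α : ℝ} (hα : 1 ≤ α) {f : L2R} (hf : MemH α f)
    (hs : IsSolenoidal f) (F : Fin 3 → L2C) (n m : ℕ) :
    |(inner ℂ (cutoffInv hα n (lerayProjection (drift hα F (𝓕 (toComplex f)))))
      (cutoff m (𝓕 (toComplex f)))).re| ≤
    ∑ j : Fin 3, ‖F j‖ * (‖f‖ + ‖Lam α f‖) + ‖Lam α f‖ * ‖Lam α f‖ := by
  rw [inner_cutoffInv_drift hα hf hs]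
  refine (Complex.abs_re_le_norm _).trans ((norm_sub_le _ _).trans (add_le_add ?_ ?_))
  · refine (norm_sum_le _ _).trans (Finset.sum_le_sum fun j _ => (norm_inner_le_norm _ _).trans ?_)
    exact mul_le_mul (norm_cutoff_le _ _) ((norm_cutoff_le _ _).trans (hf.norm_freqDeriv_le hα j))
      (norm_nonneg _) (norm_nonneg _)
  · refine (norm_inner_le_norm _ _).trans ?_
    rw [← Lp.norm_fourier_eq (Lam α f)]
    exact mul_le_mul (norm_cutoff_le _ _) (norm_cutoff_le _ _) (norm_nonneg _) (norm_nonneg _)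

theorem tendsto_re_inner_cutoffInv_drift {α : ℝ} (hα : 1 ≤ α) {f : L2R} (hf : MemH α f)
    (hs : IsSolenoidal f) (F : Fin 3 → L2C) :
    Tendsto (fun p : ℕ × ℕ =>
      (inner ℂ (cutoffInv hα p.1 (lerayProjection (drift hα F (𝓕 (toComplex f)))))
        (cutoff p.2 (𝓕 (toComplex f)))).re) atTop (𝓝 (power α F f)) := by
  have h1 : ∀ x y : L2C, Tendsto (fun p : ℕ × ℕ => (inner ℂ (cutoff p.1 x) (cutoff p.2 y)).re) atTop
      (𝓝 (inner ℂ x y).re) := by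
    intro x y
    rw [← prod_atTop_atTop_eq]
    exact (Complex.continuous_re.tendsto _).comp
      (((tendsto_cutoff x).comp tendsto_fst).inner ((tendsto_cutoff y).comp tendsto_snd))
  have h2 : ‖Lam α f‖ ^ 2 = (inner ℂ (𝓕 (Lam α f)) (𝓕 (Lam α f))).re := by
    rw [← Lp.norm_fourier_eq (Lam α f)]
    exact (inner_self_eq_norm_sq (𝕜 := ℂ) _).symm
  rw [power, h2]
  simp only [inner_cutoffInv_drift hα hf hs, Complex.sub_re, Complex.re_sum]
  exact (tendsto_finsetSum _ fun j _ => h1 _ _).sub (h1 _ _)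

/-! ### Returning from the frequency side to real fields -/

theorem isometry_fourier_toComplex : Isometry fun f : L2R => (𝓕 (toComplex f) : L2C) := by
  refine (Lp.fourierTransformₗᵢ E3 C3).isometry.comp (Isometry.of_dist_eq fun f g => ?_)
  rw [dist_eq_norm, dist_eq_norm, ← norm_toComplex]
  congr 1
  exact ((complexify.compLpL 2 volume).map_sub f g).symm

/-- A set of full measure meets every nonempty open subset of $(0,T)$, hence is dense in $[0,T)$;
this includes the initial time. -/
theorem mem_closure_of_ae {T : EReal} {p : ℝ → Prop}
    (hp : ∀ᵐ t ∂(timeMeasure T), p t) {t : ℝ} (ht0 : 0 ≤ t) (ht : (t : EReal) < T) :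
    t ∈ closure {s | s ∈ times T ∧ p s} := by
  rw [mem_closure_iff]
  intro o ho hto
  have hne : (o ∩ times T).Nonempty := by
    obtain ⟨b, hb1, hb2⟩ := EReal.lt_iff_exists_real_btwn.1 ht
    have hb : t < b := EReal.coe_lt_coe_iff.1 hb1
    obtain ⟨ε, hε, hball⟩ := Metric.isOpen_iff.1 ho t hto
    refine ⟨t + min (ε / 2) (b - t), hball ?_, ?_, ?_⟩
    · rw [Metric.mem_ball, Real.dist_eq, add_sub_cancel_left, abs_of_pos (lt_min (by linarith)
        (by linarith))]
      exact (min_le_left _ _).trans_lt (by linarith)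
    · have := lt_min (half_pos hε) (sub_pos.2 hb)
      linarith
    · refine lt_of_le_of_lt (EReal.coe_le_coe_iff.2 ?_) hb2
      linarith [min_le_right (ε / 2) (b - t)]
  by_contra hemp
  rw [Set.not_nonempty_iff_eq_empty] at hemp
  rw [timeMeasure, ae_restrict_iff' (measurableSet_times T)] at hp
  have hnull : volume (o ∩ times T) = 0 := by
    refine measure_mono_null ?_ hp
    rintro s ⟨hs1, hs2⟩ hs3
    exact hemp.subset (show s ∈ o ∩ {s | s ∈ times T ∧ p s} from ⟨hs1, hs2, hs3 hs2⟩)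
  exact ((ho.inter (isOpen_times T)).measure_pos volume hne).ne' hnull

/-- The transforms of real fields form the range of an isometry from a complete space, which is
closed. A continuous curve that lies in it for almost all times lies in it for all times. The
representative obtained is even strongly continuous. -/
theorem exists_real_representative {T : EReal} {f : ℝ → L2R} {V : ℝ → L2C}
    (hV : ContinuousOn V {t | 0 ≤ t ∧ (t : EReal) < T})
    (hae : (fun t => (𝓕 (toComplex (f t)) : L2C)) =ᵐ[timeMeasure T] V) :
    ∃ v : ℝ → L2R, IsWeaklyContinuousRepresentative T f v ∧
      ∀ t : ℝ, 0 ≤ t → (t : EReal) < T → (𝓕 (toComplex (v t)) : L2C) = V t := by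
  have hι := isometry_fourier_toComplex
  have hmem : ∀ t : ℝ, 0 ≤ t → (t : EReal) < T →
      ∃ g : L2R, (𝓕 (toComplex g) : L2C) = V t := by
    intro t h0 ht
    have h1 : V t ∈ closure (Set.range fun g : L2R => (𝓕 (toComplex g) : L2C)) := by
      refine ContinuousWithinAt.mem_closure ((hV t ⟨h0, ht⟩).mono fun s hs => ⟨hs.1.1.le, hs.1.2⟩)
        (mem_closure_of_ae hae h0 ht) fun s hs => ⟨f s, hs.2⟩
    rwa [hι.isClosedEmbedding.isClosed_range.closure_eq] at h1
  choose! v hv using hmem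
  refine ⟨v, ⟨?_, fun g => ?_⟩, hv⟩
  · filter_upwards [hae, ae_restrict_mem (measurableSet_times T)] with t h1 h2
    exact hι.injective (h1.trans (hv t h2.1.le h2.2).symm)
  · have hvc : ContinuousOn v {t | 0 ≤ t ∧ (t : EReal) < T} := by
      rw [hι.isEmbedding.continuousOn_iff]
      exact hV.congr fun t ht => hv t ht.1 ht.2
    exact hvc.inner continuousOn_const

/-! ### The energy balance of each equation and the sum of the two -/

theorem IsWeakSolution.exists_representative {T : EReal} {α : ℝ} {f₀ : L2R}
    {f a₁ b₁ a₂ b₂ : ℝ → L2R} (hα : 1 ≤ α) (hT : 0 < T)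
    (h : IsWeakSolution T α f₀ f a₁ b₁ a₂ b₂)
    (h1 : InL4 T a₁) (h2 : InL4 T b₁) (h3 : InL4 T a₂) (h4 : InL4 T b₂)
    (hf : InEnergyClass T α f) (hf₀ : IsSolenoidal f₀)
    (hF : ∀ j, MemLp (fun t => flux (a₁ t) (b₁ t) (a₂ t) (b₂ t) j) 2 (timeMeasure T)) :
    ∃ v : ℝ → L2R, IsWeaklyContinuousRepresentative T f v ∧ v 0 = f₀ ∧
      Integrable (fun t => power α (flux (a₁ t) (b₁ t) (a₂ t) (b₂ t)) (f t)) (timeMeasure T) ∧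
      ∀ t : ℝ, 0 ≤ t → (t : EReal) < T → ‖v t‖ ^ 2 = ‖f₀‖ ^ 2 +
        2 * ∫ s in (0 : ℝ)..t, power α (flux (a₁ s) (b₁ s) (a₂ s) (b₂ s)) (f s) := by
  set F : ℝ → Fin 3 → L2C := fun t => flux (a₁ t) (b₁ t) (a₂ t) (b₂ t) with hFdef
  have hfF : MemLp (fun t => (𝓕 (toComplex (f t)) : L2C)) 2 (timeMeasure T) :=
    memLp_fourier_toComplex hf.memLp_two
  have hPD : MemLp (fun t => lerayProjection (drift hα (F t) (𝓕 (toComplex (f t))))) 2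
      (timeMeasure T) := lerayProjection.comp_memLp' (memLp_drift hα hF hfF)
  have hW : ∀ n, MemLp (fun t => cutoffInv hα n
      (lerayProjection (drift hα (F t) (𝓕 (toComplex (f t)))))) 2 (timeMeasure T) := fun n =>
    (cutoffInv hα n).comp_memLp' hPD
  have hprim := h.ae_eq_primitive hα h1 h2 h3 h4 hf.memLp_two hf.solenoidal hf₀ hF
  set k : ℝ → ℝ := fun t => ∑ j : Fin 3, ‖F t j‖ * (‖f t‖ + ‖Lam α (f t)‖) +
    ‖Lam α (f t)‖ * ‖Lam α (f t)‖ with hk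
  have hki : Integrable k (timeMeasure T) := by
    refine (integrable_finsetSum _ fun j _ => ?_).add
      (hf.lam_memLp_two.norm.integrable_mul hf.lam_memLp_two.norm)
    exact (hF j).norm.integrable_mul (hf.memLp_two.norm.add hf.lam_memLp_two.norm)
  have hbound : ∀ n m, ∀ᵐ t ∂(timeMeasure T), |(inner ℂ (cutoffInv hα n (lerayProjection
      (drift hα (F t) (𝓕 (toComplex (f t)))))) (cutoff m (𝓕 (toComplex (f t))))).re| ≤ k t := by
    intro n m
    filter_upwards [hf.memH, hf.solenoidal] with t h5 h6
    exact abs_re_inner_cutoffInv_drift_le hα h5 h6 _ n m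
  have hlim : ∀ᵐ t ∂(timeMeasure T), Tendsto (fun p : ℕ × ℕ => (inner ℂ (cutoffInv hα p.1
      (lerayProjection (drift hα (F t) (𝓕 (toComplex (f t))))))
        (cutoff p.2 (𝓕 (toComplex (f t))))).re) atTop (𝓝 (power α (F t) (f t))) := by
    filter_upwards [hf.memH, hf.solenoidal] with t h5 h6
    exact tendsto_re_inner_cutoffInv_drift hα h5 h6 _
  have hint : Integrable (fun t => power α (F t) (f t)) (timeMeasure T) := by
    refine hki.mono' (aestronglyMeasurable_of_tendsto_ae atTop (fun p : ℕ × ℕ => ?_) hlim) ?_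
    · exact Complex.continuous_re.comp_aestronglyMeasurable
        ((hW p.1).1.inner ((cutoff p.2).continuous.comp_aestronglyMeasurable hfF.1))
    · have hb := ae_all_iff.2 fun n => ae_all_iff.2 fun m => hbound n m
      filter_upwards [hb, hlim] with t h5 h6
      exact le_of_tendsto h6.abs (Eventually.of_forall fun p => h5 p.1 p.2)
  -- Applying `cutoffInv` to the primitive identity for the resolvent displays the truncation of
  -- $\hat f$ as a primitive, as the abstract theorem demands.
  obtain ⟨V, hV, hVae, hV0, hVE⟩ := exists_continuous_representative (S := cutoff) hT hfF.1
    tendsto_cutoff (fun n t ht => (hW n).intervalIntegrable_of_mem ht) (fun n => (hW n).1)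
    (fun n => by
      filter_upwards [hprim, ae_restrict_mem (measurableSet_times T)] with t h5 h6
      have h7 := congrArg (cutoffInv hα n) h5
      rw [map_add, cutoffInv_resolvent, cutoffInv_resolvent,
        ← ContinuousLinearMap.intervalIntegral_comp_comm _ (hPD.intervalIntegrable_of_mem h6)] at h7
      exact h7)
    hki hbound hlim
  obtain ⟨v, hv, hvV⟩ := exists_real_representative hV hVae
  have h0T : ((0 : ℝ) : EReal) < T := by simpa using hT
  refine ⟨v, hv, isometry_fourier_toComplex.injective ((hvV 0 le_rfl h0T).trans hV0), hint,
    fun t ht0 ht => ?_⟩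
  have h8 := hVE t ht0 ht
  rw [← hvV t ht0 ht, Lp.norm_fourier_eq, norm_toComplex, Lp.norm_fourier_eq, norm_toComplex] at h8
  exact h8

/-- Three cancellations by antisymmetry: $((a\cdot\nabla)a,a)=0$, $((a\cdot\nabla)b,b)=0$, and
$((b\cdot\nabla)a,b)+((b\cdot\nabla)b,a)=0$. Only the last one couples the two equations. -/
theorem power_add_power {α : ℝ} (hα : 1 ≤ α) {a b : L2R} (ha : MemH α a) (hb : MemH α b)
    (has : IsSolenoidal a) (hbs : IsSolenoidal b) (ha4 : MemLp a 4 volume)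
    (hb4 : MemLp b 4 volume) :
    power α (flux a a b b) a + power α (flux a b b a) b = -(‖Lam α a‖ ^ 2 + ‖Lam α b‖ ^ 2) := by
  have h1 := sum_inner_prodField_eq_zero has ha4 (ha.hasH1 hα) (ha.hasH1 hα)
  have h2 := sum_inner_prodField_eq_zero has ha4 (hb.hasH1 hα) (hb.hasH1 hα)
  have h3 := sum_inner_prodField_eq_zero hbs hb4 (hb.hasH1 hα) (ha.hasH1 hα)
  rw [Finset.sum_add_distrib] at h1 h2 h3
  simp only [power, flux, inner_sub_left, Complex.sub_re, Finset.sum_sub_distrib]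
  linarith

theorem energyAndDissipation_eq {T : EReal} {α : ℝ} (hα : 1 ≤ α) {u₀ B₀ : L2R}
    {u B v b : ℝ → L2R} (hu : InEnergyClass T α u) (hB : InEnergyClass T α B)
    (hu4 : InL4 T u) (hB4 : InL4 T B) (huv : u =ᵐ[timeMeasure T] v) (hBb : B =ᵐ[timeMeasure T] b)
    (hui : Integrable (fun t => power α (flux (u t) (u t) (B t) (B t)) (u t)) (timeMeasure T))
    (hBi : Integrable (fun t => power α (flux (u t) (B t) (B t) (u t)) (B t)) (timeMeasure T))
    {t : ℝ} (ht0 : 0 ≤ t) (ht : (t : EReal) < T)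
    (hv : ‖v t‖ ^ 2 = ‖u₀‖ ^ 2 +
      2 * ∫ s in (0 : ℝ)..t, power α (flux (u s) (u s) (B s) (B s)) (u s))
    (hb : ‖b t‖ ^ 2 = ‖B₀‖ ^ 2 +
      2 * ∫ s in (0 : ℝ)..t, power α (flux (u s) (B s) (B s) (u s)) (B s)) :
    energyAndDissipation α v b t = 1 / 2 * ‖u₀‖ ^ 2 + 1 / 2 * ‖B₀‖ ^ 2 := by
  have hii : ∀ {g : ℝ → ℝ}, Integrable g (timeMeasure T) → IntervalIntegrable g volume 0 t :=
    fun hg => (intervalIntegrable_iff_integrableOn_Ioc_of_le ht0).2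
      (IntegrableOn.mono_set hg (Ioc_subset_times ht))
  -- The dissipation integral does not see the change of representatives, so the pointwise
  -- cancellation for `u` and `B` carries over to `v` and `b`.
  have hdiss : ∫ s in (0 : ℝ)..t, (‖Lam α (v s)‖ ^ 2 + ‖Lam α (b s)‖ ^ 2) =
      ∫ s in (0 : ℝ)..t, -(power α (flux (u s) (u s) (B s) (B s)) (u s) +
        power α (flux (u s) (B s) (B s) (u s)) (B s)) := by
    refine intervalIntegral.integral_congr_ae ?_
    have key : ∀ᵐ s ∂(timeMeasure T), ‖Lam α (v s)‖ ^ 2 + ‖Lam α (b s)‖ ^ 2 =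
        -(power α (flux (u s) (u s) (B s) (B s)) (u s) +
          power α (flux (u s) (B s) (B s) (u s)) (B s)) := by
      filter_upwards [huv, hBb, hu.memH, hB.memH, hu.solenoidal, hB.solenoidal, hu4.ae_memLp,
        hB4.ae_memLp] with s h1 h2 h3 h4 h5 h6 h7 h8
      rw [power_add_power hα h3 h4 h5 h6 h7 h8, neg_neg, h1, h2]
    rw [timeMeasure, ae_restrict_iff' (measurableSet_times T)] at key
    filter_upwards [key] with s hs hst
    rw [Set.uIoc_of_le ht0] at hst
    exact hs (Ioc_subset_times ht hst)
  rw [energyAndDissipation, hdiss, intervalIntegral.integral_neg,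
    intervalIntegral.integral_add (hii hui) (hii hBi), hv, hb]
  ring

end FracMHD

/-! ### The energy equality for the system -/

theorem theorem1p1 (α β θ : ℝ) (hα : 1 ≤ α) (hβ : 0 ≤ β) (hθ : 0 ≤ θ)
    (hlow : 1 / 2 ≤ β + θ) (hhigh : β + θ ≤ 1)
    (T : EReal) (hT : 0 < T)
    (u₀ B₀ : FracMHD.L2R)
    (hu₀ : FracMHD.IsSolenoidal u₀) (hB₀ : FracMHD.IsSolenoidal B₀)
    (u B : ℝ → FracMHD.L2R) (hsol : FracMHD.IsLerayHopf T α u₀ B₀ u B)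
    (hu : FracMHD.PowerInMultiplierClass T
      (ENNReal.ofReal (2 * α * (β + θ)) / ENNReal.ofReal (α - θ))
      (θ / (β + θ)) (ENNReal.ofReal (2 * (β + θ))) (2 / (β + θ) - 2) u)
    (hB : FracMHD.PowerInMultiplierClass T
      (ENNReal.ofReal (2 * α * (β + θ)) / ENNReal.ofReal (α - θ))
      (θ / (β + θ)) (ENNReal.ofReal (2 * (β + θ))) (2 / (β + θ) - 2) B) :
    ∃ v b : ℝ → FracMHD.L2R,
      FracMHD.IsWeaklyContinuousRepresentative T u v ∧
      FracMHD.IsWeaklyContinuousRepresentative T B b ∧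
      v 0 = u₀ ∧ b 0 = B₀ ∧
      ∀ t : ℝ, 0 ≤ t → (t : EReal) < T →
        FracMHD.energyAndDissipation α v b t = 1 / 2 * ‖u₀‖ ^ 2 + 1 / 2 * ‖B₀‖ ^ 2 := by
  have hu4 : FracMHD.InL4 T u :=
    FracMHD.exists_integrable_eLpNorm_four_le hα hβ hθ hlow hhigh hsol.u_class hu
  have hB4 : FracMHD.InL4 T B :=
    FracMHD.exists_integrable_eLpNorm_four_le hα hβ hθ hlow hhigh hsol.B_class hB
  have hum := hsol.u_class.memLp_two.1
  have hBm := hsol.B_class.memLp_two.1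
  have hmom : FracMHD.IsWeakSolution T α u₀ u u u B B := hsol.momentum
  have hind : FracMHD.IsWeakSolution T α B₀ B u B B u := hsol.induction_eq
  obtain ⟨v, hv, hv0, hvi, hvE⟩ := hmom.exists_representative hα hT hu4 hu4 hB4 hB4 hsol.u_class hu₀
    (hu4.memLp_flux hu4 hB4 hB4 hum hum hBm hBm)
  obtain ⟨b, hb, hb0, hbi, hbE⟩ := hind.exists_representative hα hT hu4 hB4 hB4 hu4 hsol.B_class hB₀
    (hu4.memLp_flux hB4 hB4 hu4 hum hBm hBm hum)
  exact ⟨v, b, hv, hb, hv0, hb0, fun t ht0 ht => FracMHD.energyAndDissipation_eq hα hsol.u_class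
    hsol.B_class hu4 hB4 hv.ae_eq hb.ae_eq hvi hbi ht0 ht (hvE t ht0 ht) (hbE t ht0 ht)⟩
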